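/- Let $\mu_0\neq 0$ be a non-negative Radon measure on $(0,\infty)$ with $\langle\mu_0,m\wedge 1\rangle=\int_{(0,\infty)}\min(m,1)\,\mu_0(dm)<\infty$ (its mass may be infinite). Put $M_0:=\langle\mu_0,m\rangle\in(0,\infty]$, $K:=\langle\mu_0,m^2\rangle\in(0,\infty]$, $T_{\rm gel}:=1/K\in[0,\infty)$ (so $T_{\rm gel}=0$ if $K=\infty$), and $g_0(x):=\int_{(0,\infty)} m\,x^m\,\mu_0(dm)$, which is finite for $x\in[0,1)$ and analytic on $(0,1)$. A family $(\mu_t)_{t\ge 0}$ of non-negative Radon measures on $(0,\infty)$, equal to $\mu_0$ at $t=0$, is called a solution of Smoluchowski's equation with kernel $mm'$ if * for every $t>0$, $\int_0^t\langle\mu_s,m\rangle^2\,ds<\infty$; * for every continuous $\phi:(0,\infty)\to\mathbb R$ with compact support and every $t>0$, $$\langle\mu_t,\phi\rangle=\langle\mu_0,\phi\rangle+\frac12\int_0^t\iint mm'\bigl(\phi(m+m')-\phi(m)-\phi(m')\bigr)\,\mu_s(dm)\,\mu_s(dm')\,ds,$$ where the integrand of the time integral is Lebesgue integrable on $[0,t]$;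 * if $\langle\mu_0,m^2\rangle<\infty$, then $t\mapsto\langle\mu_t,m^2\rangle$ is bounded in a right neighbourhood of $0$. Then there is exactly one solution $(\mu_t)_{t\ge0}$, and it has the following properties. 1. The total mass $M_t:=\langle\mu_t,m\rangle$ is continuous on $[0,\infty)$ as a function with values in $[0,\infty]$, and is finite for every $t>0$. It is constant on $[0,T_{\rm gel}]$, strictly decreasing on $[T_{\rm gel},\infty)$, and analytic on $[0,\infty)\setminus\{T_{\rm gel}\}$. 2. If the limit $$\nu:=-\lim_{x\to1^-}\frac{(g_0'(x))^3}{g_0'(x)+x\,g_0''(x)}$$ exists in $[-\infty,\infty]$, then $\nu\in[-\infty,0]$ and the right derivative of $M$ at $T_{\rm gel}$ is $\nu$, that is, $\lim_{t\to T_{\rm gel}^+}\frac{M_t-M_{T_{\rm gel}}}{t-T_{\rm gel}}=\nu$ in $[-\infty,\infty]$ (the quotient being $-\infty$ if $M_{T_{\rm gel}}=\infty$). 3. Let $m_0:=\inf\operatorname{supp}\mu_0\in[0,\infty)$. Then $\dfrac1{tM_t}\to m_0$ as $t\to\infty$. 4. The second moment $\langle\mu_t,m^2\rangle$ is finite for $t\in[0,T_{\rm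 gel})$ and infinite for $t\in[T_{\rm gel},\infty)$. -/

import Mathlib

open MeasureTheory Set Filter Topology
open scoped ENNReal

noncomputable section

namespace Smoluchowski

/-- Non-negative Radon measures on the open half-line `(0, ∞)`, seen as Borel measures on `ℝ`
that give no mass to `(-∞, 0]` and are finite on compact subsets of `(0, ∞)`. -/
structure IsRadonOnPos (μ : Measure ℝ) : Prop where
  null_nonpos : μ (Iic 0) = 0
  finite_Icc : ∀ a b : ℝ, 0 < a → μ (Icc a b) < ∞

/-- The first moment (total mass) `⟨μ, m⟩ ∈ [0, ∞]`. -/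
def mass (μ : Measure ℝ) : ℝ≥0∞ := ∫⁻ m, ENNReal.ofReal m ∂μ

/-- The second moment `⟨μ, m²⟩ ∈ [0, ∞]`. -/
def secondMoment (μ : Measure ℝ) : ℝ≥0∞ := ∫⁻ m, ENNReal.ofReal (m ^ 2) ∂μ

/-- Test functions: continuous functions with compact support in `(0, ∞)` (extended by `0`). -/
structure IsTestFunction (φ : ℝ → ℝ) : Prop where
  continuous : Continuous φ
  hasCompactSupport : HasCompactSupport φ
  tsupport_subset : tsupport φ ⊆ Ioi 0

/-- The coagulation term `⟨μ(dm) μ(dm'), m m' (φ(m + m') - φ(m) - φ(m'))⟩`. -/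
def coagulation (μ : Measure ℝ) (φ : ℝ → ℝ) : ℝ :=
  ∫ p : ℝ × ℝ, p.1 * p.2 * (φ (p.1 + p.2) - φ p.1 - φ p.2) ∂(μ.prod μ)

/-- The family `(μ t)`, `t ≥ 0`, is a (global, weak) solution of Smoluchowski's equation with
kernel `m m'` started from `μ₀`. The values of `μ` at negative times play no role. The condition
`integrable` says that the time integral in the equation makes sense as a Lebesgue integral. -/
structure IsSolution (μ₀ : Measure ℝ) (μ : ℝ → Measure ℝ) : Prop where
  initial : μ 0 = μ₀
  radon : ∀ t : ℝ, 0 ≤ t → IsRadonOnPos (μ t)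
  mass_sq : ∀ t : ℝ, 0 < t → ∫⁻ s in Ioc 0 t, mass (μ s) ^ 2 < ∞
  integrable : ∀ φ : ℝ → ℝ, IsTestFunction φ → ∀ t : ℝ, 0 < t →
    IntervalIntegrable (fun s => coagulation (μ s) φ) volume 0 t
  equation : ∀ φ : ℝ → ℝ, IsTestFunction φ → ∀ t : ℝ, 0 < t →
    ∫ m, φ m ∂(μ t) = ∫ m, φ m ∂μ₀ + 1 / 2 * ∫ s in (0 : ℝ)..t, coagulation (μ s) φ
  secondMoment_bounded : secondMoment μ₀ < ∞ →
    ∃ ε : ℝ, 0 < ε ∧ ∃ C : ℝ≥0∞, C < ∞ ∧ ∀ t ∈ Ico 0 ε, secondMoment (μ t) ≤ C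

/-- The generating function `g(x) = ⟨μ, m x ^ m⟩`, used for `x ∈ [0, 1)`, where it is finite. -/
def genFun (μ : Measure ℝ) (x : ℝ) : ℝ := ∫ m, m * x ^ m ∂μ

/-- The gelation time `1 / ⟨μ, m²⟩`, equal to `0` if `⟨μ, m²⟩ = ∞`. -/
def gelTime (μ : Measure ℝ) : ℝ := ((secondMoment μ)⁻¹).toReal

end Smoluchowski

end

/-!
Write `h_t(y) = ⟨μ_t, m e^{-ym}⟩`, so that `M_t = h_t(0)` and `∂_y h_t(y) = -⟨μ_t, m² e^{-ym}⟩`.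
Tested against `m e^{-ym}`, Smoluchowski's equation reads `∂ₜ h = (M - h) ∂_y h`: the function `h`
is constant along the characteristics `t ↦ y + t h₀(y) - ∫₀ᵗ M_s ds` as long as these stay in
`(0, ∞)`.

*Uniqueness.* For any solution the mass is finite and nonincreasing for positive times, because
coagulation decreases the integrals of the subadditive functions `m ∧ k`
(`IsSolution.antitoneOn_mass`). This gives enough regularity to follow the characteristics that
start far enough to the right (`IsSolution.characteristics`), with `A_t = ∫₀ᵗ M_s ds` as the only
unknown: for two solutions, `h_T(z - A_T) = h'_T(z - A'_T)` for large `z`, which means that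
`m μ_T(dm)` and `m μ'_T(dm)` agree up to an exponential tilt (`IsSolution.tilt_eq`). The tilt shows
that the solution with the larger `A` has the smaller mass, which is the derivative of `A`; hence
`(A - A')²` is nonincreasing and vanishes, and the two solutions coincide (`IsSolution.unique`).

*Existence.* Let `l_t` (`foot`) be the point where the convex function `y ↦ y + t h₀(y)` attains
its minimum `a_t` (`front`). The point `l_t` is `0` up to the gelation time, and afterwards it is
the solution of `t ⟨μ₀, m² e^{-lm}⟩ = 1`. A solution should have `∫₀ᵗ M_s ds = a_t`, so that `μ_t`
should satisfy `h_t(y + t h₀(y) - a_t) = h₀(y)` for `y ≥ l_t` (`IsTransported`). Such a measure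
exists: with `ν(dm) = t m μ₀(dm)`, the number `w = t h₀(y)` solves the equation `w = ℒν(z - w)` at
`z = y + t h₀(y)`, and the minimal solution of this equation is the Laplace transform of the total
progeny of a branching process, the limit of an iteration of compound Poisson type
(`exists_progeny`). On the half-line `y ≥ l_t` the map `y ↦ y + t h₀(y)` is injective, so that `w`
is the minimal solution, and tilting the progeny by `e^{-a_t m}` gives `μ_t`
(`IsAdmissible.exists_transported`). Differentiation along characteristics proves the equation for
the test functions `m e^{-ym}` (`IsTransported.satisfiesEquation_exp`), and the Weierstrass theorem
in the variable `e^{-m}` extends it to all test functions (`IsTransported.isSolution`). The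
condition `∫₀ᵗ M_s² ds < ∞` is checked on an explicit primitive of `M²`
(`IsTransported.integrableOn_mass_sq`).

*Properties.* By construction `M_t = h₀(l_t)` (`IsTransported.mass_eq`), so that all statements
about the mass follow from the equation `t ⟨μ₀, m² e^{-lm}⟩ = 1` for `l = l_t`: analyticity from
the inverse function theorem; the derivative `-⟨μ₀, m² e^{-lm}⟩³ / ⟨μ₀, m³ e^{-lm}⟩`, which at
`x = e^{-l}` is the quotient built from the generating function up to the factor `x²`, and with
L'Hôpital's rule the right derivative at the gelation time; and the identity
`1 / (t M_t) = ⟨μ₀, m² e^{-lm}⟩ / ⟨μ₀, m e^{-lm}⟩`, whose right-hand side is a mean of `m` that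
concentrates at `inf supp μ₀` as `l → ∞`. The second moment of `μ_t` is the limit of
`⟨μ₀, m² e^{-wm}⟩ / (1 - t ⟨μ₀, m² e^{-wm}⟩)` as `w ↓ l_t`, which is infinite exactly from the
gelation time on.
-/

noncomputable section

namespace Smoluchowski

section

/-! ### Laplace moments -/

/-- The class of measures in which the equation is solved: Radon measures on `(0, ∞)` with
`⟨μ, m ∧ 1⟩ < ∞`. -/
structure IsAdmissible (μ : Measure ℝ) : Prop extends IsRadonOnPos μ where
  min_lt_top : ∫⁻ m, ENNReal.ofReal (min m 1) ∂μ < ∞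

/-- The Laplace moment `⟨μ, m ^ n e^{-ym}⟩` with values in `[0, ∞]`. -/
def lapE (n : ℕ) (μ : Measure ℝ) (y : ℝ) : ℝ≥0∞ :=
  ∫⁻ m, ENNReal.ofReal (m ^ n * Real.exp (-(y * m))) ∂μ

/-- The Laplace moment `⟨μ, m ^ n e^{-ym}⟩` as a real number. -/
def lap (n : ℕ) (μ : Measure ℝ) (y : ℝ) : ℝ := ∫ m, m ^ n * Real.exp (-(y * m)) ∂μ

variable {μ : Measure ℝ} {n : ℕ} {y : ℝ}

lemma mass_eq_lapE (μ : Measure ℝ) : mass μ = lapE 1 μ 0 := by simp [mass, lapE]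

lemma secondMoment_eq_lapE (μ : Measure ℝ) : secondMoment μ = lapE 2 μ 0 := by
  simp [secondMoment, lapE]

lemma IsRadonOnPos.ae_pos (h : IsRadonOnPos μ) : ∀ᵐ m ∂μ, 0 < m := by
  have := h.null_nonpos
  rw [ae_iff]
  simpa [Iic, not_lt] using this

lemma IsRadonOnPos.sigmaFinite (h : IsRadonOnPos μ) : SigmaFinite μ := by
  refine ⟨⟨⟨fun k => Iic 0 ∪ Icc (1 / ((k : ℝ) + 1)) k, fun _ => trivial, fun k => ?_, ?_⟩⟩⟩
  · refine (measure_union_le _ _).trans_lt ?_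
    rw [h.null_nonpos, zero_add]
    exact h.finite_Icc _ _ (by positivity)
  · refine eq_univ_of_forall fun x => ?_
    rcases le_or_gt x 0 with hx | hx
    · exact mem_iUnion.2 ⟨0, Or.inl hx⟩
    obtain ⟨k₁, hk₁⟩ := exists_nat_one_div_lt hx
    obtain ⟨k₂, hk₂⟩ := exists_nat_ge x
    refine mem_iUnion.2 ⟨max k₁ k₂, Or.inr ⟨le_trans ?_ hk₁.le, hk₂.trans ?_⟩⟩
    · gcongr
      exact le_max_left _ _
    · exact_mod_cast le_max_right _ _

lemma lap_eq_toReal (h : IsRadonOnPos μ) (n : ℕ) (y : ℝ) : lap n μ y = (lapE n μ y).toReal := by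
  rw [lap, lapE, integral_eq_lintegral_of_nonneg_ae]
  · filter_upwards [h.ae_pos] with m hm
    simp only [Pi.zero_apply]
    positivity
  · exact Measurable.aestronglyMeasurable (by fun_prop)

lemma pow_mul_exp_neg_le {m : ℝ} (hm : 0 ≤ m) (hy : 0 < y) (n : ℕ) :
    m ^ n * Real.exp (-(y * m)) ≤ n.factorial / y ^ n := by
  have h := Real.pow_div_factorial_le_exp (y * m) (by positivity) n
  rw [Real.exp_neg, ← div_eq_mul_inv, div_le_div_iff₀ (Real.exp_pos _) (by positivity)]
  rw [div_le_iff₀ (by positivity), mul_pow] at h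
  linarith

lemma pow_mul_exp_neg_le_min {m : ℝ} (hm : 0 < m) (hy : 0 < y) (hn : 1 ≤ n) :
    m ^ n * Real.exp (-(y * m)) ≤ (1 + n.factorial / y ^ n) * min m 1 := by
  have h0 : (0 : ℝ) ≤ n.factorial / y ^ n := by positivity
  rcases le_total m 1 with h1 | h1
  · rw [min_eq_left h1]
    have h2 : m ^ n * Real.exp (-(y * m)) ≤ m ^ 1 * 1 :=
      mul_le_mul (pow_le_pow_of_le_one hm.le h1 hn)
        (Real.exp_le_one_iff.2 (by nlinarith)) (Real.exp_pos _).le (by positivity)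
    nlinarith
  · rw [min_eq_right h1]
    linarith [pow_mul_exp_neg_le hm.le hy n]

lemma IsAdmissible.integrable_min (h : IsAdmissible μ) : Integrable (fun m => min m 1) μ := by
  refine ⟨Measurable.aestronglyMeasurable (by fun_prop), ?_⟩
  refine lt_of_eq_of_lt (lintegral_congr_ae ?_) h.min_lt_top
  filter_upwards [h.ae_pos] with m hm
  rw [← ofReal_norm, Real.norm_of_nonneg (by positivity)]

lemma IsAdmissible.integrable (h : IsAdmissible μ) {φ : ℝ → ℝ} {C : ℝ}
    (hφ : AEStronglyMeasurable φ μ) (hC : ∀ m, 0 < m → |φ m| ≤ C * min m 1) : Integrable φ μ := by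
  refine (h.integrable_min.const_mul C).mono' hφ ?_
  filter_upwards [h.ae_pos] with m hm using hC m hm

lemma IsAdmissible.integrable_lap (h : IsAdmissible μ) (hn : 1 ≤ n) (hy : 0 < y) :
    Integrable (fun m => m ^ n * Real.exp (-(y * m))) μ := by
  refine h.integrable (C := 1 + n.factorial / y ^ n)
    (Measurable.aestronglyMeasurable (by fun_prop)) fun m hm => ?_
  rw [abs_of_nonneg (by positivity)]
  exact pow_mul_exp_neg_le_min hm hy hn

lemma lapE_eq_ofReal (h : IsRadonOnPos μ)
    (hi : Integrable (fun m => m ^ n * Real.exp (-(y * m))) μ) :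
    lapE n μ y = ENNReal.ofReal (lap n μ y) := by
  rw [lap, lapE, ofReal_integral_eq_lintegral_ofReal hi]
  filter_upwards [h.ae_pos] with m hm
  simp only [Pi.zero_apply]
  positivity

lemma integrable_of_lapE_lt_top (h : IsRadonOnPos μ) (hi : lapE n μ y < ∞) :
    Integrable (fun m => m ^ n * Real.exp (-(y * m))) μ := by
  refine ⟨Measurable.aestronglyMeasurable (by fun_prop), ?_⟩
  refine lt_of_eq_of_lt (lintegral_congr_ae ?_) hi
  filter_upwards [h.ae_pos] with m hm
  rw [← ofReal_norm, Real.norm_of_nonneg (by positivity)]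

lemma IsAdmissible.lapE_lt_top (h : IsAdmissible μ) (hn : 1 ≤ n) (hy : 0 < y) :
    lapE n μ y < ∞ := by
  rw [lapE_eq_ofReal h.toIsRadonOnPos (h.integrable_lap hn hy)]
  exact ENNReal.ofReal_lt_top

lemma lapE_antitone (h : IsRadonOnPos μ) (n : ℕ) : Antitone (lapE n μ) := by
  intro y z hyz
  refine lintegral_mono_ae ?_
  filter_upwards [h.ae_pos] with m hm
  gcongr

/-- Monotone convergence: a Laplace moment, possibly infinite, is the supremum of its values on the
right. -/
lemma lapE_le_of_forall_gt (h : IsRadonOnPos μ) {c : ℝ≥0∞}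
    (hc : ∀ z, y < z → lapE n μ z ≤ c) : lapE n μ y ≤ c := by
  have key : Tendsto (fun k : ℕ => lapE n μ (y + 1 / ((k : ℝ) + 1))) atTop (𝓝 (lapE n μ y)) := by
    refine lintegral_tendsto_of_tendsto_of_monotone (fun k => by fun_prop) ?_ ?_
    · filter_upwards [h.ae_pos] with m hm
      intro i j hij
      refine ENNReal.ofReal_le_ofReal ?_
      gcongr
    · filter_upwards [h.ae_pos] with m hm
      refine (ENNReal.continuous_ofReal.tendsto _).comp ?_
      have h1 : Tendsto (fun k : ℕ => y + 1 / ((k : ℝ) + 1)) atTop (𝓝 (y + 0)) :=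
        tendsto_const_nhds.add tendsto_one_div_add_atTop_nhds_zero_nat
      rw [add_zero] at h1
      exact tendsto_const_nhds.mul ((Real.continuous_exp.tendsto _).comp (h1.mul_const m).neg)
  exact le_of_tendsto' key fun k => hc _ (by simp; positivity)

/-! ### Regularity of the Laplace moments -/

/-- The measure `m μ(dm)`, whose moment generating function provides the regularity of the Laplace
moments. -/
lemma integral_withDensity_id (h : IsRadonOnPos μ) (f : ℝ → ℝ) :
    ∫ m, f m ∂(μ.withDensity fun m => ENNReal.ofReal m) = ∫ m, m * f m ∂μ := by
  rw [integral_withDensity_eq_integral_toReal_smul (by fun_prop) (by simp)]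
  refine integral_congr_ae ?_
  filter_upwards [h.ae_pos] with m hm
  simp [ENNReal.toReal_ofReal hm.le]

lemma IsAdmissible.neg_mem_interior (h : IsAdmissible μ) (hy : 0 < y) :
    -y ∈ interior (ProbabilityTheory.integrableExpSet id
      (μ.withDensity fun m => ENNReal.ofReal m)) := by
  rw [mem_interior]
  refine ⟨Iio 0, fun z hz => ?_, isOpen_Iio, by simpa using hy⟩
  rw [ProbabilityTheory.integrableExpSet, Set.mem_ofPred_eq,
    integrable_withDensity_iff_integrable_smul' (by fun_prop) (by simp)]
  refine (h.integrable_lap le_rfl (neg_pos.2 hz)).congr ?_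
  filter_upwards [h.ae_pos] with m hm
  simp [ENNReal.toReal_ofReal hm.le]

lemma lap_succ_eq (h : IsRadonOnPos μ) (n : ℕ) (y : ℝ) :
    lap (n + 1) μ y = ∫ m, (id m) ^ n * Real.exp (-y * id m)
      ∂(μ.withDensity fun m => ENNReal.ofReal m) := by
  rw [integral_withDensity_id h, lap]
  refine integral_congr_ae (Eventually.of_forall fun m => ?_)
  simp only [id]
  ring_nf

lemma IsAdmissible.hasDerivAt_lap (h : IsAdmissible μ) (hn : 1 ≤ n) (hy : 0 < y) :
    HasDerivAt (lap n μ) (-lap (n + 1) μ y) y := by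
  obtain ⟨n, rfl⟩ := Nat.exists_eq_add_of_le' hn
  have h1 := ProbabilityTheory.hasDerivAt_integral_pow_mul_exp_real (h.neg_mem_interior hy) n
  have h2 := h1.scomp y (hasDerivAt_neg y)
  rw [lap_succ_eq h.toIsRadonOnPos (n + 1) y]
  refine (h2.congr_deriv (by simp)).congr_of_eventuallyEq (Eventually.of_forall fun z => ?_)
  simp only [Function.comp]
  rw [lap_succ_eq h.toIsRadonOnPos]

lemma IsAdmissible.continuousAt_lap (h : IsAdmissible μ) (hn : 1 ≤ n) (hy : 0 < y) :
    ContinuousAt (lap n μ) y := (h.hasDerivAt_lap hn hy).continuousAt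

lemma IsAdmissible.analyticAt_lap (h : IsAdmissible μ) (hn : 1 ≤ n) (hy : 0 < y) :
    AnalyticAt ℝ (lap n μ) y := by
  obtain ⟨n, rfl⟩ := Nat.exists_eq_add_of_le' hn
  have h1 := (ProbabilityTheory.analyticAt_iteratedDeriv_mgf (h.neg_mem_interior hy) n).comp
    (analyticAt_id.neg : AnalyticAt ℝ (fun z : ℝ => -z) y)
  refine h1.congr ?_
  filter_upwards [lt_mem_nhds hy] with z hz
  simp only [Function.comp]
  rw [ProbabilityTheory.iteratedDeriv_mgf (h.neg_mem_interior hz), lap_succ_eq h.toIsRadonOnPos]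

lemma IsRadonOnPos.lapE_pos (h : IsRadonOnPos μ) (hne : μ ≠ 0) (n : ℕ) (y : ℝ) :
    0 < lapE n μ y := by
  rw [pos_iff_ne_zero]
  intro h0
  rw [lapE, lintegral_eq_zero_iff (by fun_prop)] at h0
  have : ∀ᵐ m ∂μ, False := by
    filter_upwards [h0, h.ae_pos] with m hm hm0
    have : (0 : ℝ) < m ^ n * Real.exp (-(y * m)) := by positivity
    simp at hm
    linarith
  rw [ae_iff] at this
  exact hne (by simpa using this)

lemma IsAdmissible.lap_pos (h : IsAdmissible μ) (hne : μ ≠ 0) (hn : 1 ≤ n) (hy : 0 < y) :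
    0 < lap n μ y := by
  rw [lap_eq_toReal h.toIsRadonOnPos]
  exact ENNReal.toReal_pos (h.lapE_pos hne n y).ne' (h.lapE_lt_top hn hy).ne

lemma lap_nonneg (h : IsRadonOnPos μ) (n : ℕ) (y : ℝ) : 0 ≤ lap n μ y := by
  rw [lap_eq_toReal h]
  exact ENNReal.toReal_nonneg

lemma IsAdmissible.strictAntiOn_lap (h : IsAdmissible μ) (hne : μ ≠ 0) (hn : 1 ≤ n) :
    StrictAntiOn (lap n μ) (Ioi 0) := by
  refine strictAntiOn_of_deriv_neg (convex_Ioi 0)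
    (fun y hy => (h.continuousAt_lap hn hy).continuousWithinAt) fun y hy => ?_
  rw [interior_Ioi] at hy
  rw [(h.hasDerivAt_lap hn hy).deriv]
  linarith [h.lap_pos hne (n := n + 1) (by omega) hy]

lemma IsAdmissible.tendsto_lap_atTop (h : IsAdmissible μ) (hn : 1 ≤ n) :
    Tendsto (lap n μ) atTop (𝓝 0) := by
  have h0 : (0 : ℝ) = ∫ m, (0 : ℝ) ∂μ := by simp
  rw [h0]
  refine tendsto_integral_filter_of_dominated_convergence
    (fun m => m ^ n * Real.exp (-(1 * m))) ?_ ?_ (h.integrable_lap hn one_pos) ?_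
  · exact Eventually.of_forall fun y => Measurable.aestronglyMeasurable (by fun_prop)
  · filter_upwards [eventually_ge_atTop 1] with y hy
    filter_upwards [h.ae_pos] with m hm
    rw [Real.norm_of_nonneg (by positivity)]
    gcongr
  · filter_upwards [h.ae_pos] with m hm
    rw [← mul_zero (m ^ n)]
    refine tendsto_const_nhds.mul (Real.tendsto_exp_neg_atTop_nhds_zero.comp ?_)
    exact tendsto_id.atTop_mul_const hm

lemma lapE_tendsto_nhdsGT (h : IsRadonOnPos μ) (n : ℕ) (y : ℝ) :
    Tendsto (lapE n μ) (𝓝[>] y) (𝓝 (lapE n μ y)) := by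
  refine tendsto_order.2 ⟨fun c hc => ?_, fun c hc => ?_⟩
  · by_contra hcon
    refine absurd (lapE_le_of_forall_gt h (c := c) fun z hz => ?_) (not_le.2 hc)
    by_contra! hlt
    refine hcon ?_
    filter_upwards [Ioo_mem_nhdsGT hz] with w hw
    exact hlt.trans_le (lapE_antitone h n hw.2.le)
  · filter_upwards [self_mem_nhdsWithin] with z hz
    exact (lapE_antitone h n (le_of_lt hz)).trans_lt hc

lemma IsAdmissible.continuousOn_lapE (h : IsAdmissible μ) (hn : 1 ≤ n) :
    ContinuousOn (lapE n μ) (Ici 0) := by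
  intro y hy
  rcases eq_or_lt_of_le (show (0 : ℝ) ≤ y from hy) with rfl | hy
  · rw [← Ioi_insert, continuousWithinAt_insert_self]
    exact lapE_tendsto_nhdsGT h.toIsRadonOnPos n 0
  · refine ContinuousAt.continuousWithinAt ?_
    have h1 := ENNReal.continuous_ofReal.continuousAt.comp (h.continuousAt_lap hn hy)
    refine h1.congr ?_
    filter_upwards [lt_mem_nhds hy] with z hz
    simp [lapE_eq_ofReal h.toIsRadonOnPos (h.integrable_lap hn hz)]

/-- The tangent inequality for the convex function `y ↦ ⟨μ, m e^{-ym}⟩`, up to the boundary point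
`0`. -/
lemma lap_one_tangent (h : IsRadonOnPos μ) {y z : ℝ}
    (h1 : lapE 1 μ y < ∞) (h2 : lapE 2 μ y < ∞) (h3 : lapE 1 μ z < ∞) :
    lap 1 μ y - lap 2 μ y * (z - y) ≤ lap 1 μ z := by
  have i1 := integrable_of_lapE_lt_top h h1
  have i2 := integrable_of_lapE_lt_top h h2
  have i3 := integrable_of_lapE_lt_top h h3
  rw [lap, lap, lap, ← integral_mul_const, ← integral_sub i1 (i2.mul_const _)]
  refine integral_mono_ae (i1.sub (i2.mul_const _)) i3 ?_
  filter_upwards [h.ae_pos] with m hm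
  have e : Real.exp (-(z * m)) = Real.exp (-(y * m)) * Real.exp (-((z - y) * m)) := by
    rw [← Real.exp_add]; ring_nf
  have := Real.add_one_le_exp (-((z - y) * m))
  have hp : 0 < m * Real.exp (-(y * m)) := by positivity
  rw [e]
  nlinarith

/-- If the second moment and the truncated first moment are finite, then so is the mass. -/
lemma IsAdmissible.mass_lt_top (h : IsAdmissible μ) (h2 : secondMoment μ < ∞) : mass μ < ∞ := by
  refine lt_of_le_of_lt ?_ (ENNReal.add_lt_top.2 ⟨h.min_lt_top, h2⟩)
  rw [secondMoment, ← lintegral_add_left (by fun_prop)]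
  refine lintegral_mono_ae ?_
  filter_upwards [h.ae_pos] with m hm
  rw [← ENNReal.ofReal_add (by positivity) (by positivity)]
  refine ENNReal.ofReal_le_ofReal ?_
  rcases le_total m 1 with h1 | h1
  · rw [min_eq_left h1]; nlinarith
  · rw [min_eq_right h1]; nlinarith

end

section

/-! ### A branching measure -/

/-- The limit of an increasing sequence of measures. -/
lemma exists_measure_iSup {α : Type*} [MeasurableSpace α] (ρ : ℕ → Measure α) (hρ : Monotone ρ) :
    ∃ σ : Measure α, ∀ f : α → ℝ≥0∞, Measurable f → ∫⁻ x, f x ∂σ = ⨆ k, ∫⁻ x, f x ∂(ρ k) := by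
  have happ : ∀ s : Set α, Monotone fun k => ρ k s := fun s i j hij => hρ hij s
  refine ⟨Measure.ofMeasurable (fun s _ => ⨆ k, ρ k s) (by simp) fun s hs hd => ?_, ?_⟩
  · simp_rw [measure_iUnion hd hs, ENNReal.tsum_eq_iSup_sum]
    rw [iSup_comm]
    refine iSup_congr fun F => ?_
    rw [ENNReal.finsetSum_iSup_of_monotone fun i => happ (s i)]
  set σ := Measure.ofMeasurable (fun s _ => ⨆ k, ρ k s) (by simp) _ with hσ
  have hσa : ∀ s, MeasurableSet s → σ s = ⨆ k, ρ k s := fun s hs => Measure.ofMeasurable_apply s hs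
  intro f hf
  refine Measurable.ennreal_induction (fun c s hs => ?_) (fun f g _ hf _ hf' hg' => ?_)
    (fun f hf hm hfi => ?_) hf
  · simp_rw [lintegral_indicator_const hs, hσa s hs, ENNReal.mul_iSup]
  · simp_rw [Pi.add_apply, lintegral_add_left hf, hf', hg']
    refine ENNReal.iSup_add_iSup_of_monotone ?_ ?_ <;>
      exact fun i j hij => lintegral_mono' (hρ hij) le_rfl
  · simp_rw [lintegral_iSup hf hm, hfi]
    rw [iSup_comm]

/-- Convolution powers of a measure on the line. -/
def convPow (ρ : Measure ℝ) : ℕ → Measure ℝ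
  | 0 => Measure.dirac 0
  | j + 1 => ρ ∗ convPow ρ j

/-- The compound Poisson type operation `ρ ↦ ∫ ν(dm) δ_m ∗ exp(m ρ)`, where `exp` denotes the
exponential with respect to convolution. -/
def branch (ν ρ : Measure ℝ) : Measure ℝ :=
  Measure.sum fun j : ℕ =>
    (ν.withDensity fun m => ENNReal.ofReal (m ^ j / j.factorial)) ∗ convPow ρ j

/-- The Laplace transform of a measure on the line, with values in `[0, ∞]`. -/
def expL (ρ : Measure ℝ) (z : ℝ) : ℝ≥0∞ := ∫⁻ m, ENNReal.ofReal (Real.exp (-(z * m))) ∂ρ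

instance sFinite_convPow (ρ : Measure ℝ) [SFinite ρ] (j : ℕ) : SFinite (convPow ρ j) := by
  induction j with
  | zero => exact inferInstanceAs (SFinite (Measure.dirac 0))
  | succ j ih => exact inferInstanceAs (SFinite (ρ ∗ convPow ρ j))

instance sFinite_branch (ν ρ : Measure ℝ) [SFinite ν] [SFinite ρ] : SFinite (branch ν ρ) := by
  unfold branch; infer_instance

lemma expL_conv (ρ σ : Measure ℝ) [SFinite ρ] [SFinite σ] (z : ℝ) :
    expL (ρ ∗ σ) z = expL ρ z * expL σ z := by
  simp only [expL]
  rw [Measure.lintegral_conv (by fun_prop)]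
  simp_rw [mul_add, neg_add, Real.exp_add, ENNReal.ofReal_mul (Real.exp_pos _).le]
  simp_rw [lintegral_const_mul _ (show Measurable fun m : ℝ =>
    ENNReal.ofReal (Real.exp (-(z * m))) by fun_prop)]
  rw [lintegral_mul_const _ (by fun_prop)]

lemma expL_convPow (ρ : Measure ℝ) [SFinite ρ] (z : ℝ) (j : ℕ) :
    expL (convPow ρ j) z = expL ρ z ^ j := by
  induction j with
  | zero => simp [expL, convPow]
  | succ j ih => rw [convPow, expL_conv, ih, pow_succ']

/-- `ℒ(branch ν ρ)(z) = ℒν(z - ℒρ(z))`, by summation of the exponential series. -/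
lemma expL_branch {ν ρ : Measure ℝ} [SFinite ν] [SFinite ρ] (hν : ∀ᵐ m ∂ν, 0 < m) {z w : ℝ}
    (hw : 0 ≤ w) (h : expL ρ z = ENNReal.ofReal w) : expL (branch ν ρ) z = expL ν (z - w) := by
  have h1 : ∀ j : ℕ, expL ((ν.withDensity fun m => ENNReal.ofReal (m ^ j / j.factorial)) ∗
      convPow ρ j) z = ∫⁻ m, ENNReal.ofReal (Real.exp (-(z * m))) *
        (ENNReal.ofReal (m ^ j / j.factorial) * ENNReal.ofReal w ^ j) ∂ν := by
    intro j
    rw [expL_conv, expL_convPow, h, expL,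
      lintegral_withDensity_eq_lintegral_mul _ (by fun_prop) (by fun_prop),
      ← lintegral_mul_const _ (by fun_prop)]
    refine lintegral_congr fun m => ?_
    simp only [Pi.mul_apply]
    ring
  rw [branch, expL, lintegral_sum_measure]
  simp only [expL] at h1
  simp_rw [h1]
  rw [← lintegral_tsum (fun j => by fun_prop), expL]
  refine lintegral_congr_ae ?_
  filter_upwards [hν] with m hm
  simp_rw [ENNReal.tsum_mul_left]
  have h2 : HasSum (fun j : ℕ => (m * w) ^ j / j.factorial) (Real.exp (m * w)) := by
    rw [Real.exp_eq_exp_ℝ]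
    exact NormedSpace.expSeries_div_hasSum_exp (m * w)
  have h3 : ∑' j : ℕ, ENNReal.ofReal (m ^ j / j.factorial) * ENNReal.ofReal w ^ j
      = ENNReal.ofReal (Real.exp (m * w)) := by
    rw [← h2.tsum_eq, ENNReal.ofReal_tsum_of_nonneg (fun j => by positivity) h2.summable]
    refine tsum_congr fun j => ?_
    rw [← ENNReal.ofReal_pow hw, ← ENNReal.ofReal_mul (by positivity)]
    congr 1
    rw [mul_pow]
    ring
  rw [h3, ← ENNReal.ofReal_mul (Real.exp_pos _).le, ← Real.exp_add]
  congr 2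
  ring

lemma convPow_mono {ρ σ : Measure ℝ} [SFinite ρ] [SFinite σ] (h : ρ ≤ σ) (j : ℕ) :
    convPow ρ j ≤ convPow σ j := by
  induction j with
  | zero => exact le_rfl
  | succ j ih => exact Measure.map_mono (Measure.prod_mono h ih) (by fun_prop)

lemma branch_mono (ν : Measure ℝ) {ρ σ : Measure ℝ} [SFinite ν] [SFinite ρ] [SFinite σ]
    (h : ρ ≤ σ) : branch ν ρ ≤ branch ν σ := by
  refine Measure.le_iff.2 fun s hs => ?_
  rw [branch, branch, Measure.sum_apply _ hs, Measure.sum_apply _ hs]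
  exact ENNReal.tsum_le_tsum fun j =>
    Measure.map_mono (Measure.prod_mono le_rfl (convPow_mono h j)) (by fun_prop) s

lemma ae_pos_conv {ρ σ : Measure ℝ} [SFinite σ] (hρ : ∀ᵐ m ∂ρ, 0 < m) (hσ : ∀ᵐ m ∂σ, 0 ≤ m) :
    ∀ᵐ m ∂(ρ ∗ σ), 0 < m := by
  rw [Measure.conv, ae_map_iff (by fun_prop) measurableSet_Ioi]
  filter_upwards [Measure.quasiMeasurePreserving_fst.ae hρ,
    Measure.quasiMeasurePreserving_snd.ae hσ] with p h1 h2
  linarith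

lemma ae_nonneg_convPow {ρ : Measure ℝ} [SFinite ρ] (hρ : ∀ᵐ m ∂ρ, 0 < m) (j : ℕ) :
    ∀ᵐ m ∂(convPow ρ j), 0 ≤ m := by
  induction j with
  | zero => simp [convPow]
  | succ j ih => exact (ae_pos_conv hρ ih).mono fun m hm => hm.le

lemma ae_pos_branch {ν ρ : Measure ℝ} [SFinite ρ] (hν : ∀ᵐ m ∂ν, 0 < m)
    (hρ : ∀ᵐ m ∂ρ, 0 < m) : ∀ᵐ m ∂(branch ν ρ), 0 < m := by
  rw [branch, Measure.ae_sum_iff]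
  exact fun j => ae_pos_conv ((withDensity_absolutelyContinuous _ _).ae_le hν)
    (ae_nonneg_convPow hρ j)

/-- The total progeny of the branching process with offspring law governed by `ν`: a measure `ρ`
on `(0, ∞)` whose Laplace transform `w` at `z` is the minimal solution of `w = ℒν(z - w)`. In
particular it is finite and bounded by any given solution `W`. -/
theorem exists_progeny (ν : Measure ℝ) [SFinite ν] (hν : ∀ᵐ m ∂ν, 0 < m) :
    ∃ ρ : Measure ℝ, (∀ᵐ m ∂ρ, 0 < m) ∧ ∀ z W : ℝ, 0 ≤ W → expL ν (z - W) = ENNReal.ofReal W →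
      ∃ w, 0 ≤ w ∧ w ≤ W ∧ expL ρ z = ENNReal.ofReal w ∧ expL ν (z - w) = ENNReal.ofReal w := by
  -- the progeny up to generation `k`
  let r : ℕ → Measure ℝ := fun k => (branch ν)^[k] 0
  have r_succ : ∀ k, r (k + 1) = branch ν (r k) := fun k => Function.iterate_succ_apply' _ _ _
  have hsf : ∀ k, SFinite (r k) := by
    intro k
    induction k with
    | zero => exact inferInstanceAs (SFinite (0 : Measure ℝ))
    | succ k ih => rw [r_succ]; infer_instance
  have hpos : ∀ k, ∀ᵐ m ∂(r k), 0 < m := by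
    intro k
    induction k with
    | zero => simp [r]
    | succ k ih => rw [r_succ]; exact ae_pos_branch hν ih
  have hmono : Monotone r := by
    refine monotone_nat_of_le_succ fun k => ?_
    induction k with
    | zero => exact Measure.zero_le _
    | succ k ih => rw [r_succ, r_succ (k + 1)]; exact branch_mono ν ih
  obtain ⟨ρ, hρ⟩ := exists_measure_iSup r hmono
  refine ⟨ρ, ?_, fun z W hW hfix => ?_⟩
  · have := hρ ((Iic 0).indicator 1) (measurable_one.indicator measurableSet_Iic)
    simp_rw [lintegral_indicator_one measurableSet_Iic] at this
    rw [ae_iff]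
    simp only [not_lt]
    change ρ (Iic 0) = 0
    rw [this]
    simp only [ENNReal.iSup_eq_zero]
    intro k
    have := hpos k
    rw [ae_iff] at this
    simpa [Iic, not_lt] using this
  have hle : ∀ k, expL (r k) z ≤ ENNReal.ofReal W := by
    intro k
    induction k with
    | zero => simp [r, expL]
    | succ k ih =>
      have hk : expL (r k) z = ENNReal.ofReal (expL (r k) z).toReal :=
        (ENNReal.ofReal_toReal (ne_top_of_le_ne_top ENNReal.ofReal_ne_top ih)).symm
      have h1 : (expL (r k) z).toReal ≤ W := ENNReal.toReal_le_of_le_ofReal hW ih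
      rw [r_succ, expL_branch hν ENNReal.toReal_nonneg hk, ← hfix]
      refine lintegral_mono_ae ?_
      filter_upwards [hν] with m hm
      gcongr
  have hlim : expL ρ z = ⨆ k, expL (r k) z := hρ _ (by fun_prop)
  have hfin : expL ρ z ≤ ENNReal.ofReal W := hlim ▸ iSup_le hle
  have hne : expL ρ z ≠ ∞ := ne_top_of_le_ne_top ENNReal.ofReal_ne_top hfin
  have hm1 : Monotone fun k => expL (r k) z := fun i j hij => lintegral_mono' (hmono hij) le_rfl
  have ht1 : Tendsto (fun k => expL (r k) z) atTop (𝓝 (expL ρ z)) := hlim ▸ tendsto_atTop_iSup hm1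
  refine ⟨(expL ρ z).toReal, ENNReal.toReal_nonneg, ENNReal.toReal_le_of_le_ofReal hW hfin,
    (ENNReal.ofReal_toReal hne).symm, ?_⟩
  have ht2 : Tendsto (fun k => expL (r (k + 1)) z) atTop (𝓝 (expL ν (z - (expL ρ z).toReal))) := by
    have : ∀ k, expL (r (k + 1)) z = expL ν (z - (expL (r k) z).toReal) := fun k => by
      rw [r_succ]
      exact expL_branch hν ENNReal.toReal_nonneg (ENNReal.ofReal_toReal
        (ne_top_of_le_ne_top ENNReal.ofReal_ne_top (hle k))).symm
    simp_rw [this]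
    have ht3 : Tendsto (fun k => (expL (r k) z).toReal) atTop (𝓝 (expL ρ z).toReal) :=
      (ENNReal.tendsto_toReal hne).comp ht1
    have hm3 : Monotone fun k => (expL (r k) z).toReal := fun i j hij =>
      ENNReal.toReal_mono (ne_top_of_le_ne_top ENNReal.ofReal_ne_top (hle j)) (hm1 hij)
    refine lintegral_tendsto_of_tendsto_of_monotone (fun k => by fun_prop) ?_ ?_
    · filter_upwards [hν] with m hm
      intro i j hij
      have := hm3 hij
      simp only at this
      dsimp only
      gcongr
    · refine Eventually.of_forall fun m => (ENNReal.continuous_ofReal.tendsto _).comp ?_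
      exact (Real.continuous_exp.tendsto _).comp
        (((tendsto_const_nhds.sub ht3).mul_const m).neg)
  rw [ENNReal.ofReal_toReal hne]
  exact tendsto_nhds_unique ht2 (ht1.comp (tendsto_add_atTop_nat 1))

/-! ### Uniqueness of Laplace transforms -/

/-- Two measures on the line whose Laplace transforms are finite and coincide near `0` are
equal: the complex transforms are analytic in a vertical strip, so that they coincide there, in
particular on the imaginary axis. -/
lemma ext_of_expL {μ ν : Measure ℝ} {δ : ℝ} (hδ : 0 < δ)
    (hfin : ∀ z ∈ Ioo (-δ) δ, expL μ z < ∞) (h : ∀ z ∈ Ioo (-δ) δ, expL μ z = expL ν z) :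
    μ = ν := by
  have key : ∀ σ : Measure ℝ, (∀ z ∈ Ioo (-δ) δ, expL σ z < ∞) →
      IsFiniteMeasure σ ∧ Ioo (-δ) δ ⊆ interior (ProbabilityTheory.integrableExpSet id σ) := by
    intro σ hσ
    refine ⟨⟨?_⟩, interior_maximal (fun z hz => ?_) isOpen_Ioo⟩
    · simpa [expL] using hσ 0 (by simpa using hδ)
    · refine ⟨Measurable.aestronglyMeasurable (by fun_prop), ?_⟩
      refine lt_of_eq_of_lt (lintegral_congr fun m => ?_) (hσ (-z) ⟨by linarith [hz.2],
        by linarith [hz.1]⟩)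
      rw [← ofReal_norm, Real.norm_of_nonneg (Real.exp_pos _).le]
      simp
  obtain ⟨f1, i1⟩ := key μ hfin
  obtain ⟨f2, i2⟩ := key ν fun z hz => h z hz ▸ hfin z hz
  have hmgf : ∀ z ∈ Ioo (-δ) δ, ProbabilityTheory.mgf id μ z = ProbabilityTheory.mgf id ν z := by
    intro z hz
    have hz' := h (-z) ⟨by linarith [hz.2], by linarith [hz.1]⟩
    simp only [expL, neg_mul, neg_neg] at hz'
    simp only [ProbabilityTheory.mgf, id]
    rw [integral_eq_lintegral_of_nonneg_ae (Eventually.of_forall fun m => (Real.exp_pos _).le)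
      (Measurable.aestronglyMeasurable (by fun_prop)), hz',
      ← integral_eq_lintegral_of_nonneg_ae (Eventually.of_forall fun m => (Real.exp_pos _).le)
      (Measurable.aestronglyMeasurable (by fun_prop))]
  refine Measure.ext_of_charFun (funext fun t => ?_)
  rw [← ProbabilityTheory.complexMGF_id_mul_I, ← ProbabilityTheory.complexMGF_id_mul_I]
  let S : Set ℂ := {z | z.re ∈ Ioo (-δ) δ}
  have a1 : AnalyticOnNhd ℂ (ProbabilityTheory.complexMGF id μ) S :=
    ProbabilityTheory.analyticOnNhd_complexMGF.mono fun z hz => i1 hz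
  have a2 : AnalyticOnNhd ℂ (ProbabilityTheory.complexMGF id ν) S :=
    ProbabilityTheory.analyticOnNhd_complexMGF.mono fun z hz => i2 hz
  have hpre : IsPreconnected S :=
    ((convex_Ioo (-δ) δ).linear_preimage Complex.reLm).isPreconnected
  have h0 : (0 : ℂ) ∈ S := by simpa [S] using hδ
  refine a1.eqOn_of_preconnected_of_frequently_eq a2 hpre h0 ?_ (by simpa [S] using hδ)
  have hs : Tendsto (fun k : ℕ => ((δ / ((k : ℝ) + 2) : ℝ) : ℂ)) atTop (𝓝[≠] 0) := by
    rw [tendsto_nhdsWithin_iff]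
    refine ⟨?_, Eventually.of_forall fun k => ?_⟩
    · rw [← Complex.ofReal_zero]
      refine (Complex.continuous_ofReal.tendsto _).comp ?_
      exact tendsto_const_nhds.div_atTop
        (tendsto_atTop_add_const_right _ _ tendsto_natCast_atTop_atTop)
    · simp only [mem_compl_iff, mem_singleton_iff, Complex.ofReal_eq_zero]
      positivity
  refine hs.frequently (Eventually.frequently (Eventually.of_forall fun k => ?_))
  rw [ProbabilityTheory.complexMGF_ofReal, ProbabilityTheory.complexMGF_ofReal, hmgf]
  refine ⟨by have : 0 < δ / ((k : ℝ) + 2) := by positivity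
             linarith, ?_⟩
  rw [div_lt_iff₀ (by positivity)]
  nlinarith [(Nat.cast_nonneg k : (0 : ℝ) ≤ k)]

end

section

/-! ### The coagulation term -/

variable {μ : Measure ℝ}

lemma integrable_id_of_mass_lt_top (h : IsRadonOnPos μ) (hM : mass μ < ∞) :
    Integrable (fun m : ℝ => m) μ := by
  refine ⟨Measurable.aestronglyMeasurable (by fun_prop), lt_of_eq_of_lt (lintegral_congr_ae ?_) hM⟩
  filter_upwards [h.ae_pos] with m hm
  rw [← ofReal_norm, Real.norm_of_nonneg hm.le]

lemma integral_id_eq_mass (h : IsRadonOnPos μ) : ∫ m, m ∂μ = (mass μ).toReal := by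
  rw [mass, integral_eq_lintegral_of_nonneg_ae]
  · filter_upwards [h.ae_pos] with m hm using hm.le
  · exact Measurable.aestronglyMeasurable (by fun_prop)

lemma ae_prod_pos (h : IsRadonOnPos μ) : ∀ᵐ p ∂(μ.prod μ), 0 < p.1 ∧ 0 < p.2 := by
  have := h.sigmaFinite
  filter_upwards [Measure.quasiMeasurePreserving_fst.ae h.ae_pos,
    Measure.quasiMeasurePreserving_snd.ae h.ae_pos] with p h1 h2 using ⟨h1, h2⟩

lemma coagulation_integrand_le {φ : ℝ → ℝ} {C : ℝ} (hC : ∀ m, 0 < m → |φ m| ≤ C) {p q : ℝ}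
    (hp : 0 < p) (hq : 0 < q) : |p * q * (φ (p + q) - φ p - φ q)| ≤ 3 * C * (p * q) := by
  rw [abs_mul, abs_of_pos (mul_pos hp hq), mul_comm]
  refine mul_le_mul_of_nonneg_right ?_ (mul_pos hp hq).le
  have h1 := abs_le.1 (hC p hp)
  have h2 := abs_le.1 (hC q hq)
  have h3 := abs_le.1 (hC (p + q) (add_pos hp hq))
  exact abs_le.2 ⟨by linarith, by linarith⟩

lemma integrable_mul_prod (h : IsRadonOnPos μ) (hM : mass μ < ∞) :
    Integrable (fun p : ℝ × ℝ => p.1 * p.2) (μ.prod μ) := by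
  have := h.sigmaFinite
  exact (integrable_id_of_mass_lt_top h hM).mul_prod (integrable_id_of_mass_lt_top h hM)

lemma integrable_coagulation (h : IsRadonOnPos μ) (hM : mass μ < ∞) {φ : ℝ → ℝ} {C : ℝ}
    (hφ : Measurable φ) (hC : ∀ m, 0 < m → |φ m| ≤ C) :
    Integrable (fun p : ℝ × ℝ => p.1 * p.2 * (φ (p.1 + p.2) - φ p.1 - φ p.2)) (μ.prod μ) := by
  refine ((integrable_mul_prod h hM).const_mul (3 * C)).mono'
    (Measurable.aestronglyMeasurable (by fun_prop)) ?_
  filter_upwards [ae_prod_pos h] with p hp using coagulation_integrand_le hC hp.1 hp.2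

lemma abs_coagulation_le (h : IsRadonOnPos μ) (hM : mass μ < ∞) {φ : ℝ → ℝ} {C : ℝ}
    (hC : ∀ m, 0 < m → |φ m| ≤ C) :
    |coagulation μ φ| ≤ 3 * C * (mass μ).toReal ^ 2 := by
  have := h.sigmaFinite
  have h1 : 3 * C * (mass μ).toReal ^ 2 = ∫ p : ℝ × ℝ, 3 * C * (p.1 * p.2) ∂(μ.prod μ) := by
    rw [integral_const_mul, integral_prod_mul (fun m : ℝ => m) (fun m : ℝ => m),
      integral_id_eq_mass h]
    ring
  rw [h1, coagulation, ← Real.norm_eq_abs]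
  refine norm_integral_le_of_norm_le ((integrable_mul_prod h hM).const_mul _) ?_
  filter_upwards [ae_prod_pos h] with p hp using coagulation_integrand_le hC hp.1 hp.2

lemma tendsto_coagulation (h : IsRadonOnPos μ) (hM : mass μ < ∞) {φ : ℝ → ℝ} {ψ : ℕ → ℝ → ℝ}
    {C : ℝ} (hψ : ∀ k, Measurable (ψ k)) (hC : ∀ k m, 0 < m → |ψ k m| ≤ C)
    (hlim : ∀ m, 0 < m → Tendsto (fun k => ψ k m) atTop (𝓝 (φ m))) :
    Tendsto (fun k => coagulation μ (ψ k)) atTop (𝓝 (coagulation μ φ)) := by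
  refine tendsto_integral_of_dominated_convergence (fun p : ℝ × ℝ => 3 * C * (p.1 * p.2))
    (fun k => ?_) ((integrable_mul_prod h hM).const_mul _) (fun k => ?_) ?_
  · have := hψ k
    exact Measurable.aestronglyMeasurable (by fun_prop)
  · filter_upwards [ae_prod_pos h] with p hp using coagulation_integrand_le (hC k) hp.1 hp.2
  · filter_upwards [ae_prod_pos h] with p hp
    exact tendsto_const_nhds.mul (((hlim _ (add_pos hp.1 hp.2)).sub (hlim _ hp.1)).sub
      (hlim _ hp.2))

/-! ### Test functions and cut-offs -/

lemma IsTestFunction.exists_support_subset {φ : ℝ → ℝ} (hφ : IsTestFunction φ) :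
    ∃ a b : ℝ, 0 < a ∧ Function.support φ ⊆ Icc a b := by
  rcases (tsupport φ).eq_empty_or_nonempty with he | hne
  · refine ⟨1, 1, one_pos, ?_⟩
    rw [tsupport_eq_empty_iff.1 he]
    simp
  · obtain ⟨a, ha, ha'⟩ := hφ.hasCompactSupport.isCompact.exists_isLeast hne
    obtain ⟨b, hb, hb'⟩ := hφ.hasCompactSupport.isCompact.exists_isGreatest hne
    exact ⟨a, b, hφ.tsupport_subset ha, fun x hx =>
      ⟨ha' (subset_tsupport _ hx), hb' (subset_tsupport _ hx)⟩⟩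

lemma IsTestFunction.integrable {φ : ℝ → ℝ} (hφ : IsTestFunction φ) (h : IsRadonOnPos μ) :
    Integrable φ μ := by
  obtain ⟨a, b, ha, hab⟩ := hφ.exists_support_subset
  obtain ⟨C, hC⟩ := hφ.hasCompactSupport.exists_bound_of_continuous hφ.continuous
  rw [← integrableOn_iff_integrable_of_support_subset hab]
  exact Measure.integrableOn_of_bounded (h.finite_Icc a b ha).ne
    hφ.continuous.aestronglyMeasurable (Eventually.of_forall hC)

/-- A cut-off function: it vanishes outside `[1 / (k + 1), k + 2]` and tends to `1` as `k → ∞`. -/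
def cutoff (k : ℕ) (m : ℝ) : ℝ :=
  max 0 (min 1 (((k : ℝ) + 1) * m - 1)) * max 0 (min 1 ((k : ℝ) + 2 - m))

lemma continuous_cutoff (k : ℕ) : Continuous (cutoff k) := by unfold cutoff; fun_prop

lemma cutoff_nonneg (k : ℕ) (m : ℝ) : 0 ≤ cutoff k m :=
  mul_nonneg (le_max_left _ _) (le_max_left _ _)

lemma cutoff_le_one (k : ℕ) (m : ℝ) : cutoff k m ≤ 1 :=
  mul_le_one₀ (max_le zero_le_one (min_le_left _ _)) (le_max_left _ _)
    (max_le zero_le_one (min_le_left _ _))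

lemma cutoff_mono {m : ℝ} (hm : 0 < m) : Monotone fun k => cutoff k m := by
  intro i j hij
  have : (i : ℝ) ≤ j := by exact_mod_cast hij
  simp only [cutoff]
  gcongr

lemma cutoff_eventually_eq_one {m : ℝ} (hm : 0 < m) : ∀ᶠ k in atTop, cutoff k m = 1 := by
  obtain ⟨k₁, hk₁⟩ := exists_nat_ge (2 / m)
  obtain ⟨k₂, hk₂⟩ := exists_nat_ge m
  filter_upwards [eventually_ge_atTop k₁, eventually_ge_atTop k₂] with k h1 h2
  have h1' : (k₁ : ℝ) ≤ k := by exact_mod_cast h1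
  have h2' : (k₂ : ℝ) ≤ k := by exact_mod_cast h2
  rw [div_le_iff₀ hm] at hk₁
  have e1 : 1 ≤ ((k : ℝ) + 1) * m - 1 := by nlinarith
  have e2 : 1 ≤ (k : ℝ) + 2 - m := by linarith
  simp [cutoff, min_eq_left e1, min_eq_left e2]

lemma isTestFunction_cutoff_mul (k : ℕ) {φ : ℝ → ℝ} (hφ : Continuous φ) :
    IsTestFunction fun m => cutoff k m * φ m := by
  have hsub : tsupport (fun m => cutoff k m * φ m) ⊆ Icc (1 / ((k : ℝ) + 1)) (k + 2) := by
    refine closure_minimal (fun m hm => ?_) isClosed_Icc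
    by_contra hcon
    refine hm ?_
    rw [mem_Icc, not_and_or, not_le, not_le] at hcon
    rcases hcon with h1 | h1
    · rw [lt_div_iff₀ (by positivity)] at h1
      have : min 1 (((k : ℝ) + 1) * m - 1) ≤ 0 := (min_le_right _ _).trans (by linarith)
      simp [cutoff, max_eq_left this]
    · have : min 1 ((k : ℝ) + 2 - m) ≤ 0 := (min_le_right _ _).trans (by linarith)
      simp [cutoff, max_eq_left this]
  refine ⟨(continuous_cutoff k).mul hφ, ?_, hsub.trans fun m hm => ?_⟩
  · exact isCompact_Icc.of_isClosed_subset (isClosed_tsupport _) hsub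
  · exact lt_of_lt_of_le (by positivity) hm.1

lemma tendsto_cutoff_mul {m : ℝ} (hm : 0 < m) (c : ℝ) :
    Tendsto (fun k => cutoff k m * c) atTop (𝓝 c) := by
  refine tendsto_const_nhds.congr' ?_
  filter_upwards [cutoff_eventually_eq_one hm] with k hk
  rw [hk, one_mul]

lemma abs_cutoff_mul_le (k : ℕ) (m c : ℝ) : |cutoff k m * c| ≤ |c| := by
  rw [abs_mul, abs_of_nonneg (cutoff_nonneg k m)]
  exact mul_le_of_le_one_left (abs_nonneg _) (cutoff_le_one k m)

/-- Monotone convergence along the cut-offs. -/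
lemma tendsto_lintegral_cutoff (h : IsRadonOnPos μ) {φ : ℝ → ℝ} (hφ : Continuous φ)
    (h0 : ∀ m, 0 < m → 0 ≤ φ m) :
    Tendsto (fun k => ENNReal.ofReal (∫ m, cutoff k m * φ m ∂μ)) atTop
      (𝓝 (∫⁻ m, ENNReal.ofReal (φ m) ∂μ)) := by
  have e : ∀ k, ENNReal.ofReal (∫ m, cutoff k m * φ m ∂μ)
      = ∫⁻ m, ENNReal.ofReal (cutoff k m * φ m) ∂μ := by
    intro k
    refine ofReal_integral_eq_lintegral_ofReal ((isTestFunction_cutoff_mul k hφ).integrable h) ?_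
    filter_upwards [h.ae_pos] with m hm using mul_nonneg (cutoff_nonneg k m) (h0 m hm)
  simp_rw [e]
  refine lintegral_tendsto_of_tendsto_of_monotone (fun k => ?_) ?_ ?_
  · have := (continuous_cutoff k).measurable
    have := hφ.measurable
    exact Measurable.aemeasurable (by fun_prop)
  · filter_upwards [h.ae_pos] with m hm
    intro i j hij
    exact ENNReal.ofReal_le_ofReal (mul_le_mul_of_nonneg_right (cutoff_mono hm hij) (h0 m hm))
  · filter_upwards [h.ae_pos] with m hm
    exact (ENNReal.continuous_ofReal.tendsto _).comp (tendsto_cutoff_mul hm _)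

/-! ### The equation for a larger class of test functions -/

variable {μ₀ : Measure ℝ} {μ : ℝ → Measure ℝ}

lemma IsSolution.continuousOn_testFunction (hs : IsSolution μ₀ μ) {φ : ℝ → ℝ}
    (hφ : IsTestFunction φ) {t : ℝ} (ht : 0 < t) :
    ContinuousOn (fun s => ∫ m, φ m ∂(μ s)) (Icc 0 t) := by
  have h1 : ContinuousOn (fun s => ∫ m, φ m ∂μ₀ + 1 / 2 * ∫ r in (0 : ℝ)..s,
      coagulation (μ r) φ) (Icc 0 t) := by
    refine continuousOn_const.add (continuousOn_const.mul ?_)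
    rw [← uIcc_of_le ht.le]
    refine intervalIntegral.continuousOn_primitive_interval' (hs.integrable φ hφ t ht) ?_
    exact left_mem_uIcc
  refine h1.congr fun s hs' => ?_
  rcases eq_or_lt_of_le hs'.1 with rfl | h0
  · simp [hs.initial]
  · exact hs.equation φ hφ s h0

lemma IsSolution.aemeasurable_mass (hs : IsSolution μ₀ μ) {t : ℝ} (ht : 0 < t) :
    AEMeasurable (fun s => mass (μ s)) (volume.restrict (Ioc 0 t)) := by
  refine aemeasurable_of_tendsto_metrizable_ae atTop
    (f := fun k s => ENNReal.ofReal (∫ m, cutoff k m * m ∂(μ s))) (fun k => ?_) ?_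
  · refine AEMeasurable.ennreal_ofReal ?_
    exact ((hs.continuousOn_testFunction (isTestFunction_cutoff_mul k continuous_id) ht).mono
      Ioc_subset_Icc_self).aemeasurable measurableSet_Ioc
  · filter_upwards [ae_restrict_mem measurableSet_Ioc] with s hs'
    exact tendsto_lintegral_cutoff (hs.radon s hs'.1.le) continuous_id fun m hm => hm.le

lemma IsSolution.ae_mass_lt_top (hs : IsSolution μ₀ μ) {t : ℝ} (ht : 0 < t) :
    ∀ᵐ s ∂(volume.restrict (Ioc 0 t)), mass (μ s) < ∞ := by
  filter_upwards [ae_lt_top' ((hs.aemeasurable_mass ht).pow_const 2) (hs.mass_sq t ht).ne]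
    with s hs'
  by_contra hcon
  rw [not_lt, top_le_iff] at hcon
  simp [hcon] at hs'

lemma IsSolution.integrableOn_mass_sq (hs : IsSolution μ₀ μ) {t : ℝ} (ht : 0 < t) :
    IntegrableOn (fun s => (mass (μ s)).toReal ^ 2) (Ioc 0 t) := by
  refine ⟨((hs.aemeasurable_mass ht).ennreal_toReal.pow_const 2).aestronglyMeasurable, ?_⟩
  refine lt_of_le_of_lt (lintegral_mono fun s => ?_) (hs.mass_sq t ht)
  rw [← ofReal_norm, Real.norm_of_nonneg (by positivity), ENNReal.ofReal_pow (by positivity)]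
  gcongr
  exact ENNReal.ofReal_toReal_le

lemma ae_restrict_radon (hs : IsSolution μ₀ μ) {t : ℝ} :
    ∀ᵐ s ∂(volume.restrict (Ioc 0 t)), IsRadonOnPos (μ s) := by
  filter_upwards [ae_restrict_mem measurableSet_Ioc] with s hs' using hs.radon s hs'.1.le

/-- Coagulation only decreases the truncated mass up to a bounded amount, so that the solution
stays admissible. -/
lemma IsSolution.isAdmissible (hs : IsSolution μ₀ μ) (h₀ : IsAdmissible μ₀) {t : ℝ} (ht : 0 ≤ t) :
    IsAdmissible (μ t) := by
  rcases eq_or_lt_of_le ht with rfl | ht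
  · rwa [hs.initial]
  refine ⟨hs.radon t ht.le, ?_⟩
  have hc : Continuous fun m : ℝ => min m 1 := by fun_prop
  have h0 : ∀ m : ℝ, 0 < m → 0 ≤ min m 1 := fun m hm => by positivity
  have hl := tendsto_lintegral_cutoff (hs.radon t ht.le) hc h0
  refine lt_of_le_of_lt (le_of_tendsto' hl fun k => ENNReal.ofReal_le_ofReal (?_ : _ ≤
    (∫ m, min m 1 ∂μ₀) + 1 / 2 * ∫ s in (0 : ℝ)..t, 3 * 1 * (mass (μ s)).toReal ^ 2))
    ENNReal.ofReal_lt_top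
  have hφ := isTestFunction_cutoff_mul k hc
  rw [hs.equation _ hφ t ht]
  refine add_le_add (integral_mono_ae (hφ.integrable h₀.toIsRadonOnPos) h₀.integrable_min ?_)
    (mul_le_mul_of_nonneg_left ?_ (by norm_num))
  · filter_upwards [h₀.ae_pos] with m hm
    exact mul_le_of_le_one_left (h0 m hm) (cutoff_le_one k m)
  · rw [intervalIntegral.integral_of_le ht.le, intervalIntegral.integral_of_le ht.le]
    refine integral_mono_ae ((hs.integrable _ hφ t ht).1)
      ((hs.integrableOn_mass_sq ht).const_mul _) ?_
    filter_upwards [hs.ae_mass_lt_top ht, ae_restrict_radon hs] with s h1 h2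
    refine (le_abs_self _).trans (abs_coagulation_le h2 h1 fun m hm => ?_)
    refine (abs_cutoff_mul_le _ _ _).trans ?_
    rw [abs_of_nonneg (h0 m hm)]
    exact min_le_right _ _

/-- The weak form of the equation at time `t` for the test function `φ`, including the
integrability of its right-hand side. -/
def SatisfiesEquation (μ₀ : Measure ℝ) (μ : ℝ → Measure ℝ) (t : ℝ) (φ : ℝ → ℝ) : Prop :=
  IntervalIntegrable (fun s => coagulation (μ s) φ) volume 0 t ∧
    ∫ m, φ m ∂(μ t) = ∫ m, φ m ∂μ₀ + 1 / 2 * ∫ s in (0 : ℝ)..t, coagulation (μ s) φ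

/-- The weak form of the equation is stable under pointwise limits of test functions that are
dominated by a multiple of `m ∧ 1`. -/
lemma SatisfiesEquation.of_tendsto (h₀ : IsAdmissible μ₀) {t : ℝ} (ht : 0 < t)
    (hμt : IsAdmissible (μ t))
    (hae : ∀ᵐ s ∂(volume.restrict (Ioc 0 t)), IsRadonOnPos (μ s) ∧ mass (μ s) < ∞)
    (hsq : IntegrableOn (fun s => (mass (μ s)).toReal ^ 2) (Ioc 0 t))
    {φ : ℝ → ℝ} {ψ : ℕ → ℝ → ℝ} {C : ℝ} (hψ : ∀ k, Continuous (ψ k))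
    (hC : ∀ k m, 0 < m → |ψ k m| ≤ C * min m 1)
    (hlim : ∀ m, 0 < m → Tendsto (fun k => ψ k m) atTop (𝓝 (φ m)))
    (heq : ∀ k, SatisfiesEquation μ₀ μ t (ψ k)) : SatisfiesEquation μ₀ μ t φ := by
  have hC0 : 0 ≤ C := by
    have := (abs_nonneg _).trans (hC 0 1 one_pos)
    simpa using this
  have hC' : ∀ k m, 0 < m → |ψ k m| ≤ C := fun k m hm =>
    (hC k m hm).trans (mul_le_of_le_one_right hC0 (min_le_right _ _))
  have hco : ∀ᵐ s ∂(volume.restrict (Ioc 0 t)), Tendsto (fun k => coagulation (μ s) (ψ k)) atTop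
      (𝓝 (coagulation (μ s) φ)) := by
    filter_upwards [hae] with s h1
    exact tendsto_coagulation h1.1 h1.2 (fun k => (hψ k).measurable) hC' hlim
  have hbd : ∀ k, ∀ᵐ s ∂(volume.restrict (Ioc 0 t)),
      ‖coagulation (μ s) (ψ k)‖ ≤ 3 * C * (mass (μ s)).toReal ^ 2 := by
    intro k
    filter_upwards [hae] with s h1
    exact abs_coagulation_le h1.1 h1.2 (hC' k)
  have hmeas : ∀ k, AEStronglyMeasurable (fun s => coagulation (μ s) (ψ k))
      (volume.restrict (Ioc 0 t)) := fun k => (heq k).1.1.1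
  have hint := hsq.const_mul (3 * C)
  have hspace : ∀ ν : Measure ℝ, IsAdmissible ν → Tendsto (fun k => ∫ m, ψ k m ∂ν)
      atTop (𝓝 (∫ m, φ m ∂ν)) := by
    intro ν hν
    refine tendsto_integral_of_dominated_convergence (fun m => C * min m 1)
      (fun k => (hψ k).aestronglyMeasurable) (hν.integrable_min.const_mul C) (fun k => ?_) ?_
    · filter_upwards [hν.ae_pos] with m hm using hC k m hm
    · filter_upwards [hν.ae_pos] with m hm using hlim m hm
  constructor
  · rw [intervalIntegrable_iff_integrableOn_Ioc_of_le ht.le]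
    refine hint.mono' (aestronglyMeasurable_of_tendsto_ae atTop hmeas hco) ?_
    filter_upwards [hco, ae_all_iff.2 hbd] with s h1 h2
    exact le_of_tendsto' h1.norm h2
  · refine tendsto_nhds_unique (hspace _ hμt) ?_
    simp_rw [fun k => (heq k).2]
    refine (hspace _ h₀).add (tendsto_const_nhds.mul ?_)
    simp_rw [intervalIntegral.integral_of_le ht.le]
    exact tendsto_integral_of_dominated_convergence _ hmeas hint hbd hco

/-- The equation holds for all continuous functions bounded by a multiple of `m ∧ 1`. -/
lemma IsSolution.extended (hs : IsSolution μ₀ μ) (h₀ : IsAdmissible μ₀) {φ : ℝ → ℝ} {C : ℝ}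
    (hφ : Continuous φ) (hC : ∀ m, 0 < m → |φ m| ≤ C * min m 1) {t : ℝ} (ht : 0 < t) :
    SatisfiesEquation μ₀ μ t φ := by
  have hψ : ∀ k, IsTestFunction fun m => cutoff k m * φ m := fun k =>
    isTestFunction_cutoff_mul k hφ
  refine SatisfiesEquation.of_tendsto h₀ ht (hs.isAdmissible h₀ ht.le)
    ((ae_restrict_radon hs).and (hs.ae_mass_lt_top ht)) (hs.integrableOn_mass_sq ht)
    (fun k => (hψ k).continuous) (fun k m hm => (abs_cutoff_mul_le k m _).trans (hC m hm))
    (fun m hm => tendsto_cutoff_mul hm _)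
    fun k => ⟨hs.integrable _ (hψ k) t ht, hs.equation _ (hψ k) t ht⟩

end

section

/-! ### Monotonicity and right continuity of the mass -/

variable {μ₀ : Measure ℝ} {μ : ℝ → Measure ℝ}

lemma IsSolution.continuousOn_integral (hs : IsSolution μ₀ μ) (h₀ : IsAdmissible μ₀) {φ : ℝ → ℝ}
    {C : ℝ} (hφ : Continuous φ) (hC : ∀ m, 0 < m → |φ m| ≤ C * min m 1) :
    ContinuousOn (fun s => ∫ m, φ m ∂(μ s)) (Ici 0) := by
  intro t ht
  have ht1 : 0 < t + 1 := by linarith [show (0 : ℝ) ≤ t from ht]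
  have h1 : ContinuousOn (fun s => ∫ m, φ m ∂μ₀ + 1 / 2 * ∫ r in (0 : ℝ)..s,
      coagulation (μ r) φ) (Icc 0 (t + 1)) := by
    refine continuousOn_const.add (continuousOn_const.mul ?_)
    rw [← uIcc_of_le ht1.le]
    exact intervalIntegral.continuousOn_primitive_interval' (hs.extended h₀ hφ hC ht1).1
      left_mem_uIcc
  have h2 : ContinuousOn (fun s => ∫ m, φ m ∂(μ s)) (Icc 0 (t + 1)) := by
    refine h1.congr fun s hs' => ?_
    rcases eq_or_lt_of_le hs'.1 with rfl | h0
    · simp [hs.initial]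
    · exact (hs.extended h₀ hφ hC h0).2
  refine (h2 t ⟨ht, by linarith⟩).mono_of_mem_nhdsWithin ?_
  rw [← Ici_inter_Iic]
  exact inter_mem_nhdsWithin _ (Iic_mem_nhds (by linarith))

/-- Coagulation decreases the integrals of subadditive functions. -/
lemma IsSolution.antitoneOn_integral (hs : IsSolution μ₀ μ) (h₀ : IsAdmissible μ₀) {φ : ℝ → ℝ}
    {C : ℝ} (hφ : Continuous φ) (hC : ∀ m, 0 < m → |φ m| ≤ C * min m 1)
    (hsub : ∀ p q, 0 < p → 0 < q → φ (p + q) ≤ φ p + φ q) :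
    AntitoneOn (fun s => ∫ m, φ m ∂(μ s)) (Ici 0) := by
  intro s hs0 t ht0 hst
  rw [mem_Ici] at hs0 ht0
  have hneg : ∀ r, 0 ≤ r → coagulation (μ r) φ ≤ 0 := by
    intro r hr
    refine integral_nonpos_of_ae ?_
    filter_upwards [ae_prod_pos (hs.radon r hr)] with p hp
    have := hsub p.1 p.2 hp.1 hp.2
    exact mul_nonpos_of_nonneg_of_nonpos (mul_pos hp.1 hp.2).le (by linarith)
  rcases eq_or_lt_of_le ht0 with rfl | ht
  · rw [le_antisymm hst hs0]
  have e1 := (hs.extended h₀ hφ hC ht).2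
  have i1 := (hs.extended h₀ hφ hC ht).1
  rcases eq_or_lt_of_le hs0 with rfl | hs0
  · dsimp only
    rw [e1, hs.initial]
    have : ∫ r in (0 : ℝ)..t, coagulation (μ r) φ ≤ 0 := by
      rw [intervalIntegral.integral_of_le ht.le]
      refine setIntegral_nonpos measurableSet_Ioc fun r hr => hneg r hr.1.le
    linarith
  · have e2 := (hs.extended h₀ hφ hC hs0).2
    have i2 := (hs.extended h₀ hφ hC hs0).1
    have i3 : IntervalIntegrable (fun r => coagulation (μ r) φ) volume s t := i2.symm.trans i1
    have e3 := intervalIntegral.integral_add_adjacent_intervals i2 i3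
    have : ∫ r in s..t, coagulation (μ r) φ ≤ 0 := by
      rw [intervalIntegral.integral_of_le hst]
      refine setIntegral_nonpos measurableSet_Ioc fun r hr => hneg r (hs0.trans hr.1).le
    dsimp only
    rw [e1, e2, ← e3]
    linarith

lemma abs_min_le (k : ℕ) {m : ℝ} (hm : 0 < m) :
    |min m ((k : ℝ) + 1)| ≤ ((k : ℝ) + 1) * min m 1 := by
  have hk : (0 : ℝ) ≤ k := Nat.cast_nonneg k
  rw [abs_of_pos (by positivity), mul_min_of_nonneg _ _ (by positivity), mul_one]
  exact min_le_min_right _ (by nlinarith)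

lemma min_subadd (c : ℝ) (hc : 0 ≤ c) (p q : ℝ) (hp : 0 < p) (hq : 0 < q) :
    min (p + q) c ≤ min p c + min q c := by
  rcases le_total p c with h1 | h1
  · rcases le_total q c with h2 | h2
    · rw [min_eq_left h1, min_eq_left h2]; exact min_le_left _ _
    · rw [min_eq_right h2]
      exact (min_le_right _ _).trans (by have := le_min hp.le hc; linarith)
  · rw [min_eq_right h1]
    exact (min_le_right _ _).trans (by have := le_min hq.le hc; linarith)

/-- The mass is the increasing limit of truncated masses. -/
lemma tendsto_truncated_mass {ν : Measure ℝ} (h : IsAdmissible ν) :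
    Tendsto (fun k : ℕ => ENNReal.ofReal (∫ m, min m ((k : ℝ) + 1) ∂ν)) atTop (𝓝 (mass ν)) := by
  have e : ∀ k : ℕ, ENNReal.ofReal (∫ m, min m ((k : ℝ) + 1) ∂ν)
      = ∫⁻ m, ENNReal.ofReal (min m ((k : ℝ) + 1)) ∂ν := by
    intro k
    refine ofReal_integral_eq_lintegral_ofReal (h.integrable
      (Measurable.aestronglyMeasurable (by fun_prop)) fun m hm => abs_min_le k hm) ?_
    filter_upwards [h.ae_pos] with m hm
    simp only [Pi.zero_apply]
    positivity
  simp_rw [e]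
  refine lintegral_tendsto_of_tendsto_of_monotone (fun k => by fun_prop) ?_ ?_
  · refine Eventually.of_forall fun m i j hij => ENNReal.ofReal_le_ofReal ?_
    have : (i : ℝ) ≤ j := by exact_mod_cast hij
    exact min_le_min_left _ (by linarith)
  · refine Eventually.of_forall fun m => (ENNReal.continuous_ofReal.tendsto _).comp ?_
    obtain ⟨k, hk⟩ := exists_nat_ge m
    refine tendsto_const_nhds.congr' ?_
    filter_upwards [eventually_ge_atTop k] with j hj
    have : (k : ℝ) ≤ j := by exact_mod_cast hj
    rw [min_eq_left (by linarith)]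

lemma truncated_mass_le {ν : Measure ℝ} (h : IsAdmissible ν) (k : ℕ) :
    ENNReal.ofReal (∫ m, min m ((k : ℝ) + 1) ∂ν) ≤ mass ν := by
  rw [ofReal_integral_eq_lintegral_ofReal (h.integrable
      (Measurable.aestronglyMeasurable (by fun_prop)) fun m hm => abs_min_le k hm)]
  · exact lintegral_mono fun m => ENNReal.ofReal_le_ofReal (min_le_left _ _)
  · filter_upwards [h.ae_pos] with m hm
    simp only [Pi.zero_apply]
    positivity

lemma IsSolution.antitoneOn_mass (hs : IsSolution μ₀ μ) (h₀ : IsAdmissible μ₀) :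
    AntitoneOn (fun s => mass (μ s)) (Ici 0) := by
  intro s hs0 t ht0 hst
  refine le_of_tendsto_of_tendsto' (tendsto_truncated_mass (hs.isAdmissible h₀ ht0))
    (tendsto_truncated_mass (hs.isAdmissible h₀ hs0)) fun k => ENNReal.ofReal_le_ofReal ?_
  exact hs.antitoneOn_integral h₀ (by fun_prop) (fun m hm => abs_min_le k hm)
    (min_subadd _ (by positivity)) hs0 ht0 hst

lemma IsSolution.mass_lt_top (hs : IsSolution μ₀ μ) (h₀ : IsAdmissible μ₀) {t : ℝ} (ht : 0 < t) :
    mass (μ t) < ∞ := by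
  have hne : (ae (volume.restrict (Ioc 0 t))).NeBot := by
    rw [ae_neBot]
    simp [ht]
  obtain ⟨s, hs1, hs2⟩ := ((ae_restrict_mem (μ := volume) (s := Ioc 0 t)
    measurableSet_Ioc).and (hs.ae_mass_lt_top ht)).exists
  exact (hs.antitoneOn_mass h₀ hs1.1.le ht.le hs1.2).trans_lt hs2

/-- Being nonincreasing and a supremum of continuous functions, the mass is right continuous. -/
lemma IsSolution.mass_rightContinuous (hs : IsSolution μ₀ μ) (h₀ : IsAdmissible μ₀) {t : ℝ}
    (ht : 0 < t) : ContinuousWithinAt (fun s => (mass (μ s)).toReal) (Ici t) t := by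
  refine (ENNReal.tendsto_toReal (hs.mass_lt_top h₀ ht).ne).comp ?_
  refine tendsto_order.2 ⟨fun c hc => ?_, fun c hc => ?_⟩
  · obtain ⟨k, hk⟩ := ((tendsto_truncated_mass (hs.isAdmissible h₀ ht.le)).eventually
      (lt_mem_nhds hc)).exists
    have hcont := hs.continuousOn_integral h₀ (φ := fun m => min m ((k : ℝ) + 1)) (by fun_prop)
      (fun m hm => abs_min_le k hm)
    have h1 := ((ENNReal.continuous_ofReal.comp_continuousOn hcont) t ht.le).mono
      (Ici_subset_Ici.2 ht.le)
    filter_upwards [h1.eventually (lt_mem_nhds hk), self_mem_nhdsWithin] with s hs1 hs2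
    exact lt_of_lt_of_le hs1 (truncated_mass_le (hs.isAdmissible h₀ (ht.le.trans hs2)) k)
  · filter_upwards [self_mem_nhdsWithin] with s hs2
    exact (hs.antitoneOn_mass h₀ ht.le (ht.le.trans hs2) hs2).trans_lt hc

/-! ### The integrated mass -/

/-- The integrated mass `A_t = ∫₀ᵗ M_s ds` of a family of measures. -/
def cumMass (μ : ℝ → Measure ℝ) (t : ℝ) : ℝ := ∫ s in (0 : ℝ)..t, (mass (μ s)).toReal

lemma IsSolution.intervalIntegrable_mass (hs : IsSolution μ₀ μ) {t : ℝ} (ht : 0 < t) :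
    IntervalIntegrable (fun s => (mass (μ s)).toReal) volume 0 t := by
  rw [intervalIntegrable_iff_integrableOn_Ioc_of_le ht.le]
  have h1 : IntegrableOn (fun _ : ℝ => (1 : ℝ)) (Ioc 0 t) := by simp
  refine (h1.add (hs.integrableOn_mass_sq ht)).mono'
    (hs.aemeasurable_mass ht).ennreal_toReal.aestronglyMeasurable (Eventually.of_forall fun s => ?_)
  rw [Real.norm_of_nonneg ENNReal.toReal_nonneg]
  simp only [Pi.add_apply]
  nlinarith [sq_nonneg ((mass (μ s)).toReal - 1)]

lemma IsSolution.continuousOn_cumMass (hs : IsSolution μ₀ μ) {t : ℝ} (ht : 0 < t) :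
    ContinuousOn (cumMass μ) (Icc 0 t) := by
  rw [← uIcc_of_le ht.le]
  exact intervalIntegral.continuousOn_primitive_interval' (hs.intervalIntegrable_mass ht)
    left_mem_uIcc

lemma IsSolution.cumMass_mono (hs : IsSolution μ₀ μ) {s t : ℝ} (h0 : 0 ≤ s) (hst : s ≤ t) :
    cumMass μ s ≤ cumMass μ t := by
  rcases eq_or_lt_of_le (h0.trans hst) with h | ht
  · rw [le_antisymm hst (h ▸ h0)]
  refine intervalIntegral.integral_mono_interval le_rfl h0 hst
    (Eventually.of_forall fun r => ENNReal.toReal_nonneg) (hs.intervalIntegrable_mass ht)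

lemma IsSolution.hasDerivWithinAt_cumMass (hs : IsSolution μ₀ μ) (h₀ : IsAdmissible μ₀) {t : ℝ}
    (ht : 0 < t) : HasDerivWithinAt (cumMass μ) (mass (μ t)).toReal (Ici t) t := by
  refine intervalIntegral.integral_hasDerivWithinAt_right (hs.intervalIntegrable_mass ht)
    (t := Ioi t) ?_ ((hs.mass_rightContinuous h₀ ht).mono Ioi_subset_Ici_self)
  have := (hs.intervalIntegrable_mass (show 0 < t + 1 by linarith)).1.1
  exact ⟨Ioc 0 (t + 1), mem_of_superset (Ioo_mem_nhdsGT (show t < t + 1 by linarith))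
    fun s hs' => ⟨ht.trans hs'.1, hs'.2.le⟩, this⟩

/-! ### The equation for the Laplace moments -/

lemma coagulation_mul_exp {ν : Measure ℝ} (h : IsAdmissible ν) (hM : mass ν < ∞) {y : ℝ}
    (hy : 0 < y) : coagulation ν (fun m => m ^ 1 * Real.exp (-(y * m)))
      = -(2 * (((mass ν).toReal - lap 1 ν y) * lap 2 ν y)) := by
  have := h.sigmaFinite
  have i0 := integrable_id_of_mass_lt_top h.toIsRadonOnPos hM
  have i1 := h.integrable_lap (n := 1) le_rfl hy
  have i2 := h.integrable_lap (n := 2) (by norm_num) hy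
  have e : ∀ p : ℝ × ℝ, p.1 * p.2 * ((p.1 + p.2) ^ 1 * Real.exp (-(y * (p.1 + p.2)))
      - p.1 ^ 1 * Real.exp (-(y * p.1)) - p.2 ^ 1 * Real.exp (-(y * p.2)))
      = (p.1 ^ 2 * Real.exp (-(y * p.1))) * (p.2 ^ 1 * Real.exp (-(y * p.2)))
        + (p.1 ^ 1 * Real.exp (-(y * p.1))) * (p.2 ^ 2 * Real.exp (-(y * p.2)))
        - (p.1 ^ 2 * Real.exp (-(y * p.1))) * p.2 - p.1 * (p.2 ^ 2 * Real.exp (-(y * p.2))) := by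
    intro p
    rw [mul_add, neg_add, Real.exp_add]
    ring
  rw [coagulation]
  simp_rw [e]
  let F : ℕ → ℝ → ℝ := fun n m => m ^ n * Real.exp (-(y * m))
  rw [integral_sub, integral_sub, integral_add, integral_prod_mul (F 2) (F 1),
    integral_prod_mul (F 1) (F 2), integral_prod_mul (F 2) (fun m => m),
    integral_prod_mul (fun m => m) (F 2), integral_id_eq_mass h.toIsRadonOnPos]
  · simp only [lap, F]
    ring
  · exact i2.mul_prod i1
  · exact i1.mul_prod i2
  · exact (i2.mul_prod i1).add (i1.mul_prod i2)
  · exact i2.mul_prod i0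
  · exact ((i2.mul_prod i1).add (i1.mul_prod i2)).sub (i2.mul_prod i0)
  · exact i0.mul_prod i2

lemma abs_pow_mul_exp_le {n : ℕ} (hn : 1 ≤ n) {y : ℝ} (hy : 0 < y) (m : ℝ) (hm : 0 < m) :
    |m ^ n * Real.exp (-(y * m))| ≤ (1 + n.factorial / y ^ n) * min m 1 := by
  rw [abs_of_pos (by positivity)]
  exact pow_mul_exp_neg_le_min hm hy hn

lemma IsSolution.continuousOn_lap (hs : IsSolution μ₀ μ) (h₀ : IsAdmissible μ₀) {n : ℕ}
    (hn : 1 ≤ n) {y : ℝ} (hy : 0 < y) : ContinuousOn (fun s => lap n (μ s) y) (Ici 0) :=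
  hs.continuousOn_integral h₀ (by fun_prop) (abs_pow_mul_exp_le hn hy)

/-- Uniform bounds for the Laplace moments of a solution. -/
lemma IsSolution.lap_le (hs : IsSolution μ₀ μ) (h₀ : IsAdmissible μ₀) {n : ℕ} (hn : 1 ≤ n)
    {δ y t : ℝ} (hδ : 0 < δ) (hy : δ ≤ y) (ht : 0 ≤ t) :
    lap n (μ t) y ≤ (1 + n.factorial / δ ^ n) * ∫ m, min m 1 ∂μ₀ := by
  have ha := hs.isAdmissible h₀ ht
  have h1 : lap n (μ t) y ≤ ∫ m, (1 + n.factorial / δ ^ n) * min m 1 ∂(μ t) := by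
    refine integral_mono_ae (ha.integrable_lap hn (hδ.trans_le hy))
      (ha.integrable_min.const_mul _) ?_
    filter_upwards [ha.ae_pos] with m hm
    refine le_trans ?_ (pow_mul_exp_neg_le_min hm hδ hn)
    gcongr
  rw [integral_const_mul] at h1
  refine h1.trans (mul_le_mul_of_nonneg_left ?_ (by positivity))
  have := hs.antitoneOn_integral h₀ (φ := fun m => min m 1) (C := 1) (by fun_prop)
    (fun m hm => by rw [one_mul, abs_of_pos (by positivity)]) (min_subadd 1 zero_le_one)
    (show (0 : ℝ) ∈ Ici 0 by simp) (show t ∈ Ici 0 from ht) ht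
  simpa [hs.initial] using this

/-- The function `h_t(y) = ⟨μ_t, m e^{-ym}⟩` satisfies `∂ₜ h = (M - h) ∂_y h` in the sense of right
derivatives; the mass is not known to be continuous from the left. -/
lemma IsSolution.hasDerivWithinAt_lap (hs : IsSolution μ₀ μ) (h₀ : IsAdmissible μ₀) {t y : ℝ}
    (ht : 0 < t) (hy : 0 < y) : HasDerivWithinAt (fun s => lap 1 (μ s) y)
      (-(((mass (μ t)).toReal - lap 1 (μ t) y) * lap 2 (μ t) y)) (Ici t) t := by
  have hφ : Continuous fun m : ℝ => m ^ 1 * Real.exp (-(y * m)) := by fun_prop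
  have hext := fun {s : ℝ} (hs' : 0 < s) =>
    hs.extended h₀ hφ (abs_pow_mul_exp_le le_rfl hy) hs'
  have hco : ∀ s, 0 < s → coagulation (μ s) (fun m => m ^ 1 * Real.exp (-(y * m)))
      = -(2 * (((mass (μ s)).toReal - lap 1 (μ s) y) * lap 2 (μ s) y)) := fun s hs' =>
    coagulation_mul_exp (hs.isAdmissible h₀ hs'.le) (hs.mass_lt_top h₀ hs') hy
  have hcont : ContinuousWithinAt (fun s => coagulation (μ s) fun m => m ^ 1 *
      Real.exp (-(y * m))) (Ioi t) t := by
    have h1 : ContinuousWithinAt (fun s => -(2 * (((mass (μ s)).toReal - lap 1 (μ s) y) *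
        lap 2 (μ s) y))) (Ioi t) t := by
      have c0 := (hs.mass_rightContinuous h₀ ht).mono Ioi_subset_Ici_self
      have hsub : Ioi t ⊆ Ici 0 := fun s hs' => ht.le.trans (le_of_lt hs')
      have c1 := ((hs.continuousOn_lap h₀ (n := 1) le_rfl hy) t ht.le).mono hsub
      have c2 := ((hs.continuousOn_lap h₀ (n := 2) (by norm_num) hy) t ht.le).mono hsub
      exact (continuousWithinAt_const.mul ((c0.sub c1).mul c2)).neg
    exact h1.congr (fun s hs' => hco s (ht.trans hs')) (hco t ht)
  have hder : HasDerivWithinAt (fun s => lap 1 μ₀ y + 1 / 2 * ∫ r in (0 : ℝ)..s,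
      coagulation (μ r) fun m => m ^ 1 * Real.exp (-(y * m)))
      (1 / 2 * coagulation (μ t) fun m => m ^ 1 * Real.exp (-(y * m))) (Ici t) t := by
    refine (HasDerivWithinAt.const_mul _ ?_).const_add _
    refine intervalIntegral.integral_hasDerivWithinAt_right (hext ht).1 (t := Ioi t) ?_ hcont
    exact ⟨Ioc 0 (t + 1), mem_of_superset (Ioo_mem_nhdsGT (show t < t + 1 by linarith))
      fun s hs' => ⟨ht.trans hs'.1, hs'.2.le⟩, (hext (show 0 < t + 1 by linarith)).1.1.1⟩
  refine (hder.congr (fun s hs' => (hext (ht.trans_le hs')).2) (hext ht).2).congr_deriv ?_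
  rw [hco t ht]
  ring

end

section

/-! ### Characteristics -/

variable {μ₀ : Measure ℝ} {μ : ℝ → Measure ℝ}

/-- A product with a factor that vanishes at the point: only the derivative of this factor and
the continuity of the other one matter. -/
lemma hasDerivWithinAt_mul_of_eq_zero {κ g : ℝ → ℝ} {g' s : ℝ} {S : Set ℝ}
    (hκ : ContinuousWithinAt κ S s) (hg : HasDerivWithinAt g g' S s) (h0 : g s = 0) :
    HasDerivWithinAt (fun r => κ r * g r) (κ s * g') S s := by
  rw [hasDerivWithinAt_iff_tendsto_slope] at hg ⊢
  refine ((hκ.mono sdiff_subset).tendsto.mul hg).congr fun r => ?_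
  simp only [slope_def_field, h0]
  ring

/-- A quantitative mean value property of `y ↦ ⟨ν, m e^{-ym}⟩`: the difference quotients deviate
from the derivative by an amount that is uniform over measures with bounded third Laplace moments.
It serves to differentiate `s ↦ ⟨μ_s, m e^{-Y_s m}⟩` when only right derivatives in time are
known. -/
lemma IsAdmissible.exists_slope_lap {ν : Measure ℝ} (h : IsAdmissible ν) {δ L : ℝ} (hδ : 0 < δ)
    (hL : ∀ ξ, δ ≤ ξ → lap 3 ν ξ ≤ L) {y z : ℝ} (hy : δ ≤ y) (hz : δ ≤ z) :
    ∃ c, lap 1 ν z - lap 1 ν y = c * (z - y) ∧ |c + lap 2 ν y| ≤ L * |z - y| := by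
  rcases eq_or_ne z y with rfl | hne
  · exact ⟨-lap 2 ν z, by simp⟩
  have hsub : ∀ ξ ∈ uIcc y z, δ ≤ ξ := fun ξ hξ => (le_min hy hz).trans hξ.1
  have hpos : ∀ ξ ∈ uIcc y z, 0 < ξ := fun ξ hξ => hδ.trans_le (hsub ξ hξ)
  have hlip : ∀ ξ ∈ uIcc y z, ‖lap 2 ν ξ - lap 2 ν y‖ ≤ L * ‖ξ - y‖ := by
    intro ξ hξ
    refine Convex.norm_image_sub_le_of_norm_hasDerivWithin_le (s := uIcc y z)
      (fun w hw => (h.hasDerivAt_lap (n := 2) (by norm_num) (hpos w hw)).hasDerivWithinAt)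
      (fun w hw => ?_) (convex_uIcc y z) left_mem_uIcc hξ
    rw [norm_neg, Real.norm_of_nonneg (lap_nonneg h.toIsRadonOnPos _ _)]
    exact hL w (hsub w hw)
  have hmv := Convex.norm_image_sub_le_of_norm_hasDerivWithin_le (s := uIcc y z)
    (f := fun w => lap 1 ν w + lap 2 ν y * w) (C := L * |z - y|)
    (fun w hw => ((h.hasDerivAt_lap (n := 1) le_rfl (hpos w hw)).add
      ((hasDerivAt_id w).const_mul (lap 2 ν y))).hasDerivWithinAt)
    (fun w hw => ?_) (convex_uIcc y z) left_mem_uIcc right_mem_uIcc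
  · have h0 : z - y ≠ 0 := sub_ne_zero.2 hne
    refine ⟨(lap 1 ν z - lap 1 ν y) / (z - y), by field_simp, ?_⟩
    have e : (lap 1 ν z - lap 1 ν y) / (z - y) + lap 2 ν y
        = (lap 1 ν z + lap 2 ν y * z - (lap 1 ν y + lap 2 ν y * y)) / (z - y) := by
      field_simp
      ring
    rw [e, abs_div, div_le_iff₀ (abs_pos.2 h0)]
    exact hmv
  · have h1 := hlip w hw
    have h2 : |w - y| ≤ |z - y| := abs_sub_left_of_mem_uIcc hw
    have h3 : 0 ≤ L := (lap_nonneg h.toIsRadonOnPos 3 y).trans (hL y hy)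
    simp only [mul_one, Nat.reduceAdd]
    rw [← norm_neg]
    refine le_trans (le_of_eq ?_) (h1.trans (mul_le_mul_of_nonneg_left h2 h3))
    congr 1
    ring

/-- Along the characteristic `s ↦ z - A_s + s h₀(z)` the Laplace transform is constant. Here `z`
has to be so large that the characteristic does not reach `0` before time `T`. The difference
`h_s(Y_s) - h₀(z)` solves a linear differential equation, so that Gronwall's lemma applies; it is
applied on `[ε, T]`, where the mass is finite. -/
theorem IsSolution.characteristics (hs : IsSolution μ₀ μ) (h₀ : IsAdmissible μ₀) {T z : ℝ}
    (hT : 0 < T) (hz : cumMass μ T < z) :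
    lap 1 (μ T) (z - cumMass μ T + T * lap 1 μ₀ z) = lap 1 μ₀ z := by
  set q := lap 1 μ₀ z with hq
  have hq0 : 0 ≤ q := lap_nonneg h₀.toIsRadonOnPos _ _
  set δ := z - cumMass μ T with hδdef
  have hδ : 0 < δ := sub_pos.2 hz
  let Y : ℝ → ℝ := fun s => z - cumMass μ s + s * q
  have hY : ∀ s ∈ Icc 0 T, δ ≤ Y s := by
    intro s hs'
    have := hs.cumMass_mono hs'.1 hs'.2
    have := mul_nonneg hs'.1 hq0
    simp only [Y, hδdef]
    linarith
  set B := ∫ m, min m 1 ∂μ₀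
  set L := (1 + (Nat.factorial 3 : ℝ) / δ ^ 3) * B
  set L₂ := (1 + (Nat.factorial 2 : ℝ) / δ ^ 2) * B
  have hL : ∀ t, 0 ≤ t → ∀ ξ, δ ≤ ξ → lap 3 (μ t) ξ ≤ L := fun t ht ξ hξ =>
    hs.lap_le h₀ (by norm_num) hδ hξ ht
  have hL₂ : ∀ t, 0 ≤ t → ∀ ξ, δ ≤ ξ → lap 2 (μ t) ξ ≤ L₂ := fun t ht ξ hξ =>
    hs.lap_le h₀ (by norm_num) hδ hξ ht
  have hYc : ContinuousOn Y (Icc 0 T) :=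
    (continuousOn_const.sub (hs.continuousOn_cumMass hT)).add
      (continuousOn_id.mul continuousOn_const)
  let K : ℝ → ℝ := fun s => lap 1 (μ s) (Y s)
  -- the slopes of `lap 1 (μ r)` between `Y s` and `Y r`
  have hslope : ∀ s ∈ Icc 0 T, ∃ c : ℝ → ℝ, ∀ r ∈ Icc 0 T,
      lap 1 (μ r) (Y r) - lap 1 (μ r) (Y s) = c r * (Y r - Y s) ∧
      |c r + lap 2 (μ r) (Y s)| ≤ L * |Y r - Y s| := by
    intro s hs'
    have : ∀ r, ∃ c, r ∈ Icc 0 T → lap 1 (μ r) (Y r) - lap 1 (μ r) (Y s) = c * (Y r - Y s) ∧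
        |c + lap 2 (μ r) (Y s)| ≤ L * |Y r - Y s| := by
      intro r
      by_cases hr : r ∈ Icc 0 T
      · obtain ⟨c, hc⟩ := (hs.isAdmissible h₀ hr.1).exists_slope_lap hδ (hL r hr.1) (hY s hs')
          (hY r hr)
        exact ⟨c, fun _ => hc⟩
      · exact ⟨0, fun h => absurd h hr⟩
    choose c hc using this
    exact ⟨c, fun r hr => hc r hr⟩
  have hdecomp : ∀ s ∈ Icc 0 T, ∀ c : ℝ → ℝ, (∀ r ∈ Icc 0 T,
      lap 1 (μ r) (Y r) - lap 1 (μ r) (Y s) = c r * (Y r - Y s) ∧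
      |c r + lap 2 (μ r) (Y s)| ≤ L * |Y r - Y s|) →
      ContinuousWithinAt c (Icc 0 T) s ∧ c s = -lap 2 (μ s) (Y s) ∧
      EqOn K (fun r => lap 1 (μ r) (Y s) + c r * (Y r - Y s)) (Icc 0 T) := by
    intro s hs' c hc
    have hcs : c s = -lap 2 (μ s) (Y s) := by
      have := (hc s hs').2
      rw [sub_self, abs_zero, mul_zero] at this
      linarith [abs_eq_zero.1 (le_antisymm this (abs_nonneg _))]
    refine ⟨?_, hcs, fun r hr => ?_⟩
    · have h1 : ContinuousWithinAt (fun r => -lap 2 (μ r) (Y s)) (Icc 0 T) s :=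
        (((hs.continuousOn_lap h₀ (n := 2) (by norm_num) (hδ.trans_le (hY s hs'))) s hs'.1).mono
          Icc_subset_Ici_self).neg
      have h2 : Tendsto (fun r => L * |Y r - Y s|) (𝓝[Icc 0 T] s) (𝓝 0) := by
        have := ((((hYc s hs').sub (continuousWithinAt_const (b := Y s))).abs).const_mul L).tendsto
        simpa using this
      have h3 : Tendsto (fun r => c r + lap 2 (μ r) (Y s)) (𝓝[Icc 0 T] s) (𝓝 0) := by
        refine squeeze_zero_norm' ?_ h2
        filter_upwards [self_mem_nhdsWithin] with r hr using (hc r hr).2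
      have h4 := h3.add h1.tendsto
      rw [ContinuousWithinAt, hcs]
      simpa using h4
    · have := (hc r hr).1
      simp only [K]
      linarith
  have hKc : ContinuousOn K (Icc 0 T) := by
    intro s hs'
    obtain ⟨c, hc⟩ := hslope s hs'
    obtain ⟨hc1, hc2, hc3⟩ := hdecomp s hs' c hc
    refine ContinuousWithinAt.congr ?_ hc3 (hc3 hs')
    exact (((hs.continuousOn_lap h₀ (n := 1) le_rfl (hδ.trans_le (hY s hs'))) s hs'.1).mono
      Icc_subset_Ici_self).add (hc1.mul ((hYc s hs').sub continuousWithinAt_const))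
  have hKd : ∀ s ∈ Ioo 0 T, HasDerivWithinAt (fun r => K r - q)
      (lap 2 (μ s) (Y s) * (K s - q)) (Ici s) s := by
    intro s hs'
    have hsI := Ioo_subset_Icc_self hs'
    obtain ⟨c, hc⟩ := hslope s hsI
    obtain ⟨hc1, hc2, hc3⟩ := hdecomp s hsI c hc
    have hYd : HasDerivWithinAt (fun r => Y r - Y s) (-(mass (μ s)).toReal + q) (Ici s) s := by
      have h1 := ((hs.hasDerivWithinAt_cumMass h₀ hs'.1).const_sub z).add
        ((hasDerivWithinAt_id s (Ici s)).mul_const q)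
      rw [one_mul] at h1
      exact h1.sub_const _
    have hmem : Icc 0 T ∈ 𝓝[Ici s] s :=
      mem_nhdsWithin_of_mem_nhds (Icc_mem_nhds hs'.1 hs'.2)
    have h1 := (hs.hasDerivWithinAt_lap h₀ hs'.1 (hδ.trans_le (hY s hsI))).add
      (hasDerivWithinAt_mul_of_eq_zero (hc1.mono_of_mem_nhdsWithin hmem) hYd (sub_self _))
    have h2 := (h1.congr_of_eventuallyEq (f₁ := K) (mem_of_superset hmem hc3) (hc3 hsI)).sub_const q
    refine h2.congr_deriv ?_
    rw [hc2]
    simp only [K]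
    ring
  have hgr : ∀ ε ∈ Ioo 0 T, |K T - q| ≤ |K ε - q| * Real.exp (L₂ * T) := by
    intro ε hε
    have hsub : Icc ε T ⊆ Icc 0 T := Icc_subset_Icc_left hε.1.le
    have h1 := norm_le_gronwallBound_of_norm_deriv_right_le (f := fun r => K r - q)
      (f' := fun s => lap 2 (μ s) (Y s) * (K s - q)) (δ := |K ε - q|) (K := L₂) (ε := 0)
      (a := ε) (b := T) ((hKc.mono hsub).sub continuousOn_const)
      (fun s hs' => hKd s ⟨hε.1.trans_le hs'.1, hs'.2⟩) le_rfl (fun s hs' => ?_) T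
      (right_mem_Icc.2 hε.2.le)
    · rw [gronwallBound_ε0] at h1
      refine h1.trans (mul_le_mul_of_nonneg_left (Real.exp_le_exp.2 ?_) (abs_nonneg _))
      have : 0 ≤ L₂ := (lap_nonneg h₀.toIsRadonOnPos 2 δ).trans
        (by simpa [hs.initial] using hL₂ 0 le_rfl δ le_rfl)
      exact mul_le_mul_of_nonneg_left (by linarith [hε.1]) this
    · have hsI : s ∈ Icc 0 T := ⟨hε.1.le.trans hs'.1, hs'.2.le⟩
      rw [norm_mul, add_zero, Real.norm_of_nonneg (lap_nonneg (hs.radon s hsI.1) _ _)]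
      exact mul_le_mul_of_nonneg_right (hL₂ s hsI.1 _ (hY s hsI)) (norm_nonneg _)
  have hK0 : K 0 = q := by simp [K, Y, hs.initial, cumMass, hq]
  have hlim : Tendsto (fun ε => |K ε - q| * Real.exp (L₂ * T)) (𝓝[>] 0) (𝓝 0) := by
    have h1 : Tendsto K (𝓝[>] 0) (𝓝 (K 0)) :=
      ((hKc 0 (left_mem_Icc.2 hT.le)).mono_of_mem_nhdsWithin (Icc_mem_nhdsGT hT)).tendsto
    have h2 := ((h1.sub_const q).abs).mul_const (Real.exp (L₂ * T))
    rwa [hK0, sub_self, abs_zero, zero_mul] at h2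
  have hfin : |K T - q| ≤ 0 := ge_of_tendsto hlim (by
    filter_upwards [Ioo_mem_nhdsGT hT] with ε hε using hgr ε hε)
  have : K T = q := by linarith [abs_eq_zero.1 (le_antisymm hfin (abs_nonneg _))]
  exact this

/-! ### Uniqueness -/

/-- The Laplace transform of the tilted measure `m e^{-bm} ν(dm)`. -/
lemma lintegral_tilt {ν : Measure ℝ} (h : IsRadonOnPos ν) (b c : ℝ) :
    ∫⁻ m, ENNReal.ofReal (Real.exp (-(c * m)))
      ∂(ν.withDensity fun m => ENNReal.ofReal (m * Real.exp (-(b * m)))) = lapE 1 ν (b + c) := by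
  rw [lintegral_withDensity_eq_lintegral_mul _ (by fun_prop) (by fun_prop), lapE]
  refine lintegral_congr_ae ?_
  filter_upwards [h.ae_pos] with m hm
  rw [Pi.mul_apply, ← ENNReal.ofReal_mul (by positivity), mul_assoc, ← Real.exp_add, pow_one]
  ring_nf

/-- Two solutions agree up to an exponential tilt, which is governed by the integrated masses. -/
lemma IsSolution.tilt_eq {μ' : ℝ → Measure ℝ} (hs : IsSolution μ₀ μ) (hs' : IsSolution μ₀ μ')
    (h₀ : IsAdmissible μ₀) {T : ℝ} (hT : 0 < T) :
    ∃ b : ℝ, (μ T).withDensity (fun m => ENNReal.ofReal (m * Real.exp (-((b - cumMass μ T) * m))))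
      = (μ' T).withDensity
        (fun m => ENNReal.ofReal (m * Real.exp (-((b - cumMass μ' T) * m)))) := by
  set A := cumMass μ T
  set A' := cumMass μ' T
  set c := max (max A A') 0 + 1
  have hcA : A < c := lt_of_le_of_lt ((le_max_left _ _).trans (le_max_left _ _)) (lt_add_one _)
  have hcA' : A' < c := lt_of_le_of_lt ((le_max_right _ _).trans (le_max_left _ _)) (lt_add_one _)
  have hc0 : 0 < c := lt_of_le_of_lt (le_max_right _ _) (lt_add_one _)
  -- every large point is reached by a characteristic that starts to the right of `c`
  have key : ∀ z, c + T * lap 1 μ₀ c < z →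
      lapE 1 (μ T) (z - A) < ∞ ∧ lapE 1 (μ T) (z - A) = lapE 1 (μ' T) (z - A') := by
    intro z hz
    have hTl : ∀ w, 0 ≤ T * lap 1 μ₀ w := fun w =>
      mul_nonneg hT.le (lap_nonneg h₀.toIsRadonOnPos _ _)
    have hcz : c ≤ z := by linarith [hTl c]
    have hcont : ContinuousOn (fun w => w + T * lap 1 μ₀ w) (Icc c z) := fun w hw =>
      (continuousAt_id.add (continuousAt_const.mul
        (h₀.continuousAt_lap le_rfl (hc0.trans_le hw.1)))).continuousWithinAt
    obtain ⟨w, hw, hwz⟩ := intermediate_value_Icc hcz hcont ⟨hz.le, by linarith [hTl z]⟩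
    have e1 := hs.characteristics h₀ hT (hcA.trans_le hw.1)
    have e2 := hs'.characteristics h₀ hT (hcA'.trans_le hw.1)
    simp only at hwz
    rw [show w - cumMass μ T + T * lap 1 μ₀ w = z - A by rw [← hwz]; ring] at e1
    rw [show w - cumMass μ' T + T * lap 1 μ₀ w = z - A' by rw [← hwz]; ring] at e2
    have p1 : 0 < z - A := by linarith
    have p2 : 0 < z - A' := by linarith
    have a1 := hs.isAdmissible h₀ hT.le
    have a2 := hs'.isAdmissible h₀ hT.le
    refine ⟨a1.lapE_lt_top le_rfl p1, ?_⟩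
    rw [lapE_eq_ofReal a1.toIsRadonOnPos (a1.integrable_lap le_rfl p1),
      lapE_eq_ofReal a2.toIsRadonOnPos (a2.integrable_lap le_rfl p2), e1, e2]
  refine ⟨c + T * lap 1 μ₀ c + 1, ext_of_expL one_pos (fun z hz => ?_) fun z hz => ?_⟩
  · rw [expL, lintegral_tilt (hs.radon T hT.le), sub_add_eq_add_sub]
    exact (key _ (by linarith [hz.1])).1
  · rw [expL, expL, lintegral_tilt (hs.radon T hT.le), lintegral_tilt (hs'.radon T hT.le),
      sub_add_eq_add_sub, sub_add_eq_add_sub]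
    exact (key _ (by linarith [hz.1])).2

lemma mass_eq_lintegral_tilt {ν : Measure ℝ} (h : IsRadonOnPos ν) (b : ℝ) :
    mass ν = ∫⁻ m, ENNReal.ofReal (Real.exp (-(-b * m)))
      ∂(ν.withDensity fun m => ENNReal.ofReal (m * Real.exp (-(b * m)))) := by
  rw [lintegral_tilt h, add_neg_cancel, mass_eq_lapE]

/-- A larger integrated mass comes with a smaller mass. -/
lemma IsSolution.mass_le_of_cumMass_le {μ' : ℝ → Measure ℝ} (hs : IsSolution μ₀ μ)
    (hs' : IsSolution μ₀ μ') (h₀ : IsAdmissible μ₀) {T : ℝ} (hT : 0 < T)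
    (hA : cumMass μ T ≤ cumMass μ' T) : mass (μ' T) ≤ mass (μ T) := by
  obtain ⟨b, hb⟩ := hs.tilt_eq hs' h₀ hT
  rw [mass_eq_lintegral_tilt (hs.radon T hT.le) (b - cumMass μ T),
    mass_eq_lintegral_tilt (hs'.radon T hT.le) (b - cumMass μ' T), ← hb]
  refine lintegral_mono_ae ?_
  filter_upwards [(withDensity_absolutelyContinuous _ _).ae_le (hs.radon T hT.le).ae_pos] with m hm
  gcongr

/-- The square of the difference of the integrated masses of two solutions starts from `0` and is
nonincreasing. -/
lemma IsSolution.cumMass_eq {μ' : ℝ → Measure ℝ} (hs : IsSolution μ₀ μ)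
    (hs' : IsSolution μ₀ μ') (h₀ : IsAdmissible μ₀) {T : ℝ} (hT : 0 < T) :
    cumMass μ T = cumMass μ' T := by
  let D : ℝ → ℝ := fun t => (cumMass μ t - cumMass μ' t) ^ 2
  have hDc : ContinuousOn D (Icc 0 T) :=
    ((hs.continuousOn_cumMass hT).sub (hs'.continuousOn_cumMass hT)).pow 2
  have hD : ∀ ε ∈ Ioo 0 T, D T ≤ D ε := by
    intro ε hε
    refine image_le_of_deriv_right_le_deriv_boundary (f := D) (a := ε) (b := T)
      (f' := fun t => 2 * (cumMass μ t - cumMass μ' t) *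
        ((mass (μ t)).toReal - (mass (μ' t)).toReal)) (B := fun _ => D ε) (B' := fun _ => 0)
      (hDc.mono (Icc_subset_Icc_left hε.1.le)) (fun t ht => ?_) le_rfl continuousOn_const
      (fun t _ => hasDerivWithinAt_const _ _ _) (fun t ht => ?_) (right_mem_Icc.2 hε.2.le)
    · have ht0 : 0 < t := hε.1.trans_le ht.1
      have := ((hs.hasDerivWithinAt_cumMass h₀ ht0).sub (hs'.hasDerivWithinAt_cumMass h₀ ht0)).pow 2
      refine this.congr_deriv ?_
      simp
    · have ht0 : 0 < t := hε.1.trans_le ht.1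
      have f1 := (hs.mass_lt_top h₀ ht0).ne
      have f2 := (hs'.mass_lt_top h₀ ht0).ne
      rcases le_total (cumMass μ t) (cumMass μ' t) with h | h
      · have := ENNReal.toReal_mono f1 (hs.mass_le_of_cumMass_le hs' h₀ ht0 h)
        nlinarith
      · have := ENNReal.toReal_mono f2 (hs'.mass_le_of_cumMass_le hs h₀ ht0 h)
        nlinarith
  have hlim : Tendsto D (𝓝[>] 0) (𝓝 (D 0)) :=
    ((hDc 0 (left_mem_Icc.2 hT.le)).mono_of_mem_nhdsWithin (Icc_mem_nhdsGT hT)).tendsto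
  have h0 : D 0 = 0 := by simp [D, cumMass]
  have hfin : D T ≤ 0 := h0 ▸ ge_of_tendsto hlim (by
    filter_upwards [Ioo_mem_nhdsGT hT] with ε hε using hD ε hε)
  have := pow_eq_zero_iff (two_ne_zero) |>.1 (le_antisymm hfin (sq_nonneg _))
  linarith

theorem IsSolution.unique {μ' : ℝ → Measure ℝ} (hs : IsSolution μ₀ μ)
    (hs' : IsSolution μ₀ μ') (h₀ : IsAdmissible μ₀) {T : ℝ} (hT : 0 ≤ T) : μ T = μ' T := by
  rcases eq_or_lt_of_le hT with rfl | hT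
  · rw [hs.initial, hs'.initial]
  obtain ⟨b, hb⟩ := hs.tilt_eq hs' h₀ hT
  rw [← hs.cumMass_eq hs' h₀ hT] at hb
  have hinv : ∀ ν : Measure ℝ, IsRadonOnPos ν → (ν.withDensity
      (fun m => ENNReal.ofReal (m * Real.exp (-((b - cumMass μ T) * m))))).withDensity
      (fun m => (ENNReal.ofReal (m * Real.exp (-((b - cumMass μ T) * m))))⁻¹) = ν := by
    intro ν hν
    refine withDensity_inv_same (by fun_prop) ?_ (Eventually.of_forall fun m => by simp)
    filter_upwards [hν.ae_pos] with m hm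
    have : 0 < m * Real.exp (-((b - cumMass μ T) * m)) := by positivity
    simpa using this
  rw [← hinv (μ T) (hs.radon T hT.le), hb, hinv (μ' T) (hs'.radon T hT.le)]

end

section

/-! ### The foot of the boundary characteristic -/

variable {μ₀ : Measure ℝ} {s t y z : ℝ}

/-- The point `l_t ≥ 0` at which the convex function `y ↦ y + t ⟨μ₀, m e^{-ym}⟩` on `[0, ∞)`
attains its minimum: the smallest point beyond which its derivative `1 - t ⟨μ₀, m² e^{-ym}⟩` is
nonnegative. -/
def foot (μ₀ : Measure ℝ) (t : ℝ) : ℝ := sInf {y | 0 < y ∧ t * lap 2 μ₀ y ≤ 1}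

/-- The minimum `a_t` of `y ↦ y + t ⟨μ₀, m e^{-ym}⟩`. -/
def front (μ₀ : Measure ℝ) (t : ℝ) : ℝ := foot μ₀ t + t * lap 1 μ₀ (foot μ₀ t)

lemma foot_bddBelow (μ₀ : Measure ℝ) (t : ℝ) : BddBelow {y | 0 < y ∧ t * lap 2 μ₀ y ≤ 1} :=
  ⟨0, fun _ hy => hy.1.le⟩

lemma foot_nonneg (μ₀ : Measure ℝ) (t : ℝ) : 0 ≤ foot μ₀ t := Real.sInf_nonneg fun _ hy => hy.1.le

lemma foot_le (hy : 0 < y) (h : t * lap 2 μ₀ y ≤ 1) : foot μ₀ t ≤ y :=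
  csInf_le (foot_bddBelow μ₀ t) ⟨hy, h⟩

lemma foot_zero (μ₀ : Measure ℝ) : foot μ₀ 0 = 0 := by
  refine le_antisymm (le_of_forall_gt_imp_ge_of_dense fun y hy => ?_) (foot_nonneg _ _)
  exact foot_le hy (by simp)

lemma gelTime_nonneg (μ₀ : Measure ℝ) : 0 ≤ gelTime μ₀ := ENNReal.toReal_nonneg

lemma front_zero (μ₀ : Measure ℝ) : front μ₀ 0 = 0 := by simp [front, foot_zero]

lemma gelTime_eq_zero (h2 : secondMoment μ₀ = ∞) : gelTime μ₀ = 0 := by simp [gelTime, h2]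

lemma secondMoment_lt_top_of_gelTime_pos (h : 0 < gelTime μ₀) : secondMoment μ₀ < ∞ := by
  by_contra hcon
  rw [not_lt, top_le_iff] at hcon
  rw [gelTime_eq_zero hcon] at h
  exact lt_irrefl _ h

namespace IsAdmissible

lemma mul_lap_lt_one (h₀ : IsAdmissible μ₀) (hne : μ₀ ≠ 0) (ht : 0 ≤ t) (hy : foot μ₀ t < y) :
    t * lap 2 μ₀ y < 1 := by
  have hne' : {y | 0 < y ∧ t * lap 2 μ₀ y ≤ 1}.Nonempty := by
    have h1 := (h₀.tendsto_lap_atTop (n := 2) (by norm_num)).const_mul t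
    rw [mul_zero] at h1
    obtain ⟨w, hw1, hw2⟩ :=
      ((h1.eventually (gt_mem_nhds one_pos)).and (eventually_gt_atTop 0)).exists
    exact ⟨w, hw2, hw1.le⟩
  obtain ⟨w, ⟨hw0, hw1⟩, hwy⟩ := exists_lt_of_csInf_lt hne' hy
  rcases eq_or_lt_of_le ht with rfl | ht
  · simp
  · have := h₀.strictAntiOn_lap hne (n := 2) (by norm_num) hw0 (hw0.trans hwy) hwy
    nlinarith

lemma foot_lt (h₀ : IsAdmissible μ₀) (hy : 0 < y) (h : t * lap 2 μ₀ y < 1) : foot μ₀ t < y := by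
  have hc : ContinuousAt (fun w => t * lap 2 μ₀ w) y :=
    continuousAt_const.mul (h₀.continuousAt_lap (by norm_num) hy)
  have h1 : ∀ᶠ w in 𝓝[<] y, t * lap 2 μ₀ w < 1 ∧ 0 < w ∧ w < y := by
    filter_upwards [mem_nhdsWithin_of_mem_nhds (hc.eventually (gt_mem_nhds h)),
      Ioo_mem_nhdsLT hy] with w h1 h2 using ⟨h1, h2⟩
  obtain ⟨w, h1, h2, h3⟩ := h1.exists
  exact (foot_le h2 h1.le).trans_lt h3

lemma lt_foot_iff (h₀ : IsAdmissible μ₀) (hne : μ₀ ≠ 0) (ht : 0 ≤ t) (hy : 0 < y) :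
    y < foot μ₀ t ↔ 1 < t * lap 2 μ₀ y := by
  constructor
  · intro h
    by_contra! hcon
    exact absurd (foot_le hy hcon) (not_le.2 h)
  · intro h
    have hc : ContinuousAt (fun w => t * lap 2 μ₀ w) y :=
      continuousAt_const.mul (h₀.continuousAt_lap (by norm_num) hy)
    have h1 : ∀ᶠ w in 𝓝[>] y, 1 < t * lap 2 μ₀ w ∧ y < w := by
      filter_upwards [mem_nhdsWithin_of_mem_nhds (hc.eventually (lt_mem_nhds h)),
        self_mem_nhdsWithin] with w h1 h2 using ⟨h1, h2⟩
    obtain ⟨w, h1, h2⟩ := h1.exists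
    by_contra! hcon
    exact absurd (h₀.mul_lap_lt_one hne ht (hcon.trans_lt h2)) (not_lt.2 h1.le)

lemma mul_lap_foot (h₀ : IsAdmissible μ₀) (hne : μ₀ ≠ 0) (ht : 0 ≤ t) (hl : 0 < foot μ₀ t) :
    t * lap 2 μ₀ (foot μ₀ t) = 1 := by
  refine le_antisymm ?_ ?_
  · by_contra! h
    exact lt_irrefl _ ((h₀.lt_foot_iff hne ht hl).2 h)
  · by_contra! h
    exact lt_irrefl _ (h₀.foot_lt hl h)

lemma lapE_two_foot_le (h₀ : IsAdmissible μ₀) (hne : μ₀ ≠ 0) (ht : 0 < t) :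
    lapE 2 μ₀ (foot μ₀ t) ≤ ENNReal.ofReal (1 / t) := by
  refine lapE_le_of_forall_gt h₀.toIsRadonOnPos fun w hw => ?_
  have hw0 : 0 < w := (foot_nonneg μ₀ t).trans_lt hw
  rw [lapE_eq_ofReal h₀.toIsRadonOnPos (h₀.integrable_lap (by norm_num) hw0)]
  refine ENNReal.ofReal_le_ofReal ?_
  rw [le_div_iff₀ ht, mul_comm]
  exact (h₀.mul_lap_lt_one hne ht.le hw).le

lemma lapE_two_foot_lt_top (h₀ : IsAdmissible μ₀) (hne : μ₀ ≠ 0) (ht : 0 < t) :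
    lapE 2 μ₀ (foot μ₀ t) < ∞ :=
  (h₀.lapE_two_foot_le hne ht).trans_lt ENNReal.ofReal_lt_top

lemma mul_lap_foot_le (h₀ : IsAdmissible μ₀) (hne : μ₀ ≠ 0) (ht : 0 < t) :
    t * lap 2 μ₀ (foot μ₀ t) ≤ 1 := by
  have := ENNReal.toReal_le_of_le_ofReal (by positivity) (h₀.lapE_two_foot_le hne ht)
  rw [← lap_eq_toReal h₀.toIsRadonOnPos, le_div_iff₀ ht] at this
  linarith

lemma lapE_one_foot_lt_top (h₀ : IsAdmissible μ₀) (hne : μ₀ ≠ 0) (ht : 0 < t) :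
    lapE 1 μ₀ (foot μ₀ t) < ∞ := by
  rcases eq_or_lt_of_le (foot_nonneg μ₀ t) with h | h
  · have h2 := h₀.lapE_two_foot_lt_top hne ht
    rw [← h] at h2 ⊢
    rw [← secondMoment_eq_lapE] at h2
    rw [← mass_eq_lapE]
    exact h₀.mass_lt_top h2
  · exact h₀.lapE_lt_top le_rfl h

/-- `a_t` is the minimum of `y ↦ y + t ⟨μ₀, m e^{-ym}⟩`. -/
lemma front_le (h₀ : IsAdmissible μ₀) (hne : μ₀ ≠ 0) (ht : 0 < t) (hz : 0 ≤ z)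
    (hf : lapE 1 μ₀ z < ∞) : front μ₀ t ≤ z + t * lap 1 μ₀ z := by
  have h1 := lap_one_tangent h₀.toIsRadonOnPos (h₀.lapE_one_foot_lt_top hne ht)
    (h₀.lapE_two_foot_lt_top hne ht) hf
  have h2 : t * lap 2 μ₀ (foot μ₀ t) * (z - foot μ₀ t) ≤ z - foot μ₀ t := by
    rcases eq_or_lt_of_le (foot_nonneg μ₀ t) with h | h
    · have := h₀.mul_lap_foot_le hne ht
      rw [← h] at this ⊢
      nlinarith
    · rw [h₀.mul_lap_foot hne ht.le h, one_mul]
  have h3 := mul_le_mul_of_nonneg_left h1 ht.le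
  rw [front]
  nlinarith

lemma continuousWithinAt_lap_one (h₀ : IsAdmissible μ₀) (hy : 0 ≤ y) (hf : lapE 1 μ₀ y < ∞) :
    ContinuousWithinAt (lap 1 μ₀) (Ici 0) y := by
  have h1 := (ENNReal.tendsto_toReal hf.ne).comp (h₀.continuousOn_lapE (n := 1) le_rfl y hy)
  refine ContinuousWithinAt.congr (f := fun z => (lapE 1 μ₀ z).toReal) h1 ?_ ?_
  · exact fun z _ => lap_eq_toReal h₀.toIsRadonOnPos 1 z
  · exact lap_eq_toReal h₀.toIsRadonOnPos 1 y

/-- The map `y ↦ y + t ⟨μ₀, m e^{-ym}⟩` is increasing to the right of its minimum. -/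
lemma strictMonoOn_char (h₀ : IsAdmissible μ₀) (hne : μ₀ ≠ 0) (ht : 0 < t) :
    StrictMonoOn (fun y => y + t * lap 1 μ₀ y) (Ici (foot μ₀ t)) := by
  refine strictMonoOn_of_deriv_pos (convex_Ici _) (fun y hy => ?_) fun y hy => ?_
  · have hy' : foot μ₀ t ≤ y := hy
    have hf : lapE 1 μ₀ y < ∞ :=
      (lapE_antitone h₀.toIsRadonOnPos 1 hy').trans_lt (h₀.lapE_one_foot_lt_top hne ht)
    exact continuousWithinAt_id.add (continuousWithinAt_const.mul
      ((h₀.continuousWithinAt_lap_one ((foot_nonneg _ _).trans hy') hf).mono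
        (Ici_subset_Ici.2 (foot_nonneg _ _))))
  · rw [interior_Ici, mem_Ioi] at hy
    have hd : HasDerivAt (fun y => y + t * lap 1 μ₀ y) (1 + t * -lap 2 μ₀ y) y :=
      (hasDerivAt_id y).add ((h₀.hasDerivAt_lap (n := 1) le_rfl
        ((foot_nonneg _ _).trans_lt hy)).const_mul t)
    rw [hd.deriv]
    linarith [h₀.mul_lap_lt_one hne ht.le hy]

/-! ### Regularity of the foot in time -/

lemma continuousOn_foot (h₀ : IsAdmissible μ₀) (hne : μ₀ ≠ 0) :
    ContinuousOn (foot μ₀) (Ici 0) := by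
  intro t ht
  rw [mem_Ici] at ht
  refine tendsto_order.2 ⟨fun y hy => ?_, fun y hy => ?_⟩
  · obtain ⟨w, hw1, hw2⟩ := exists_between hy
    rcases lt_or_ge w 0 with hw0 | hw0
    · exact Eventually.of_forall fun r => hw1.trans (hw0.trans_le (foot_nonneg _ _))
    obtain ⟨v, hv1, hv2⟩ := exists_between hw2
    have hv0 := hw0.trans_lt hv1
    have h1 := (h₀.lt_foot_iff hne ht hv0).1 hv2
    have hc : ContinuousAt (fun r => r * lap 2 μ₀ v) t := continuousAt_id.mul continuousAt_const
    filter_upwards [mem_nhdsWithin_of_mem_nhds (hc.eventually (lt_mem_nhds h1)),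
      self_mem_nhdsWithin] with r hr hr0
    exact (hw1.trans hv1).trans ((h₀.lt_foot_iff hne hr0 hv0).2 hr)
  · have hy0 := (foot_nonneg μ₀ t).trans_lt hy
    have h1 := h₀.mul_lap_lt_one hne ht hy
    have hc : ContinuousAt (fun r => r * lap 2 μ₀ y) t := continuousAt_id.mul continuousAt_const
    filter_upwards [mem_nhdsWithin_of_mem_nhds (hc.eventually (gt_mem_nhds h1))] with r hr
    exact h₀.foot_lt hy0 hr

lemma continuousAt_foot (h₀ : IsAdmissible μ₀) (hne : μ₀ ≠ 0) (ht : 0 < t) :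
    ContinuousAt (foot μ₀) t := (h₀.continuousOn_foot hne).continuousAt (Ici_mem_nhds ht)

lemma gelTime_mul (h₀ : IsAdmissible μ₀) (hne : μ₀ ≠ 0) (h2 : secondMoment μ₀ < ∞) :
    gelTime μ₀ * (secondMoment μ₀).toReal = 1 := by
  have h1 := h₀.lapE_pos hne 2 0
  rw [← secondMoment_eq_lapE] at h1
  rw [gelTime, ENNReal.toReal_inv, inv_mul_cancel₀]
  exact (ENNReal.toReal_pos h1.ne' h2.ne).ne'

lemma foot_eq_zero (h₀ : IsAdmissible μ₀) (hne : μ₀ ≠ 0) (ht0 : 0 ≤ t) (ht : t ≤ gelTime μ₀) :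
    foot μ₀ t = 0 := by
  rcases eq_or_lt_of_le ht0 with rfl | ht0
  · exact foot_zero μ₀
  have h2 := secondMoment_lt_top_of_gelTime_pos (ht0.trans_le ht)
  refine le_antisymm (le_of_forall_gt_imp_ge_of_dense fun y hy => ?_) (foot_nonneg _ _)
  refine foot_le hy ?_
  have h3 : lap 2 μ₀ y ≤ (secondMoment μ₀).toReal := by
    rw [lap_eq_toReal h₀.toIsRadonOnPos]
    rw [secondMoment_eq_lapE] at h2 ⊢
    exact ENNReal.toReal_mono h2.ne (lapE_antitone h₀.toIsRadonOnPos 2 hy.le)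
  rw [← h₀.gelTime_mul hne h2]
  exact mul_le_mul ht h3 (lap_nonneg h₀.toIsRadonOnPos _ _) (gelTime_nonneg _)

lemma foot_pos (h₀ : IsAdmissible μ₀) (hne : μ₀ ≠ 0) (ht : gelTime μ₀ < t) :
    0 < foot μ₀ t := by
  have ht0 : 0 < t := (gelTime_nonneg _).trans_lt ht
  refine lt_of_le_of_ne (foot_nonneg _ _) fun h => ?_
  have h1 := h₀.lapE_two_foot_le hne ht0
  rw [← h, ← secondMoment_eq_lapE] at h1
  have h2 := h1.trans_lt ENNReal.ofReal_lt_top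
  have h3 := ENNReal.toReal_le_of_le_ofReal (by positivity) h1
  rw [le_div_iff₀ ht0] at h3
  have h4 := h₀.gelTime_mul hne h2
  have h5 : 0 < (secondMoment μ₀).toReal := by
    refine lt_of_le_of_ne ENNReal.toReal_nonneg fun h => ?_
    rw [← h] at h4
    simp at h4
  nlinarith

lemma foot_strictMonoOn (h₀ : IsAdmissible μ₀) (hne : μ₀ ≠ 0) :
    StrictMonoOn (foot μ₀) (Ici (gelTime μ₀)) := by
  intro s hs t ht hst
  rw [mem_Ici] at hs ht
  have hs0 := (gelTime_nonneg μ₀).trans hs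
  rcases eq_or_lt_of_le hs with rfl | hs
  · rw [h₀.foot_eq_zero hne (gelTime_nonneg _) le_rfl]
    exact h₀.foot_pos hne hst
  · have h1 := h₀.foot_pos hne hs
    have h2 := h₀.mul_lap_foot hne hs0 h1
    rw [h₀.lt_foot_iff hne (hs0.trans hst.le) h1]
    have := h₀.lap_pos hne (n := 2) (by norm_num) h1
    nlinarith

/-- After gelation the foot is a right inverse of `y ↦ 1 / ⟨μ₀, m² e^{-ym}⟩`, and thus as regular as
the inverse function theorem allows. -/
lemma eventually_inv_lap_foot (h₀ : IsAdmissible μ₀) (hne : μ₀ ≠ 0) (ht : gelTime μ₀ < t) :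
    ∀ᶠ r in 𝓝 t, (lap 2 μ₀ (foot μ₀ r))⁻¹ = r := by
  filter_upwards [lt_mem_nhds ht] with r hr
  have h1 := h₀.foot_pos hne hr
  have h2 := h₀.mul_lap_foot hne ((gelTime_nonneg _).trans hr.le) h1
  have h3 := h₀.lap_pos hne (n := 2) (by norm_num) h1
  field_simp
  linarith

lemma hasDerivAt_inv_lap (h₀ : IsAdmissible μ₀) (hne : μ₀ ≠ 0) (hy : 0 < y) :
    HasDerivAt (fun w => (lap 2 μ₀ w)⁻¹) (lap 3 μ₀ y / lap 2 μ₀ y ^ 2) y := by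
  have h := (h₀.hasDerivAt_lap (n := 2) (by norm_num) hy).inv
    (h₀.lap_pos hne (n := 2) (by norm_num) hy).ne'
  rw [neg_neg] at h
  exact h

lemma hasDerivAt_foot (h₀ : IsAdmissible μ₀) (hne : μ₀ ≠ 0) (ht : gelTime μ₀ < t) :
    HasDerivAt (foot μ₀) (lap 3 μ₀ (foot μ₀ t) / lap 2 μ₀ (foot μ₀ t) ^ 2)⁻¹ t := by
  have h1 := h₀.foot_pos hne ht
  have h2 := h₀.lap_pos hne (n := 2) (by norm_num) h1
  have h3 := h₀.lap_pos hne (n := 3) (by norm_num) h1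
  exact HasDerivAt.of_local_left_inverse
    (h₀.continuousAt_foot hne ((gelTime_nonneg _).trans_lt ht)) (h₀.hasDerivAt_inv_lap hne h1)
    (by positivity) (h₀.eventually_inv_lap_foot hne ht)

lemma analyticAt_foot (h₀ : IsAdmissible μ₀) (hne : μ₀ ≠ 0) (ht : gelTime μ₀ < t) :
    AnalyticAt ℝ (foot μ₀) t := by
  have h1 := h₀.foot_pos hne ht
  have h2 := h₀.lap_pos hne (n := 2) (by norm_num) h1
  have h3 := h₀.lap_pos hne (n := 3) (by norm_num) h1
  have ha : AnalyticAt ℝ (fun w => (lap 2 μ₀ w)⁻¹) (foot μ₀ t) :=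
    (h₀.analyticAt_lap (n := 2) (by norm_num) h1).inv h2.ne'
  have hd : deriv (fun w => (lap 2 μ₀ w)⁻¹) (foot μ₀ t) ≠ 0 := by
    rw [(h₀.hasDerivAt_inv_lap hne h1).deriv]
    positivity
  have hli := ha.analyticAt_localInverse hd
  have ht' := (h₀.eventually_inv_lap_foot hne ht).self_of_nhds
  rw [ht'] at hli
  refine hli.congr ?_
  have hleft := HasStrictDerivAt.eventually_left_inverse ha.hasStrictDerivAt hd
  have hc := h₀.continuousAt_foot hne ((gelTime_nonneg _).trans_lt ht)
  filter_upwards [hc.eventually hleft, h₀.eventually_inv_lap_foot hne ht] with r hr1 hr2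
  rw [hr2] at hr1
  exact hr1

lemma tendsto_foot_atTop (h₀ : IsAdmissible μ₀) (hne : μ₀ ≠ 0) :
    Tendsto (foot μ₀) atTop atTop := by
  refine tendsto_atTop.2 fun y => ?_
  have hy : 0 < max y 1 := lt_of_lt_of_le one_pos (le_max_right _ _)
  have hk := h₀.lap_pos hne (n := 2) (by norm_num) hy
  filter_upwards [eventually_gt_atTop (1 / lap 2 μ₀ (max y 1)), eventually_ge_atTop 0] with r hr h0
  rw [div_lt_iff₀ hk] at hr
  exact (le_max_left _ _).trans ((h₀.lt_foot_iff hne h0 hy).2 hr).le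

/-! ### The front -/

lemma continuousOn_lapE_foot (h₀ : IsAdmissible μ₀) (hne : μ₀ ≠ 0) :
    ContinuousOn (fun t => lapE 1 μ₀ (foot μ₀ t)) (Ici 0) :=
  (h₀.continuousOn_lapE le_rfl).comp (h₀.continuousOn_foot hne) fun _ _ => foot_nonneg _ _

lemma continuousAt_lap_foot (h₀ : IsAdmissible μ₀) (hne : μ₀ ≠ 0) (ht : 0 < t) :
    ContinuousAt (fun t => lap 1 μ₀ (foot μ₀ t)) t := by
  have h1 := ((h₀.continuousOn_lapE_foot hne).continuousAt (Ici_mem_nhds ht))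
  simp_rw [lap_eq_toReal h₀.toIsRadonOnPos]
  exact (ENNReal.tendsto_toReal (h₀.lapE_one_foot_lt_top hne ht).ne).comp h1

/-- The envelope theorem: the minimum `a_t` of `y ↦ y + t ⟨μ₀, m e^{-ym}⟩` has the derivative
`⟨μ₀, m e^{-lm}⟩`, the partial derivative in `t` at the minimum point. -/
lemma hasDerivAt_front (h₀ : IsAdmissible μ₀) (hne : μ₀ ≠ 0) (ht : 0 < t) :
    HasDerivAt (front μ₀) (lap 1 μ₀ (foot μ₀ t)) t := by
  have key : ∀ r s, 0 < r → 0 < s →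
      front μ₀ r - front μ₀ s ≤ lap 1 μ₀ (foot μ₀ s) * (r - s) := by
    intro r s hr hs
    have := h₀.front_le hne hr (foot_nonneg μ₀ s) (h₀.lapE_one_foot_lt_top hne hs)
    rw [front, front]
    rw [front] at this
    linarith
  rw [hasDerivAt_iff_tendsto_slope]
  have hc : Tendsto (fun r => |lap 1 μ₀ (foot μ₀ r) - lap 1 μ₀ (foot μ₀ t)|) (𝓝[≠] t) (𝓝 0) := by
    have := ((h₀.continuousAt_lap_foot hne ht).tendsto.sub_const
      (lap 1 μ₀ (foot μ₀ t))).abs.mono_left (nhdsWithin_le_nhds (s := {t}ᶜ))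
    simpa using this
  have h1 : Tendsto (fun r => slope (front μ₀) t r - lap 1 μ₀ (foot μ₀ t)) (𝓝[≠] t) (𝓝 0) := by
    refine squeeze_zero_norm' ?_ hc
    filter_upwards [self_mem_nhdsWithin, mem_nhdsWithin_of_mem_nhds (lt_mem_nhds ht)] with r hr hr0
    have hne' : r - t ≠ 0 := sub_ne_zero.2 hr
    have k1 := key r t hr0 ht
    have k2 := key t r ht hr0
    have e : slope (front μ₀) t r - lap 1 μ₀ (foot μ₀ t)
        = (front μ₀ r - front μ₀ t - lap 1 μ₀ (foot μ₀ t) * (r - t)) / (r - t) := by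
      rw [slope_def_field]
      field_simp
    rw [Real.norm_eq_abs, e, abs_div, div_le_iff₀ (abs_pos.2 hne'), ← abs_mul]
    rw [abs_of_nonpos (by linarith)]
    refine le_trans ?_ (neg_le_abs _)
    linarith
  have h2 := h1.add_const (lap 1 μ₀ (foot μ₀ t))
  simpa using h2

lemma continuousOn_front (h₀ : IsAdmissible μ₀) (hne : μ₀ ≠ 0) :
    ContinuousOn (front μ₀) (Ici 0) := by
  intro t ht
  rcases eq_or_lt_of_le (show (0 : ℝ) ≤ t from ht) with rfl | ht
  swap
  · exact (h₀.hasDerivAt_front hne ht).continuousAt.continuousWithinAt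
  rw [← Ioi_insert, continuousWithinAt_insert_self, ContinuousWithinAt, front_zero]
  refine tendsto_order.2 ⟨fun c hc => ?_, fun c hc => ?_⟩
  · filter_upwards [self_mem_nhdsWithin] with r hr
    exact hc.trans_le (add_nonneg (foot_nonneg _ _)
      (mul_nonneg (le_of_lt hr) (lap_nonneg h₀.toIsRadonOnPos _ _)))
  · have hc2 : 0 < c / 2 := by positivity
    have h1 : ContinuousAt (fun r => c / 2 + r * lap 1 μ₀ (c / 2)) 0 := by fun_prop
    have h2 := h1.eventually (gt_mem_nhds (show c / 2 + 0 * lap 1 μ₀ (c / 2) < c by linarith))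
    filter_upwards [self_mem_nhdsWithin, mem_nhdsWithin_of_mem_nhds h2] with r hr hr2
    exact (h₀.front_le hne hr hc2.le (h₀.lapE_lt_top le_rfl hc2)).trans_lt hr2

end IsAdmissible

end

section

/-! ### Construction of the solution -/

variable {μ₀ : Measure ℝ} {t y : ℝ}

/-- A family of measures whose Laplace transforms `h_t` are transported along characteristics: on
the characteristic starting at `y` one has `h_t(y + t h₀(y) - a_t) = h₀(y)`, as long as `y` lies to
the right of the foot of the boundary characteristic. -/
structure IsTransported (μ₀ : Measure ℝ) (μ : ℝ → Measure ℝ) : Prop where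
  initial : μ 0 = μ₀
  admissible : ∀ t, 0 ≤ t → IsAdmissible (μ t)
  lapE_eq : ∀ t, 0 < t → ∀ y, foot μ₀ t ≤ y →
    lapE 1 (μ t) (y + t * lap 1 μ₀ y - front μ₀ t) = lapE 1 μ₀ y

lemma IsAdmissible.of_mass_lt_top {ν : Measure ℝ} (hpos : ∀ᵐ m ∂ν, 0 < m) (hM : mass ν < ∞) :
    IsAdmissible ν := by
  have h0 : ν (Iic 0) = 0 := by
    rw [ae_iff] at hpos
    simpa [Iic, not_lt] using hpos
  refine ⟨⟨h0, fun a b ha => ?_⟩, ?_⟩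
  · have h1 : ENNReal.ofReal a * ν (Icc a b) ≤ mass ν := by
      refine le_trans ?_ (mul_meas_ge_le_lintegral₀ (by fun_prop) (ENNReal.ofReal a))
      gcongr
      exact fun m hm => ENNReal.ofReal_le_ofReal hm.1
    by_contra hcon
    rw [not_lt, top_le_iff] at hcon
    rw [hcon, ENNReal.mul_top (by simpa using ha), top_le_iff] at h1
    exact hM.ne h1
  · exact (lintegral_mono fun m => ENNReal.ofReal_le_ofReal (min_le_left _ _)).trans_lt hM

/-- Existence at a fixed time, by exponential tilting of the total progeny of a branching
process. -/
lemma IsAdmissible.exists_transported_at (h₀ : IsAdmissible μ₀) (hne : μ₀ ≠ 0) (ht : 0 < t) :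
    ∃ σ : Measure ℝ, IsAdmissible σ ∧ ∀ y, foot μ₀ t ≤ y →
      lapE 1 σ (y + t * lap 1 μ₀ y - front μ₀ t) = lapE 1 μ₀ y := by
  have := h₀.sigmaFinite
  have hpos : ∀ᵐ m ∂(μ₀.withDensity fun m => ENNReal.ofReal (t * m)), 0 < m :=
    (withDensity_absolutelyContinuous _ _).ae_le h₀.ae_pos
  obtain ⟨ρ, hρ, hfix⟩ := exists_progeny (μ₀.withDensity fun m => ENNReal.ofReal (t * m)) hpos
  have hν : ∀ z, expL (μ₀.withDensity fun m => ENNReal.ofReal (t * m)) z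
      = ENNReal.ofReal t * lapE 1 μ₀ z := by
    intro z
    rw [expL, lintegral_withDensity_eq_lintegral_mul _ (by fun_prop) (by fun_prop), lapE,
      ← lintegral_const_mul _ (by fun_prop)]
    refine lintegral_congr_ae ?_
    filter_upwards [h₀.ae_pos] with m hm
    rw [Pi.mul_apply, ← ENNReal.ofReal_mul (by positivity), ← ENNReal.ofReal_mul (by positivity)]
    ring_nf
  have hlap : ∀ y, foot μ₀ t ≤ y → lapE 1 μ₀ y = ENNReal.ofReal (lap 1 μ₀ y) := by
    intro y hy
    have h1 := (lapE_antitone h₀.toIsRadonOnPos 1 hy).trans_lt (h₀.lapE_one_foot_lt_top hne ht)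
    exact lapE_eq_ofReal h₀.toIsRadonOnPos (integrable_of_lapE_lt_top h₀.toIsRadonOnPos h1)
  have hexp : ∀ y, foot μ₀ t ≤ y →
      expL ρ (y + t * lap 1 μ₀ y) = ENNReal.ofReal (t * lap 1 μ₀ y) := by
    intro y hy
    have hW : 0 ≤ t * lap 1 μ₀ y := mul_nonneg ht.le (lap_nonneg h₀.toIsRadonOnPos _ _)
    obtain ⟨w, hw0, hwW, hw1, hw2⟩ := hfix (y + t * lap 1 μ₀ y) (t * lap 1 μ₀ y) hW
      (by rw [hν, add_sub_cancel_right, hlap y hy, ENNReal.ofReal_mul ht.le])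
    -- `w` is another solution of the fixed point equation, and it lies on the branch on which
    -- the characteristic map is injective
    set y' := y + t * lap 1 μ₀ y - w with hy'
    have hyy' : y ≤ y' := by linarith
    rw [hν, hlap y' (hy.trans hyy'), ← ENNReal.ofReal_mul ht.le, ENNReal.ofReal_eq_ofReal_iff
      (mul_nonneg ht.le (lap_nonneg h₀.toIsRadonOnPos _ _)) hw0] at hw2
    have h1 : y' = y := (h₀.strictMonoOn_char hne ht).injOn (hy.trans hyy') hy
      (by rw [hw2]; linarith)
    rw [hw1]
    congr 1
    linarith
  let σ := ρ.withDensity fun m => ENNReal.ofReal (m⁻¹ * Real.exp (-(front μ₀ t * m)) / t)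
  have hσ : ∀ y, foot μ₀ t ≤ y →
      lapE 1 σ (y + t * lap 1 μ₀ y - front μ₀ t) = lapE 1 μ₀ y := by
    intro y hy
    have h1 : lapE 1 σ (y + t * lap 1 μ₀ y - front μ₀ t)
        = ENNReal.ofReal (1 / t) * expL ρ (y + t * lap 1 μ₀ y) := by
      rw [lapE, lintegral_withDensity_eq_lintegral_mul _ (by fun_prop) (by fun_prop), expL,
        ← lintegral_const_mul _ (by fun_prop)]
      refine lintegral_congr_ae ?_
      filter_upwards [hρ] with m hm
      rw [Pi.mul_apply, ← ENNReal.ofReal_mul (by positivity), ← ENNReal.ofReal_mul (by positivity)]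
      have e : Real.exp (-((y + t * lap 1 μ₀ y) * m)) = Real.exp (-(front μ₀ t * m)) *
          Real.exp (-((y + t * lap 1 μ₀ y - front μ₀ t) * m)) := by
        rw [← Real.exp_add]; ring_nf
      rw [e]
      congr 1
      field_simp
    rw [h1, hexp y hy, hlap y hy, ← ENNReal.ofReal_mul (by positivity)]
    congr 1
    field_simp
  refine ⟨σ, IsAdmissible.of_mass_lt_top
    ((withDensity_absolutelyContinuous _ _).ae_le hρ) ?_, hσ⟩
  have := hσ (foot μ₀ t) le_rfl
  rw [← front, sub_self, ← mass_eq_lapE] at this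
  rw [this]
  exact h₀.lapE_one_foot_lt_top hne ht

lemma IsAdmissible.exists_transported (h₀ : IsAdmissible μ₀) (hne : μ₀ ≠ 0) :
    ∃ μ : ℝ → Measure ℝ, IsTransported μ₀ μ := by
  have h : ∀ t : ℝ, ∃ σ : Measure ℝ, (0 < t → IsAdmissible σ ∧ ∀ y, foot μ₀ t ≤ y →
      lapE 1 σ (y + t * lap 1 μ₀ y - front μ₀ t) = lapE 1 μ₀ y) ∧ (t ≤ 0 → σ = μ₀) := by
    intro t
    rcases le_or_gt t 0 with ht | ht
    · exact ⟨μ₀, fun h => absurd h (not_lt.2 ht), fun _ => rfl⟩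
    · obtain ⟨σ, hσ⟩ := h₀.exists_transported_at hne ht
      exact ⟨σ, fun _ => hσ, fun h => absurd h (not_le.2 ht)⟩
  choose μ hμ1 hμ2 using h
  refine ⟨μ, hμ2 0 le_rfl, fun t ht => ?_, fun t ht => (hμ1 t ht).2⟩
  rcases eq_or_lt_of_le ht with rfl | ht
  · rw [hμ2 0 le_rfl]
    exact h₀
  · exact (hμ1 t ht).1

/-! ### Characteristics of the transported family -/

/-- The starting point `Y_t(y)` of the characteristic that passes through `y` at time `t`. For
`t ≥ 0` and `y > 0` it exists and is unique. -/
def charPt (μ₀ : Measure ℝ) (y t : ℝ) : ℝ :=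
  Classical.epsilon fun w => foot μ₀ t < w ∧ w + t * lap 1 μ₀ w - front μ₀ t = y

namespace IsAdmissible

lemma strictMonoOn_char_sub_front (h₀ : IsAdmissible μ₀) (hne : μ₀ ≠ 0) (ht : 0 ≤ t) :
    StrictMonoOn (fun w => w + t * lap 1 μ₀ w - front μ₀ t) (Ici (foot μ₀ t)) := by
  rcases eq_or_lt_of_le ht with rfl | ht
  · intro a _ b _ hab
    simpa using hab
  · exact fun a ha b hb hab => sub_lt_sub_right (h₀.strictMonoOn_char hne ht ha hb hab) _

lemma charPt_spec (h₀ : IsAdmissible μ₀) (hne : μ₀ ≠ 0) (ht : 0 ≤ t) (hy : 0 < y) :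
    foot μ₀ t < charPt μ₀ y t ∧
      charPt μ₀ y t + t * lap 1 μ₀ (charPt μ₀ y t) - front μ₀ t = y := by
  refine Classical.epsilon_spec (p := fun w => foot μ₀ t < w ∧
    w + t * lap 1 μ₀ w - front μ₀ t = y) ?_
  rcases eq_or_lt_of_le ht with rfl | ht
  · exact ⟨y, by simpa [foot_zero] using hy, by simp [front_zero]⟩
  have hpos : ∀ w, 0 ≤ t * lap 1 μ₀ w := fun w =>
    mul_nonneg ht.le (lap_nonneg h₀.toIsRadonOnPos _ _)
  have hl := foot_nonneg μ₀ t
  have ha : 0 ≤ front μ₀ t := add_nonneg hl (hpos _)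
  have hcont : ContinuousOn (fun w => w + t * lap 1 μ₀ w - front μ₀ t)
      (Icc (foot μ₀ t) (foot μ₀ t + front μ₀ t + y)) := by
    intro w hw
    have hf : lapE 1 μ₀ w < ∞ :=
      (lapE_antitone h₀.toIsRadonOnPos 1 hw.1).trans_lt (h₀.lapE_one_foot_lt_top hne ht)
    exact (continuousWithinAt_id.add (continuousWithinAt_const.mul
      ((h₀.continuousWithinAt_lap_one (hl.trans hw.1) hf).mono fun v hv => hl.trans hv.1))).sub
      continuousWithinAt_const
  obtain ⟨w, hw, hwy⟩ := intermediate_value_Icc (by linarith) hcont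
    (show y ∈ _ from ⟨by simp only [front]; linarith, by
      have := hpos (foot μ₀ t + front μ₀ t + y)
      linarith⟩)
  refine ⟨w, lt_of_le_of_ne hw.1 fun h => ?_, hwy⟩
  simp only [← h, front, sub_self] at hwy
  linarith

lemma charPt_pos (h₀ : IsAdmissible μ₀) (hne : μ₀ ≠ 0) (ht : 0 ≤ t) (hy : 0 < y) :
    0 < charPt μ₀ y t := (foot_nonneg _ _).trans_lt (h₀.charPt_spec hne ht hy).1

lemma charPt_zero (h₀ : IsAdmissible μ₀) (hne : μ₀ ≠ 0) (hy : 0 < y) : charPt μ₀ y 0 = y := by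
  simpa [front_zero] using (h₀.charPt_spec hne le_rfl hy).2

lemma continuousOn_charPt (h₀ : IsAdmissible μ₀) (hne : μ₀ ≠ 0) (hy : 0 < y) :
    ContinuousOn (charPt μ₀ y) (Ici 0) := by
  intro t ht
  rw [mem_Ici] at ht
  obtain ⟨h1, h2⟩ := h₀.charPt_spec hne ht hy
  have hmono := h₀.strictMonoOn_char_sub_front hne ht
  have hc : ∀ w, ContinuousWithinAt (fun r => w + r * lap 1 μ₀ w - front μ₀ r) (Ici 0) t :=
    fun w => (continuousWithinAt_const.add (continuousWithinAt_id.mul continuousWithinAt_const)).sub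
      (h₀.continuousOn_front hne t ht)
  have hl := h₀.continuousOn_foot hne t ht
  refine tendsto_order.2 ⟨fun c hcY => ?_, fun c hcY => ?_⟩
  · obtain ⟨w, hw1, hw2⟩ := exists_between (max_lt hcY h1)
    have hlw : foot μ₀ t < w := (le_max_right _ _).trans_lt hw1
    have h3 : w + t * lap 1 μ₀ w - front μ₀ t < y := by
      have := hmono hlw.le h1.le hw2
      simp only at this
      linarith
    filter_upwards [(hc w).eventually (gt_mem_nhds h3), hl.eventually (gt_mem_nhds hlw),
      self_mem_nhdsWithin] with r hr1 hr2 hr0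
    refine (le_max_left _ _).trans_lt (hw1.trans ?_)
    obtain ⟨h4, h5⟩ := h₀.charPt_spec hne hr0 hy
    rw [← (h₀.strictMonoOn_char_sub_front hne hr0).lt_iff_lt hr2.le h4.le]
    linarith
  · have hlc : foot μ₀ t < c := h1.trans hcY
    have h3 : y < c + t * lap 1 μ₀ c - front μ₀ t := by
      have := hmono h1.le hlc.le hcY
      simp only at this
      linarith
    filter_upwards [(hc c).eventually (lt_mem_nhds h3), hl.eventually (gt_mem_nhds hlc),
      self_mem_nhdsWithin] with r hr1 hr2 hr0
    obtain ⟨h4, h5⟩ := h₀.charPt_spec hne hr0 hy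
    rw [← (h₀.strictMonoOn_char_sub_front hne hr0).lt_iff_lt h4.le hr2.le]
    linarith

/-- The implicit equation `Y + t h₀(Y) - a_t = y` is differentiated in `t` directly, since the
implicit function theorem would ask for more regularity of the front `a_t`. The slope `c_r` of `h₀`
between `Y_t` and `Y_r` turns it into a linear equation for `Y_r - Y_t`. -/
lemma hasDerivAt_charPt (h₀ : IsAdmissible μ₀) (hne : μ₀ ≠ 0) (ht : 0 < t) (hy : 0 < y) :
    HasDerivAt (charPt μ₀ y) ((1 - t * lap 2 μ₀ (charPt μ₀ y t))⁻¹ *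
      (lap 1 μ₀ (foot μ₀ t) - lap 1 μ₀ (charPt μ₀ y t))) t := by
  obtain ⟨hY1, hY2⟩ := h₀.charPt_spec hne ht.le hy
  set Y := charPt μ₀ y t with hYdef
  have hY0 : 0 < Y := h₀.charPt_pos hne ht.le hy
  have hδ : 0 < Y / 2 := by positivity
  have hk : t * lap 2 μ₀ Y < 1 := h₀.mul_lap_lt_one hne ht.le hY1
  have hYc : ContinuousAt (charPt μ₀ y) t :=
    (h₀.continuousOn_charPt hne hy).continuousAt (Ici_mem_nhds ht)
  have hL : ∀ ξ, Y / 2 ≤ ξ → lap 3 μ₀ ξ ≤ lap 3 μ₀ (Y / 2) := fun ξ hξ =>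
    (h₀.strictAntiOn_lap hne (n := 3) (by norm_num)).antitoneOn hδ (hδ.trans_le hξ) hξ
  have hsl : ∀ r, ∃ c, Y / 2 ≤ charPt μ₀ y r →
      lap 1 μ₀ (charPt μ₀ y r) - lap 1 μ₀ Y = c * (charPt μ₀ y r - Y) ∧
      |c + lap 2 μ₀ Y| ≤ lap 3 μ₀ (Y / 2) * |charPt μ₀ y r - Y| := by
    intro r
    by_cases hr : Y / 2 ≤ charPt μ₀ y r
    · obtain ⟨c, hc⟩ := h₀.exists_slope_lap hδ hL (by linarith : Y / 2 ≤ Y) hr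
      exact ⟨c, fun _ => hc⟩
    · exact ⟨0, fun h => absurd h hr⟩
  choose c hc using hsl
  have hev : ∀ᶠ r in 𝓝 t, Y / 2 ≤ charPt μ₀ y r := by
    filter_upwards [hYc.eventually (lt_mem_nhds (show Y / 2 < charPt μ₀ y t by
      rw [← hYdef]; linarith))] with r hr using hr.le
  have hct : c t = -lap 2 μ₀ Y := by
    have := (hc t hev.self_of_nhds).2
    rw [← hYdef, sub_self, abs_zero, mul_zero] at this
    linarith [abs_eq_zero.1 (le_antisymm this (abs_nonneg _))]
  have hcc : ContinuousAt c t := by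
    have h2 : Tendsto (fun r => lap 3 μ₀ (Y / 2) * |charPt μ₀ y r - Y|) (𝓝 t) (𝓝 0) := by
      have := ((hYc.tendsto.sub_const Y).abs).const_mul (lap 3 μ₀ (Y / 2))
      simpa [← hYdef] using this
    have h3 : Tendsto (fun r => c r + lap 2 μ₀ Y) (𝓝 t) (𝓝 0) := by
      refine squeeze_zero_norm' ?_ h2
      filter_upwards [hev] with r hr using (hc r hr).2
    have h4 := h3.sub_const (lap 2 μ₀ Y)
    rw [ContinuousAt, hct]
    simpa using h4
  have hκ : ContinuousAt (fun r => (1 + r * c r)⁻¹) t := by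
    have hn : 1 + t * c t ≠ 0 := by
      rw [hct]
      intro h
      linarith
    exact (continuousAt_const.add (continuousAt_id.mul hcc)).inv₀ hn
  have hg : HasDerivAt (fun r => front μ₀ r - front μ₀ t - (r - t) * lap 1 μ₀ Y)
      (lap 1 μ₀ (foot μ₀ t) - lap 1 μ₀ Y) t := by
    have h1 := ((h₀.hasDerivAt_front hne ht).sub_const (front μ₀ t)).sub
      (((hasDerivAt_id t).sub_const t).mul_const (lap 1 μ₀ Y))
    rwa [one_mul] at h1
  have hmain := hasDerivWithinAt_mul_of_eq_zero (S := univ) hκ.continuousWithinAt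
    hg.hasDerivWithinAt (by simp)
  rw [hasDerivWithinAt_univ] at hmain
  have hfin := (hmain.const_add Y).congr_of_eventuallyEq (f₁ := charPt μ₀ y) ?_
  · refine hfin.congr_deriv ?_
    rw [hct]
    ring_nf
  · have hne0 : ∀ᶠ r in 𝓝 t, 1 + r * c r ≠ 0 := by
      have : ContinuousAt (fun r => 1 + r * c r) t :=
        continuousAt_const.add (continuousAt_id.mul hcc)
      refine this.eventually_ne ?_
      rw [hct]
      intro h
      linarith
    filter_upwards [hev, hne0, lt_mem_nhds ht] with r hr1 hr2 hr0
    obtain ⟨h1, -⟩ := hc r hr1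
    obtain ⟨-, h2⟩ := h₀.charPt_spec hne hr0.le hy
    have h3 : (charPt μ₀ y r - Y) * (1 + r * c r)
        = front μ₀ r - front μ₀ t - (r - t) * lap 1 μ₀ Y := by
      linear_combination h2 - hY2 - r * h1
    rw [← h3]
    field_simp
    ring

end IsAdmissible

end

section

/-! ### Moments of the transported family -/

variable {μ₀ : Measure ℝ} {μ : ℝ → Measure ℝ} {t y : ℝ}

namespace IsTransported

lemma mass_eq (hμ : IsTransported μ₀ μ) (ht : 0 ≤ t) : mass (μ t) = lapE 1 μ₀ (foot μ₀ t) := by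
  rcases eq_or_lt_of_le ht with rfl | ht
  · rw [hμ.initial, foot_zero, mass_eq_lapE]
  · have := hμ.lapE_eq t ht _ le_rfl
    rwa [← front, sub_self, ← mass_eq_lapE] at this

lemma mass_lt_top (hμ : IsTransported μ₀ μ) (h₀ : IsAdmissible μ₀) (hne : μ₀ ≠ 0) (ht : 0 < t) :
    mass (μ t) < ∞ := by
  rw [hμ.mass_eq ht.le]
  exact h₀.lapE_one_foot_lt_top hne ht

lemma mass_toReal (hμ : IsTransported μ₀ μ) (h₀ : IsAdmissible μ₀) (ht : 0 ≤ t) :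
    (mass (μ t)).toReal = lap 1 μ₀ (foot μ₀ t) := by
  rw [hμ.mass_eq ht, lap_eq_toReal h₀.toIsRadonOnPos]

lemma lap_one_char (hμ : IsTransported μ₀ μ) (h₀ : IsAdmissible μ₀) (ht : 0 ≤ t)
    {w : ℝ} (hw : foot μ₀ t < w) :
    lap 1 (μ t) (w + t * lap 1 μ₀ w - front μ₀ t) = lap 1 μ₀ w := by
  rcases eq_or_lt_of_le ht with rfl | ht
  · simp [hμ.initial, front_zero]
  · rw [lap_eq_toReal (hμ.admissible t ht.le).toIsRadonOnPos, hμ.lapE_eq t ht w hw.le,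
      lap_eq_toReal h₀.toIsRadonOnPos]

lemma lap_one_eq (hμ : IsTransported μ₀ μ) (h₀ : IsAdmissible μ₀) (hne : μ₀ ≠ 0) (ht : 0 ≤ t)
    (hy : 0 < y) : lap 1 (μ t) y = lap 1 μ₀ (charPt μ₀ y t) := by
  obtain ⟨h1, h2⟩ := h₀.charPt_spec hne ht hy
  have := hμ.lap_one_char h₀ ht h1
  rwa [h2] at this

/-- Differentiating `h_t(y + t h₀(y) - a_t) = h₀(y)` in space. -/
lemma lap_two_char (hμ : IsTransported μ₀ μ) (h₀ : IsAdmissible μ₀) (hne : μ₀ ≠ 0) (ht : 0 ≤ t)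
    {w : ℝ} (hw : foot μ₀ t < w) :
    lap 2 (μ t) (w + t * lap 1 μ₀ w - front μ₀ t) = lap 2 μ₀ w / (1 - t * lap 2 μ₀ w) := by
  have hw0 : 0 < w := (foot_nonneg _ _).trans_lt hw
  have hk := h₀.mul_lap_lt_one hne ht hw
  have hz : 0 < w + t * lap 1 μ₀ w - front μ₀ t := by
    rcases eq_or_lt_of_le ht with rfl | ht
    · simpa [front_zero] using hw0
    · exact sub_pos.2 (h₀.strictMonoOn_char hne ht (mem_Ici.2 le_rfl) hw.le hw)
  have hθ : HasDerivAt (fun w => w + t * lap 1 μ₀ w - front μ₀ t) (1 + t * -lap 2 μ₀ w) w :=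
    ((hasDerivAt_id w).add ((h₀.hasDerivAt_lap (n := 1) le_rfl hw0).const_mul t)).sub_const _
  have h1 := ((hμ.admissible t ht).hasDerivAt_lap (n := 1) le_rfl hz).comp w hθ
  have h2 := (h₀.hasDerivAt_lap (n := 1) le_rfl hw0).congr_of_eventuallyEq
    (f₁ := lap 1 (μ t) ∘ fun w => w + t * lap 1 μ₀ w - front μ₀ t) (by
      filter_upwards [lt_mem_nhds hw] with v hv using hμ.lap_one_char h₀ ht hv)
  have h3 := h1.unique h2
  simp only [Nat.reduceAdd] at h3
  rw [eq_div_iff (by linarith)]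
  linarith

lemma lap_two_eq (hμ : IsTransported μ₀ μ) (h₀ : IsAdmissible μ₀) (hne : μ₀ ≠ 0) (ht : 0 ≤ t)
    (hy : 0 < y) : lap 2 (μ t) y
      = lap 2 μ₀ (charPt μ₀ y t) / (1 - t * lap 2 μ₀ (charPt μ₀ y t)) := by
  obtain ⟨h1, h2⟩ := h₀.charPt_spec hne ht hy
  have := hμ.lap_two_char h₀ hne ht h1
  rwa [h2] at this

end IsTransported

/-! ### Square integrability of the mass -/

lemma abs_one_sub_exp_le {m : ℝ} (hm : 0 < m) (hy : 0 < y) :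
    |1 - Real.exp (-(y * m))| ≤ (1 + y) * min m 1 := by
  have h1 : Real.exp (-(y * m)) ≤ 1 := Real.exp_le_one_iff.2 (by nlinarith)
  have h2 := Real.add_one_le_exp (-(y * m))
  have h3 := Real.exp_pos (-(y * m))
  rw [abs_of_nonneg (by linarith)]
  rcases le_total m 1 with h | h
  · rw [min_eq_left h]; nlinarith
  · rw [min_eq_right h]; nlinarith

/-- The primitive `y ↦ ⟨μ₀, 1 - e^{-ym}⟩` of the Laplace transform `⟨μ₀, m e^{-ym}⟩`. -/
lemma IsAdmissible.hasDerivAt_bernstein (h₀ : IsAdmissible μ₀) (hy : 0 < y) :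
    HasDerivAt (fun z => ∫ m, (1 - Real.exp (-(z * m))) ∂μ₀) (lap 1 μ₀ y) y := by
  refine (hasDerivAt_integral_of_dominated_loc_of_deriv_le (μ := μ₀) (s := Ioi (y / 2))
    (F := fun z m => 1 - Real.exp (-(z * m)))
    (F' := fun z m => m ^ 1 * Real.exp (-(z * m)))
    (bound := fun m => m ^ 1 * Real.exp (-(y / 2 * m))) (Ioi_mem_nhds (by linarith))
    (Eventually.of_forall fun z => Measurable.aestronglyMeasurable (by fun_prop)) ?_
    (Measurable.aestronglyMeasurable (by fun_prop)) ?_ (h₀.integrable_lap le_rfl (by positivity))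
    ?_).2
  · exact h₀.integrable (Measurable.aestronglyMeasurable (by fun_prop))
      fun m hm => abs_one_sub_exp_le hm hy
  · filter_upwards [h₀.ae_pos] with m hm
    intro z hz
    rw [Real.norm_of_nonneg (by positivity)]
    have := le_of_lt (mem_Ioi.1 hz)
    gcongr
  · refine Eventually.of_forall fun m z _ => ?_
    have h1 := (((hasDerivAt_id z).mul_const m).neg.exp).const_sub 1
    refine h1.congr_deriv ?_
    simp
    ring

namespace IsTransported

lemma aemeasurable_mass (hμ : IsTransported μ₀ μ) (h₀ : IsAdmissible μ₀) (hne : μ₀ ≠ 0) :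
    AEMeasurable (fun s => mass (μ s)) (volume.restrict (Ioc 0 t)) := by
  have h1 : ContinuousOn (fun s => mass (μ s)) (Ioc 0 t) :=
    ((h₀.continuousOn_lapE_foot hne).mono fun s hs => hs.1.le).congr fun s hs => hμ.mass_eq hs.1.le
  exact h1.aemeasurable measurableSet_Ioc

/-- If the gelation time is `0`, then `s ↦ 2 ⟨μ₀, 1 - e^{-l_s m}⟩ + s M_s²` is a nonnegative
primitive of `M_s²` on `(0, ∞)`; otherwise `M` is bounded. -/
lemma integrableOn_mass_sq (hμ : IsTransported μ₀ μ) (h₀ : IsAdmissible μ₀) (hne : μ₀ ≠ 0)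
    (ht : 0 < t) : IntegrableOn (fun s => (mass (μ s)).toReal ^ 2) (Ioc 0 t) := by
  have hmeas : AEStronglyMeasurable (fun s => (mass (μ s)).toReal ^ 2)
      (volume.restrict (Ioc 0 t)) :=
    ((hμ.aemeasurable_mass h₀ hne).ennreal_toReal.pow_const 2).aestronglyMeasurable
  rcases eq_or_lt_of_le (gelTime_nonneg μ₀) with hT | hT
  swap
  · have hM := h₀.mass_lt_top (secondMoment_lt_top_of_gelTime_pos hT)
    refine (integrable_const ((mass μ₀).toReal ^ 2)).mono' hmeas ?_
    filter_upwards [ae_restrict_mem measurableSet_Ioc] with s hs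
    rw [Real.norm_of_nonneg (by positivity)]
    gcongr
    · exact hM.ne
    · rw [hμ.mass_eq hs.1.le, mass_eq_lapE]
      exact lapE_antitone h₀.toIsRadonOnPos 1 (foot_nonneg _ _)
  let Φ : ℝ → ℝ := fun s => 2 * (∫ m, (1 - Real.exp (-(foot μ₀ s * m))) ∂μ₀)
    + s * lap 1 μ₀ (foot μ₀ s) ^ 2
  have hΦd : ∀ s, 0 < s → HasDerivAt Φ (lap 1 μ₀ (foot μ₀ s) ^ 2) s := by
    intro s hs
    have hs' : gelTime μ₀ < s := hT ▸ hs
    have hl := h₀.foot_pos hne hs'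
    have hd := h₀.hasDerivAt_foot hne hs'
    set l' := (lap 3 μ₀ (foot μ₀ s) / lap 2 μ₀ (foot μ₀ s) ^ 2)⁻¹
    have h1 := (h₀.hasDerivAt_bernstein hl).comp s hd
    have h2 := (h₀.hasDerivAt_lap (n := 1) le_rfl hl).comp s hd
    have h3 := (h1.const_mul 2).add ((hasDerivAt_id s).mul (h2.pow 2))
    refine h3.congr_deriv ?_
    have h4 := h₀.mul_lap_foot hne hs.le hl
    simp only [Function.comp, id, Nat.cast_ofNat, Nat.reduceAdd, Nat.add_one_sub_one, pow_one,
      Pi.pow_apply]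
    linear_combination (-2 * lap 1 μ₀ (foot μ₀ s) * l') * h4
  have hΦ0 : ∀ s, 0 < s → 0 ≤ Φ s := by
    intro s hs
    refine add_nonneg (mul_nonneg zero_le_two (integral_nonneg_of_ae ?_)) (by positivity)
    filter_upwards [h₀.ae_pos] with m hm
    have : Real.exp (-(foot μ₀ s * m)) ≤ 1 :=
      Real.exp_le_one_iff.2 (by have := foot_nonneg μ₀ s; nlinarith)
    simp only [Pi.zero_apply]
    linarith
  have hcont : ∀ s, 0 < s → ContinuousAt (fun s => lap 1 μ₀ (foot μ₀ s) ^ 2) s := fun s hs =>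
    (h₀.continuousAt_lap_foot hne hs).pow 2
  have hsub : ∀ k : ℕ, Icc (t / ((k : ℝ) + 1)) t ⊆ Ioi 0 := fun k s hs =>
    lt_of_lt_of_le (by positivity) hs.1
  have hle : ∀ k : ℕ, t / ((k : ℝ) + 1) ≤ t := fun k =>
    div_le_self ht.le (by linarith [(Nat.cast_nonneg k : (0 : ℝ) ≤ k)])
  refine IntegrableOn.congr_fun (f := fun s => lap 1 μ₀ (foot μ₀ s) ^ 2) ?_
    (fun s hs => by simp only [hμ.mass_toReal h₀ hs.1.le]) measurableSet_Ioc
  refine integrableOn_Ioc_of_intervalIntegral_norm_bounded_left (I := Φ t)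
    (a := fun k : ℕ => t / ((k : ℝ) + 1)) (l := atTop) (a₀ := 0) (fun k => ?_) ?_
    (Eventually.of_forall fun k => ?_)
  · have : ContinuousOn (fun s => lap 1 μ₀ (foot μ₀ s) ^ 2) (Icc (t / ((k : ℝ) + 1)) t) :=
      fun s hs => (hcont s (hsub k hs)).continuousWithinAt
    exact this.integrableOn_Icc.mono_set Ioc_subset_Icc_self
  · exact tendsto_const_nhds.div_atTop
      (tendsto_atTop_add_const_right _ _ tendsto_natCast_atTop_atTop)
  · have h1 : ∫ s in t / ((k : ℝ) + 1)..t, ‖lap 1 μ₀ (foot μ₀ s) ^ 2‖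
        = ∫ s in t / ((k : ℝ) + 1)..t, lap 1 μ₀ (foot μ₀ s) ^ 2 := by
      refine intervalIntegral.integral_congr fun s _ => ?_
      exact Real.norm_of_nonneg (by positivity)
    have h2 := intervalIntegral.integral_eq_sub_of_hasDerivAt (a := t / ((k : ℝ) + 1)) (b := t)
      (f := Φ) (f' := fun s => lap 1 μ₀ (foot μ₀ s) ^ 2)
      (fun s hs => hΦd s (hsub k (uIcc_of_le (hle k) ▸ hs)))
      (ContinuousOn.intervalIntegrable fun s hs =>
        (hcont s (hsub k (uIcc_of_le (hle k) ▸ hs))).continuousWithinAt)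
    rw [← intervalIntegral.integral_of_le (hle k), h1, h2]
    linarith [hΦ0 (t / ((k : ℝ) + 1)) (by positivity)]

lemma lintegral_mass_sq_lt_top (hμ : IsTransported μ₀ μ) (h₀ : IsAdmissible μ₀) (hne : μ₀ ≠ 0)
    (ht : 0 < t) : ∫⁻ s in Ioc 0 t, mass (μ s) ^ 2 < ∞ := by
  refine lt_of_eq_of_lt (setLIntegral_congr_fun measurableSet_Ioc fun s hs => ?_)
    (hμ.integrableOn_mass_sq h₀ hne ht).2
  rw [← ofReal_norm, Real.norm_of_nonneg (by positivity), ENNReal.ofReal_pow (by positivity),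
    ENNReal.ofReal_toReal (hμ.mass_lt_top h₀ hne hs.1).ne]

/-! ### The equation for exponential test functions -/

/-- With `Y_s` the starting point of the characteristic through `y` at time `s`, the coagulation
term is twice the time derivative of `⟨μ_s, m e^{-ym}⟩ = ⟨μ₀, m e^{-Y_s m}⟩`. -/
lemma satisfiesEquation_exp (hμ : IsTransported μ₀ μ) (h₀ : IsAdmissible μ₀) (hne : μ₀ ≠ 0)
    (ht : 0 < t) (hy : 0 < y) :
    SatisfiesEquation μ₀ μ t fun m => m ^ 1 * Real.exp (-(y * m)) := by
  have hco : ∀ s, 0 < s → coagulation (μ s) (fun m => m ^ 1 * Real.exp (-(y * m)))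
      = -(2 * (((mass (μ s)).toReal - lap 1 (μ s) y) * lap 2 (μ s) y)) := fun s hs =>
    coagulation_mul_exp (hμ.admissible s hs.le) (hμ.mass_lt_top h₀ hne hs) hy
  let f' : ℝ → ℝ := fun s => -lap 2 μ₀ (charPt μ₀ y s) *
    ((1 - s * lap 2 μ₀ (charPt μ₀ y s))⁻¹ * (lap 1 μ₀ (foot μ₀ s) - lap 1 μ₀ (charPt μ₀ y s)))
  have hf' : ∀ s, 0 < s → coagulation (μ s) (fun m => m ^ 1 * Real.exp (-(y * m))) = 2 * f' s := by
    intro s hs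
    rw [hco s hs, hμ.mass_toReal h₀ hs.le, hμ.lap_one_eq h₀ hne hs.le hy,
      hμ.lap_two_eq h₀ hne hs.le hy]
    simp only [f']
    ring
  have hder : ∀ s, 0 < s → HasDerivAt (fun s => lap 1 μ₀ (charPt μ₀ y s)) (f' s) s := fun s hs =>
    (h₀.hasDerivAt_lap (n := 1) le_rfl (h₀.charPt_pos hne hs.le hy)).comp s
      (h₀.hasDerivAt_charPt hne hs hy)
  have hcont0 : ∀ n, 1 ≤ n → ContinuousOn (fun s => lap n μ₀ (charPt μ₀ y s)) (Ici 0) :=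
    fun n hn s hs => (h₀.continuousAt_lap hn (h₀.charPt_pos hne hs hy)).comp_continuousWithinAt
      (h₀.continuousOn_charPt hne hy s hs)
  have hf'c : ContinuousOn f' (Ioc 0 t) := by
    have hsub : Ioc 0 t ⊆ Ici 0 := fun s hs => hs.1.le
    have c1 := (hcont0 1 le_rfl).mono hsub
    have c2 := (hcont0 2 (by norm_num)).mono hsub
    have c3 : ContinuousOn (fun s => lap 1 μ₀ (foot μ₀ s)) (Ioc 0 t) := fun s hs =>
      (h₀.continuousAt_lap_foot hne hs.1).continuousWithinAt
    refine c2.neg.mul (((continuousOn_const.sub (continuousOn_id.mul c2)).inv₀ fun s hs => ?_).mul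
      (c3.sub c1))
    have := h₀.mul_lap_lt_one hne hs.1.le (h₀.charPt_spec hne hs.1.le hy).1
    exact ne_of_gt (by simpa using this)
  have hf'b : ∀ s ∈ Ioc 0 t, ‖f' s‖ ≤ 3 / 2 * (1 + (Nat.factorial 1 : ℝ) / y ^ 1) *
      (mass (μ s)).toReal ^ 2 := by
    intro s hs
    have := abs_coagulation_le (hμ.admissible s hs.1.le).toIsRadonOnPos
      (hμ.mass_lt_top h₀ hne hs.1) (φ := fun m => m ^ 1 * Real.exp (-(y * m)))
      (C := 1 + (Nat.factorial 1 : ℝ) / y ^ 1) fun m hm =>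
        (abs_pow_mul_exp_le le_rfl hy m hm).trans (mul_le_of_le_one_right (by positivity)
          (min_le_right _ _))
    rw [hf' s hs.1, abs_mul, abs_two] at this
    rw [Real.norm_eq_abs]
    linarith
  have hint : IntervalIntegrable f' volume 0 t := by
    rw [intervalIntegrable_iff_integrableOn_Ioc_of_le ht.le]
    refine ((hμ.integrableOn_mass_sq h₀ hne ht).const_mul _).mono'
      (hf'c.aestronglyMeasurable measurableSet_Ioc)
      ((ae_restrict_iff' measurableSet_Ioc).2 (Eventually.of_forall hf'b))
  have hEq : EqOn (fun s => 2 * f' s)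
      (fun s => coagulation (μ s) fun m => m ^ 1 * Real.exp (-(y * m))) (Ioc 0 t) :=
    fun s hs => (hf' s hs.1).symm
  have hftc := intervalIntegral.integral_eq_sub_of_hasDerivAt_of_le ht.le
    ((hcont0 1 le_rfl).mono Icc_subset_Ici_self) (fun s hs => hder s hs.1) hint
  constructor
  · rw [intervalIntegrable_iff_integrableOn_Ioc_of_le ht.le] at hint ⊢
    exact IntegrableOn.congr_fun (hint.const_mul 2) hEq measurableSet_Ioc
  · have e1 : ∫ s in (0 : ℝ)..t, coagulation (μ s) (fun m => m ^ 1 * Real.exp (-(y * m)))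
        = 2 * ∫ s in (0 : ℝ)..t, f' s := by
      rw [← intervalIntegral.integral_const_mul, intervalIntegral.integral_of_le ht.le,
        intervalIntegral.integral_of_le ht.le]
      exact (setIntegral_congr_fun measurableSet_Ioc hEq).symm
    rw [e1, hftc, h₀.charPt_zero hne hy]
    have e2 := hμ.lap_one_eq h₀ hne ht.le hy
    change lap 1 (μ t) y = lap 1 μ₀ y + _
    rw [e2]
    ring

end IsTransported

end

section

/-! ### Density of the exponential test functions -/

variable {μ₀ : Measure ℝ} {μ : ℝ → Measure ℝ} {t y : ℝ}

/-- By the Weierstrass theorem in the variable `e^{-m}`, test functions are approximated, with an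
error of order `m e^{-m}`, by linear combinations of the functions `m e^{-km}`, `k ≥ 1`. -/
lemma IsTestFunction.exists_polynomial {φ : ℝ → ℝ} (hφ : IsTestFunction φ) {ε : ℝ} (hε : 0 < ε) :
    ∃ p : Polynomial ℝ, ∀ m, 0 < m → |m * Real.exp (-m) * p.eval (Real.exp (-m)) - φ m|
      ≤ ε * (m * Real.exp (-m)) := by
  obtain ⟨a, b, ha, hab⟩ := hφ.exists_support_subset
  have hzero : ∀ m, m ∉ Icc a b → φ m = 0 := fun m hm => by
    by_contra h
    exact hm (hab h)
  let Ψ : ℝ → ℝ := fun m => φ m / (m * Real.exp (-m))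
  have hΨ : Continuous Ψ := by
    refine continuous_iff_continuousAt.2 fun m => ?_
    rcases lt_or_ge m a with hm | hm
    · refine (continuousAt_const (y := (0 : ℝ))).congr ?_
      filter_upwards [gt_mem_nhds hm] with w hw
      simp [Ψ, hzero w fun h => absurd h.1 (not_le.2 hw)]
    · refine hφ.continuous.continuousAt.div (by fun_prop) ?_
      have := ha.trans_le hm
      positivity
  let f : ℝ → ℝ := fun x => Ψ (-Real.log x)
  have hf : ContinuousOn f (Icc 0 1) := by
    intro x hx
    refine ContinuousAt.continuousWithinAt ?_
    rcases eq_or_lt_of_le hx.1 with rfl | hx0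
    · -- near `0` the function vanishes, since `-log x` leaves the support of the test function
      refine (continuousAt_const (y := (0 : ℝ))).congr ?_
      filter_upwards [Metric.ball_mem_nhds (0 : ℝ) (Real.exp_pos (-b))] with w hw
      rw [Metric.mem_ball, dist_zero_right, Real.norm_eq_abs] at hw
      rcases eq_or_ne w 0 with rfl | hw0
      · simp [f, Ψ]
      · have h1 : Real.log |w| < -b := (Real.log_lt_iff_lt_exp (abs_pos.2 hw0)).2 hw
        rw [Real.log_abs] at h1
        simp [f, Ψ, hzero (-Real.log w) fun h => absurd h.2 (by linarith)]
    · exact hΨ.continuousAt.comp (Real.continuousAt_log hx0.ne').neg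
  obtain ⟨p, hp⟩ := exists_polynomial_near_of_continuousOn 0 1 f hf ε hε
  refine ⟨p, fun m hm => ?_⟩
  have hpos : 0 < m * Real.exp (-m) := by positivity
  have h1 := (hp (Real.exp (-m)) ⟨(Real.exp_pos _).le, Real.exp_le_one_iff.2 (by linarith)⟩).le
  simp only [f, Ψ, Real.log_exp, neg_neg] at h1
  have e : m * Real.exp (-m) * p.eval (Real.exp (-m)) - φ m
      = (p.eval (Real.exp (-m)) - φ m / (m * Real.exp (-m))) * (m * Real.exp (-m)) := by
    field_simp
  rw [e, abs_mul, abs_of_pos hpos]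
  exact mul_le_mul_of_nonneg_right h1 hpos.le

lemma IsTestFunction.exists_le_min {φ : ℝ → ℝ} (hφ : IsTestFunction φ) :
    ∃ C, ∀ m, 0 < m → |φ m| ≤ C * min m 1 := by
  obtain ⟨a, b, ha, hab⟩ := hφ.exists_support_subset
  obtain ⟨C, hC⟩ := hφ.hasCompactSupport.exists_bound_of_continuous hφ.continuous
  have ha' : 0 < min a 1 := lt_min ha one_pos
  have hC0 : 0 ≤ C := (norm_nonneg _).trans (hC 0)
  refine ⟨C / min a 1, fun m hm => ?_⟩
  by_cases hm' : m ∈ Icc a b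
  · rw [div_mul_eq_mul_div, le_div_iff₀ ha']
    exact mul_le_mul (hC m) (min_le_min_right _ hm'.1) ha'.le hC0
  · have : φ m = 0 := by
      by_contra h
      exact hm' (hab h)
    rw [this, abs_zero]
    positivity

lemma coagulation_add {ν : Measure ℝ} (h : IsRadonOnPos ν) (hM : mass ν < ∞) {φ ψ : ℝ → ℝ}
    {C D : ℝ} (hφ : Measurable φ) (hψ : Measurable ψ) (hC : ∀ m, 0 < m → |φ m| ≤ C)
    (hD : ∀ m, 0 < m → |ψ m| ≤ D) :
    coagulation ν (fun m => φ m + ψ m) = coagulation ν φ + coagulation ν ψ := by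
  rw [coagulation, coagulation, coagulation,
    ← integral_add (integrable_coagulation h hM hφ hC) (integrable_coagulation h hM hψ hD)]
  refine integral_congr_ae (Eventually.of_forall fun p => ?_)
  simp only
  ring

lemma coagulation_const_mul (ν : Measure ℝ) (φ : ℝ → ℝ) (c : ℝ) :
    coagulation ν (fun m => c * φ m) = c * coagulation ν φ := by
  rw [coagulation, coagulation, ← integral_const_mul]
  refine integral_congr_ae (Eventually.of_forall fun p => ?_)
  simp only
  ring

lemma SatisfiesEquation.const_mul {φ : ℝ → ℝ} (h : SatisfiesEquation μ₀ μ t φ) (c : ℝ) :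
    SatisfiesEquation μ₀ μ t fun m => c * φ m := by
  simp only [SatisfiesEquation, coagulation_const_mul, integral_const_mul,
    intervalIntegral.integral_const_mul]
  refine ⟨h.1.const_mul c, ?_⟩
  rw [h.2]
  ring

namespace IsTransported

lemma satisfiesEquation_add (hμ : IsTransported μ₀ μ) (h₀ : IsAdmissible μ₀) (hne : μ₀ ≠ 0)
    (ht : 0 < t) {φ ψ : ℝ → ℝ} {C D : ℝ} (hφ : Continuous φ) (hψ : Continuous ψ)
    (hC : ∀ m, 0 < m → |φ m| ≤ C * min m 1) (hD : ∀ m, 0 < m → |ψ m| ≤ D * min m 1)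
    (h1 : SatisfiesEquation μ₀ μ t φ) (h2 : SatisfiesEquation μ₀ μ t ψ) :
    SatisfiesEquation μ₀ μ t fun m => φ m + ψ m := by
  have hbd : ∀ {C : ℝ} {φ : ℝ → ℝ}, (∀ m, 0 < m → |φ m| ≤ C * min m 1) →
      ∀ m, 0 < m → |φ m| ≤ C := by
    intro C φ h m hm
    have h0 : 0 ≤ C := by simpa using (abs_nonneg _).trans (h 1 one_pos)
    exact (h m hm).trans (mul_le_of_le_one_right h0 (min_le_right _ _))
  have hEq : EqOn (fun s => coagulation (μ s) φ + coagulation (μ s) ψ)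
      (fun s => coagulation (μ s) fun m => φ m + ψ m) (Ioc 0 t) := fun s hs =>
    (coagulation_add (hμ.admissible s hs.1.le).toIsRadonOnPos (hμ.mass_lt_top h₀ hne hs.1)
      hφ.measurable hψ.measurable (hbd hC) (hbd hD)).symm
  have hint := h1.1.add h2.1
  constructor
  · rw [intervalIntegrable_iff_integrableOn_Ioc_of_le ht.le] at hint ⊢
    exact IntegrableOn.congr_fun hint hEq measurableSet_Ioc
  · have ha := hμ.admissible t ht.le
    rw [integral_add (ha.integrable hφ.aestronglyMeasurable hC)
      (ha.integrable hψ.aestronglyMeasurable hD),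
      integral_add (h₀.integrable hφ.aestronglyMeasurable hC)
      (h₀.integrable hψ.aestronglyMeasurable hD), h1.2, h2.2]
    have e : ∫ s in (0 : ℝ)..t, coagulation (μ s) (fun m => φ m + ψ m)
        = (∫ s in (0 : ℝ)..t, coagulation (μ s) φ) + ∫ s in (0 : ℝ)..t, coagulation (μ s) ψ := by
      rw [← intervalIntegral.integral_add h1.1 h2.1, intervalIntegral.integral_of_le ht.le,
        intervalIntegral.integral_of_le ht.le]
      exact (setIntegral_congr_fun measurableSet_Ioc hEq).symm
    rw [e]
    ring

lemma satisfiesEquation_polynomial (hμ : IsTransported μ₀ μ) (h₀ : IsAdmissible μ₀)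
    (hne : μ₀ ≠ 0) (ht : 0 < t) (p : Polynomial ℝ) :
    (∃ C, ∀ m, 0 < m → |m * Real.exp (-m) * p.eval (Real.exp (-m))| ≤ C * min m 1) ∧
      SatisfiesEquation μ₀ μ t fun m => m * Real.exp (-m) * p.eval (Real.exp (-m)) := by
  induction p using Polynomial.induction_on' with
  | add p q hp hq =>
    obtain ⟨⟨C, hC⟩, hp⟩ := hp
    obtain ⟨⟨D, hD⟩, hq⟩ := hq
    simp only [Polynomial.eval_add, mul_add]
    refine ⟨⟨C + D, fun m hm => ?_⟩, hμ.satisfiesEquation_add h₀ hne ht (by fun_prop)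
      (by fun_prop) hC hD hp hq⟩
    exact (abs_add_le _ _).trans (by linarith [hC m hm, hD m hm])
  | monomial k c =>
    have hk : (0 : ℝ) < (k : ℝ) + 1 := by positivity
    have e : (fun m => m * Real.exp (-m) * (Polynomial.monomial k c).eval (Real.exp (-m)))
        = fun m => c * (m ^ 1 * Real.exp (-(((k : ℝ) + 1) * m))) := by
      funext m
      rw [Polynomial.eval_monomial, ← Real.exp_nat_mul]
      have : Real.exp (-(((k : ℝ) + 1) * m)) = Real.exp (-m) * Real.exp (k * -m) := by
        rw [← Real.exp_add]; ring_nf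
      rw [this]
      ring
    rw [e]
    refine ⟨⟨|c| * (1 + (Nat.factorial 1 : ℝ) / ((k : ℝ) + 1) ^ 1), fun m hm => ?_⟩,
      (hμ.satisfiesEquation_exp h₀ hne ht hk).const_mul c⟩
    have h1 := congrFun e m
    rw [h1, abs_mul, mul_assoc]
    exact mul_le_mul_of_nonneg_left (abs_pow_mul_exp_le le_rfl hk m hm) (abs_nonneg _)

lemma satisfiesEquation (hμ : IsTransported μ₀ μ) (h₀ : IsAdmissible μ₀) (hne : μ₀ ≠ 0)
    (ht : 0 < t) {φ : ℝ → ℝ} (hφ : IsTestFunction φ) : SatisfiesEquation μ₀ μ t φ := by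
  have hε : ∀ k : ℕ, (0 : ℝ) < 1 / ((k : ℝ) + 1) := fun k => by positivity
  choose p hp using fun k : ℕ => hφ.exists_polynomial (hε k)
  obtain ⟨C, hC⟩ := hφ.exists_le_min
  refine SatisfiesEquation.of_tendsto (C := C + (1 + (Nat.factorial 1 : ℝ) / 1 ^ 1)) h₀ ht
    (hμ.admissible t ht.le) ?_ (hμ.integrableOn_mass_sq h₀ hne ht)
    (ψ := fun k m => m * Real.exp (-m) * (p k).eval (Real.exp (-m))) (fun k => by fun_prop)
    (fun k m hm => ?_) (fun m hm => ?_) fun k => (hμ.satisfiesEquation_polynomial h₀ hne ht (p k)).2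
  · filter_upwards [ae_restrict_mem measurableSet_Ioc] with s hs
    exact ⟨(hμ.admissible s hs.1.le).toIsRadonOnPos, hμ.mass_lt_top h₀ hne hs.1⟩
  · have h1 := hp k m hm
    have h2 := pow_mul_exp_neg_le_min hm one_pos (n := 1) le_rfl
    rw [pow_one, one_mul] at h2
    have h3 : (1 : ℝ) / ((k : ℝ) + 1) ≤ 1 := by
      rw [div_le_one (by positivity)]
      linarith [(Nat.cast_nonneg k : (0 : ℝ) ≤ k)]
    have h4 : 0 < m * Real.exp (-m) := by positivity
    have h5 := abs_sub_abs_le_abs_sub (m * Real.exp (-m) * (p k).eval (Real.exp (-m))) (φ m)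
    have h6 := hC m hm
    nlinarith
  · rw [tendsto_iff_norm_sub_tendsto_zero]
    refine squeeze_zero (fun k => norm_nonneg _) (fun k => hp k m hm) ?_
    have := (tendsto_one_div_add_atTop_nhds_zero_nat (𝕜 := ℝ)).mul_const (m * Real.exp (-m))
    rwa [zero_mul] at this

/-! ### The second moment -/

/-- Before gelation, `⟨μ_t, m² e^{-ym}⟩ = k / (1 - t k)` with
`k = ⟨μ₀, m² e^{-Y_t(y) m}⟩ ≤ ⟨μ₀, m²⟩`. -/
lemma secondMoment_le (hμ : IsTransported μ₀ μ) (h₀ : IsAdmissible μ₀) (hne : μ₀ ≠ 0)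
    (ht0 : 0 ≤ t) (ht : t < gelTime μ₀) : secondMoment (μ t) ≤
      ENNReal.ofReal ((secondMoment μ₀).toReal / (1 - t * (secondMoment μ₀).toReal)) := by
  have h2 := secondMoment_lt_top_of_gelTime_pos (ht0.trans_lt ht)
  have h3 := h₀.gelTime_mul hne h2
  set K := (secondMoment μ₀).toReal with hK
  have hK0 : 0 < K := by
    refine lt_of_le_of_ne ENNReal.toReal_nonneg fun h => ?_
    rw [← h] at h3
    simp at h3
  have htK : t * K < 1 := h3 ▸ mul_lt_mul_of_pos_right ht hK0
  have ha := hμ.admissible t ht0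
  rw [secondMoment_eq_lapE]
  refine lapE_le_of_forall_gt ha.toIsRadonOnPos fun y hy => ?_
  rw [lapE_eq_ofReal ha.toIsRadonOnPos (ha.integrable_lap (by norm_num) hy),
    hμ.lap_two_eq h₀ hne ht0 hy]
  refine ENNReal.ofReal_le_ofReal ?_
  have hk : lap 2 μ₀ (charPt μ₀ y t) ≤ K := by
    rw [lap_eq_toReal h₀.toIsRadonOnPos, hK]
    rw [secondMoment_eq_lapE] at h2 ⊢
    exact ENNReal.toReal_mono h2.ne
      (lapE_antitone h₀.toIsRadonOnPos 2 (h₀.charPt_pos hne ht0 hy).le)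
  have hk' := mul_le_mul_of_nonneg_left hk ht0
  exact div_le_div₀ hK0.le hk (by linarith) (by linarith)

/-- From the gelation time on, `1 - t ⟨μ₀, m² e^{-wm}⟩` vanishes at the foot `w = l_t`. -/
lemma secondMoment_eq_top (hμ : IsTransported μ₀ μ) (h₀ : IsAdmissible μ₀) (hne : μ₀ ≠ 0)
    (ht : gelTime μ₀ ≤ t) : secondMoment (μ t) = ∞ := by
  rcases eq_or_lt_of_le ((gelTime_nonneg μ₀).trans ht) with rfl | ht0
  · rw [hμ.initial]
    by_contra hcon
    have := h₀.gelTime_mul hne (lt_top_iff_ne_top.2 hcon)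
    rw [le_antisymm ht (gelTime_nonneg μ₀), zero_mul] at this
    exact zero_ne_one this
  have htk : t * lap 2 μ₀ (foot μ₀ t) = 1 := by
    rcases eq_or_lt_of_le ht with rfl | ht
    · rw [h₀.foot_eq_zero hne ht0.le le_rfl, lap_eq_toReal h₀.toIsRadonOnPos,
        ← secondMoment_eq_lapE]
      exact h₀.gelTime_mul hne (secondMoment_lt_top_of_gelTime_pos ht0)
    · exact h₀.mul_lap_foot hne ht0.le (h₀.foot_pos hne ht)
  by_contra hcon
  set C := (secondMoment (μ t)).toReal with hC
  have ha := hμ.admissible t ht0.le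
  have key : ∀ w, foot μ₀ t < w → lap 2 μ₀ w ≤ C * (1 - t * lap 2 μ₀ w) := by
    intro w hw
    have h1 := hμ.lap_two_char h₀ hne ht0.le hw
    have hk := h₀.mul_lap_lt_one hne ht0.le hw
    have hz : 0 < w + t * lap 1 μ₀ w - front μ₀ t :=
      sub_pos.2 (h₀.strictMonoOn_char hne ht0 (mem_Ici.2 le_rfl) hw.le hw)
    rw [← div_le_iff₀ (by linarith), ← h1, lap_eq_toReal ha.toIsRadonOnPos, hC]
    rw [secondMoment_eq_lapE] at hcon ⊢
    exact ENNReal.toReal_mono hcon (lapE_antitone ha.toIsRadonOnPos 2 hz.le)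
  have hlim : Tendsto (lap 2 μ₀) (𝓝[>] (foot μ₀ t)) (𝓝 (lap 2 μ₀ (foot μ₀ t))) := by
    have := (ENNReal.tendsto_toReal (h₀.lapE_two_foot_lt_top hne ht0).ne).comp
      (lapE_tendsto_nhdsGT h₀.toIsRadonOnPos 2 (foot μ₀ t))
    rw [← lap_eq_toReal h₀.toIsRadonOnPos] at this
    exact this.congr fun w => (lap_eq_toReal h₀.toIsRadonOnPos 2 w).symm
  have hle := le_of_tendsto_of_tendsto hlim
    ((tendsto_const_nhds.sub (hlim.const_mul t)).const_mul C)
    (by filter_upwards [self_mem_nhdsWithin] with w hw using key w hw)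
  rw [htk, sub_self, mul_zero] at hle
  nlinarith

theorem isSolution (hμ : IsTransported μ₀ μ) (h₀ : IsAdmissible μ₀) (hne : μ₀ ≠ 0) :
    IsSolution μ₀ μ where
  initial := hμ.initial
  radon t ht := (hμ.admissible t ht).toIsRadonOnPos
  mass_sq t ht := hμ.lintegral_mass_sq_lt_top h₀ hne ht
  integrable φ hφ t ht := (hμ.satisfiesEquation h₀ hne ht hφ).1
  equation φ hφ t ht := (hμ.satisfiesEquation h₀ hne ht hφ).2
  secondMoment_bounded h2 := by
    have h3 := h₀.gelTime_mul hne h2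
    have hT : 0 < gelTime μ₀ := by
      refine lt_of_le_of_ne (gelTime_nonneg _) fun h => ?_
      rw [← h, zero_mul] at h3
      exact zero_ne_one h3
    have hK0 : 0 ≤ (secondMoment μ₀).toReal := ENNReal.toReal_nonneg
    refine ⟨gelTime μ₀ / 2, by positivity, ENNReal.ofReal ((secondMoment μ₀).toReal / (1 / 2)),
      ENNReal.ofReal_lt_top, fun t ht => ?_⟩
    refine (hμ.secondMoment_le h₀ hne ht.1 (by linarith [ht.2])).trans
      (ENNReal.ofReal_le_ofReal ?_)
    have := mul_le_mul_of_nonneg_right ht.2.le hK0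
    exact div_le_div_of_nonneg_left hK0 (by norm_num) (by linarith)

end IsTransported

end

section

/-! ### The generating function -/

variable {μ₀ : Measure ℝ} {μ : ℝ → Measure ℝ} {t x y : ℝ}

lemma mul_rpow_eq (hx : 0 < x) (m : ℝ) :
    m * x ^ m = m ^ 1 * Real.exp (-(-Real.log x * m)) := by
  rw [Real.rpow_def_of_pos hx, pow_one]
  ring_nf

lemma genFun_eq_lap (μ₀ : Measure ℝ) (hx : 0 < x) : genFun μ₀ x = lap 1 μ₀ (-Real.log x) := by
  simp only [genFun, lap, mul_rpow_eq hx]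

lemma neg_log_pos (hx : x ∈ Ioo (0 : ℝ) 1) : 0 < -Real.log x :=
  neg_pos.2 (Real.log_neg hx.1 hx.2)

namespace IsAdmissible

lemma integrable_mul_rpow (h₀ : IsAdmissible μ₀) (hx : x ∈ Ico (0 : ℝ) 1) :
    Integrable (fun m : ℝ => m * x ^ m) μ₀ := by
  rcases eq_or_lt_of_le hx.1 with rfl | hx0
  · refine (integrable_zero ℝ ℝ μ₀).congr ?_
    filter_upwards [h₀.ae_pos] with m hm
    simp [Real.zero_rpow hm.ne']
  · simp only [mul_rpow_eq hx0]
    exact h₀.integrable_lap le_rfl (neg_log_pos ⟨hx0, hx.2⟩)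

lemma analyticOn_genFun (h₀ : IsAdmissible μ₀) : AnalyticOn ℝ (genFun μ₀) (Ioo 0 1) := by
  intro x hx
  refine AnalyticAt.analyticWithinAt ?_
  have h1 : AnalyticAt ℝ (fun x => lap 1 μ₀ (-Real.log x)) x :=
    AnalyticAt.fun_comp (g := lap 1 μ₀) (f := fun x => -Real.log x)
      (h₀.analyticAt_lap le_rfl (neg_log_pos hx)) (analyticAt_log hx.1).neg
  refine h1.congr ?_
  filter_upwards [lt_mem_nhds hx.1] with z hz using (genFun_eq_lap μ₀ hz).symm

lemma hasDerivAt_lap_neg_log (h₀ : IsAdmissible μ₀) {n : ℕ} (hn : 1 ≤ n)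
    (hx : x ∈ Ioo (0 : ℝ) 1) : HasDerivAt (fun x => lap n μ₀ (-Real.log x))
      (lap (n + 1) μ₀ (-Real.log x) / x) x := by
  have h1 := (h₀.hasDerivAt_lap hn (neg_log_pos hx)).comp x (Real.hasDerivAt_log hx.1.ne').neg
  refine h1.congr_deriv ?_
  rw [neg_mul_neg, div_eq_mul_inv]

lemma deriv_genFun (h₀ : IsAdmissible μ₀) (hx : x ∈ Ioo (0 : ℝ) 1) :
    deriv (genFun μ₀) x = lap 2 μ₀ (-Real.log x) / x := by
  refine ((h₀.hasDerivAt_lap_neg_log le_rfl hx).congr_of_eventuallyEq ?_).deriv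
  filter_upwards [lt_mem_nhds hx.1] with z hz using genFun_eq_lap μ₀ hz

lemma deriv_deriv_genFun (h₀ : IsAdmissible μ₀) (hx : x ∈ Ioo (0 : ℝ) 1) :
    deriv (deriv (genFun μ₀)) x
      = (lap 3 μ₀ (-Real.log x) - lap 2 μ₀ (-Real.log x)) / x ^ 2 := by
  have h1 := (h₀.hasDerivAt_lap_neg_log (n := 2) (by norm_num) hx).div (hasDerivAt_id x) hx.1.ne'
  have h2 : deriv (genFun μ₀) =ᶠ[𝓝 x] fun x => lap 2 μ₀ (-Real.log x) / x := by
    filter_upwards [Ioo_mem_nhds hx.1 hx.2] with z hz using h₀.deriv_genFun hz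
  rw [h2.deriv_eq]
  refine (h1.congr_deriv ?_).deriv
  have := hx.1.ne'
  simp only [id, mul_one, Nat.reduceAdd]
  field_simp

lemma genFun_quotient (h₀ : IsAdmissible μ₀) (hx : x ∈ Ioo (0 : ℝ) 1) :
    -(deriv (genFun μ₀) x ^ 3 / (deriv (genFun μ₀) x + x * deriv (deriv (genFun μ₀)) x))
      = -(lap 2 μ₀ (-Real.log x) ^ 3 / lap 3 μ₀ (-Real.log x)) / x ^ 2 := by
  have hx0 := hx.1.ne'
  rw [h₀.deriv_genFun hx, h₀.deriv_deriv_genFun hx]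
  have e : lap 2 μ₀ (-Real.log x) / x + x * ((lap 3 μ₀ (-Real.log x) - lap 2 μ₀ (-Real.log x))
      / x ^ 2) = lap 3 μ₀ (-Real.log x) / x := by
    field_simp
    ring
  rw [e]
  rcases eq_or_ne (lap 3 μ₀ (-Real.log x)) 0 with h | h
  · simp [h]
  · field_simp

/-! ### The mass as a function of time -/

lemma lapE_one_lt (h₀ : IsAdmissible μ₀) (hne : μ₀ ≠ 0) (hx : 0 ≤ x) (hxy : x < y) :
    lapE 1 μ₀ y < lapE 1 μ₀ x := by
  obtain ⟨w, hw1, hw2⟩ := exists_between hxy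
  have hw0 := hx.trans_lt hw1
  refine lt_of_lt_of_le ?_ (lapE_antitone h₀.toIsRadonOnPos 1 hw1.le)
  rw [lapE_eq_ofReal h₀.toIsRadonOnPos (h₀.integrable_lap le_rfl hw0),
    lapE_eq_ofReal h₀.toIsRadonOnPos (h₀.integrable_lap le_rfl (hw0.trans hw2))]
  exact (ENNReal.ofReal_lt_ofReal_iff (h₀.lap_pos hne le_rfl hw0)).2
    (h₀.strictAntiOn_lap hne le_rfl hw0 (hw0.trans hw2) hw2)

lemma hasDerivAt_lap_foot (h₀ : IsAdmissible μ₀) (hne : μ₀ ≠ 0) (ht : gelTime μ₀ < t) :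
    HasDerivAt (fun t => lap 1 μ₀ (foot μ₀ t))
      (-(lap 2 μ₀ (foot μ₀ t) ^ 3 / lap 3 μ₀ (foot μ₀ t))) t := by
  have hl := h₀.foot_pos hne ht
  refine ((h₀.hasDerivAt_lap (n := 1) le_rfl hl).comp t (h₀.hasDerivAt_foot hne ht)).congr_deriv ?_
  rw [inv_div]
  ring

/-- The limit of the quotient of derivatives of the generating function, read along `x = e^{-l_t}`,
is the limit of the derivative of the mass. -/
lemma tendsto_deriv_mass (h₀ : IsAdmissible μ₀) (hne : μ₀ ≠ 0) {ν : EReal}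
    (hν : Tendsto (fun x : ℝ => ((-(deriv (genFun μ₀) x ^ 3 / (deriv (genFun μ₀) x +
      x * deriv (deriv (genFun μ₀)) x)) : ℝ) : EReal)) (𝓝[<] 1) (𝓝 ν)) :
    Tendsto (fun t => ((-(lap 2 μ₀ (foot μ₀ t) ^ 3 / lap 3 μ₀ (foot μ₀ t)) : ℝ) : EReal))
      (𝓝[>] (gelTime μ₀)) (𝓝 ν) := by
  have hT := gelTime_nonneg μ₀
  have hl : Tendsto (foot μ₀) (𝓝[>] (gelTime μ₀)) (𝓝 0) := by
    have := ((h₀.continuousOn_foot hne) _ hT).mono (Ioi_subset_Ici hT)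
    rw [ContinuousWithinAt, h₀.foot_eq_zero hne hT le_rfl] at this
    exact this
  have hex : Tendsto (fun t => Real.exp (-foot μ₀ t)) (𝓝[>] (gelTime μ₀)) (𝓝[<] 1) := by
    refine tendsto_nhdsWithin_iff.2 ⟨?_, ?_⟩
    · have := (Real.continuous_exp.tendsto _).comp hl.neg
      rw [neg_zero, Real.exp_zero] at this
      exact this
    · filter_upwards [self_mem_nhdsWithin] with t ht
      exact Real.exp_lt_one_iff.2 (neg_lt_zero.2 (h₀.foot_pos hne ht))
  -- the two quotients differ by the factor `x ^ 2`, which tends to `1`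
  have h1 := hν.comp hex
  have h2 : Tendsto (fun t => ((Real.exp (-foot μ₀ t) ^ 2 : ℝ) : EReal)) (𝓝[>] (gelTime μ₀))
      (𝓝 1) := by
    have h3 := ((Real.continuous_exp.tendsto _).comp hl.neg).pow 2
    rw [neg_zero, Real.exp_zero, one_pow] at h3
    exact (continuous_coe_real_ereal.tendsto 1).comp h3
  have h3 := EReal.tendsto_mul (a := ν) (b := 1) (Or.inr (EReal.coe_ne_bot 1))
    (Or.inr (EReal.coe_ne_top 1)) (Or.inr one_ne_zero) (Or.inr one_ne_zero)
    |>.comp (h1.prodMk_nhds h2)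
  rw [mul_one] at h3
  refine h3.congr' ?_
  filter_upwards [self_mem_nhdsWithin] with t ht
  have hl0 := h₀.foot_pos hne ht
  simp only [Function.comp]
  rw [← EReal.coe_mul, h₀.genFun_quotient ⟨Real.exp_pos _,
    Real.exp_lt_one_iff.2 (neg_lt_zero.2 hl0)⟩,
    Real.log_exp, neg_neg, div_mul_cancel₀]
  positivity

lemma limit_nonpos (h₀ : IsAdmissible μ₀) {ν : EReal}
    (hν : Tendsto (fun t => ((-(lap 2 μ₀ (foot μ₀ t) ^ 3 / lap 3 μ₀ (foot μ₀ t)) : ℝ) : EReal))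
      (𝓝[>] (gelTime μ₀)) (𝓝 ν)) : ν ≤ 0 := by
  refine le_of_tendsto hν (Eventually.of_forall fun t => ?_)
  have h1 := lap_nonneg h₀.toIsRadonOnPos 2 (foot μ₀ t)
  have h2 := lap_nonneg h₀.toIsRadonOnPos 3 (foot μ₀ t)
  exact_mod_cast neg_nonpos.2 (by positivity)

/-! ### Long-time behaviour -/

lemma restrict (h₀ : IsAdmissible μ₀) (s : Set ℝ) : IsAdmissible (μ₀.restrict s) where
  null_nonpos := le_antisymm ((Measure.restrict_apply_le _ _).trans h₀.null_nonpos.le) zero_le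
  finite_Icc a b ha := (Measure.restrict_apply_le _ _).trans_lt (h₀.finite_Icc a b ha)
  min_lt_top := (lintegral_mono' Measure.restrict_le_self le_rfl).trans_lt h₀.min_lt_top

/-- The quotient of the first two Laplace moments concentrates at the lower end of the support. -/
lemma tendsto_lap_two_div_lap_one (h₀ : IsAdmissible μ₀) (hne : μ₀ ≠ 0) :
    Tendsto (fun y => lap 2 μ₀ y / lap 1 μ₀ y) atTop (𝓝 (sInf μ₀.support)) := by
  set m₀ := sInf μ₀.support
  have hsupp : ∀ᵐ m ∂μ₀, m ∈ μ₀.support := Measure.support_mem_ae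
  have hsub : μ₀.support ⊆ Ici 0 := Measure.support_subset_of_isClosed isClosed_Ici
    (by filter_upwards [h₀.ae_pos] with m hm using hm.le)
  have hbdd : BddBelow μ₀.support := ⟨0, fun m hm => hsub hm⟩
  have hm₀ : 0 ≤ m₀ := Real.sInf_nonneg fun m hm => hsub hm
  refine tendsto_order.2 ⟨fun c hc => ?_, fun c hc => ?_⟩
  · filter_upwards [eventually_gt_atTop 0] with y hy
    refine hc.trans_le ?_
    rw [le_div_iff₀ (h₀.lap_pos hne le_rfl hy), lap, lap, ← integral_const_mul]
    refine integral_mono_ae ((h₀.integrable_lap le_rfl hy).const_mul _)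
      (h₀.integrable_lap (by norm_num) hy) ?_
    filter_upwards [hsupp, h₀.ae_pos] with m hm hm0
    have h1 : m₀ ≤ m := csInf_le hbdd hm
    have h2 : 0 < m * Real.exp (-(y * m)) := by positivity
    nlinarith
  · obtain ⟨d, hd1, hd2⟩ := exists_between hc
    obtain ⟨b, hb1, hb2⟩ := exists_between hd1
    have hd0 : 0 < d := hm₀.trans_lt hd1
    -- the part of the measure on `(0, b)` bounds the first moment from below
    set σ := μ₀.restrict (Iio b)
    have hσ : IsAdmissible σ := h₀.restrict _
    have hσne : σ ≠ 0 := by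
      obtain ⟨a, ha, hab⟩ := exists_lt_of_csInf_lt (Measure.nonempty_support hne) hb1
      have h1 := (Measure.mem_support_iff_forall a).1 ha (Iio b) (Iio_mem_nhds hab)
      intro h
      rw [Measure.restrict_eq_zero] at h
      exact h1.ne' h
    have hκ := hσ.lap_pos hσne (n := 1) le_rfl one_pos
    set κ := lap 1 σ 1
    have hlow : ∀ y, 1 ≤ y → Real.exp (-((y - 1) * b)) * κ ≤ lap 1 μ₀ y := by
      intro y hy
      have hy0 : 0 < y := by linarith
      have h1 : Real.exp (-((y - 1) * b)) * κ ≤ lap 1 σ y := by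
        change _ * (∫ m, m ^ 1 * Real.exp (-(1 * m)) ∂σ) ≤ _
        rw [lap, ← integral_const_mul]
        refine integral_mono_ae ((hσ.integrable_lap le_rfl one_pos).const_mul _)
          (hσ.integrable_lap le_rfl hy0) ?_
        filter_upwards [hσ.ae_pos, ae_restrict_mem measurableSet_Iio] with m hm hmb
        have h2 : Real.exp (-(y * m)) = Real.exp (-((y - 1) * m)) * Real.exp (-(1 * m)) := by
          rw [← Real.exp_add]; ring_nf
        have h3 : Real.exp (-((y - 1) * b)) ≤ Real.exp (-((y - 1) * m)) := by
          refine Real.exp_le_exp.2 (neg_le_neg (mul_le_mul_of_nonneg_left (le_of_lt hmb) ?_))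
          linarith
        have h4 : 0 < m * Real.exp (-(1 * m)) := by positivity
        rw [h2]
        nlinarith
      refine h1.trans ?_
      rw [lap_eq_toReal hσ.toIsRadonOnPos, lap_eq_toReal h₀.toIsRadonOnPos]
      exact ENNReal.toReal_mono (h₀.lapE_lt_top le_rfl hy0).ne
        (lintegral_mono' Measure.restrict_le_self le_rfl)
    -- and the contribution of the points beyond `d` is exponentially smaller, as `b < d`
    have hup : ∀ y, 1 ≤ y →
        lap 2 μ₀ y - d * lap 1 μ₀ y ≤ Real.exp (-((y - 1) * d)) * lap 2 μ₀ 1 := by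
      intro y hy
      have hy0 : 0 < y := by linarith
      rw [lap, lap, lap, ← integral_const_mul, ← integral_const_mul,
        ← integral_sub (h₀.integrable_lap (by norm_num) hy0)
          ((h₀.integrable_lap le_rfl hy0).const_mul _)]
      refine integral_mono_ae ((h₀.integrable_lap (by norm_num) hy0).sub
        ((h₀.integrable_lap le_rfl hy0).const_mul _))
        ((h₀.integrable_lap (by norm_num) one_pos).const_mul _) ?_
      filter_upwards [h₀.ae_pos] with m hm
      have h2 : Real.exp (-(y * m)) = Real.exp (-((y - 1) * m)) * Real.exp (-(1 * m)) := by
        rw [← Real.exp_add]; ring_nf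
      have h4 : 0 < m * Real.exp (-(1 * m)) := by positivity
      have h5 := Real.exp_pos (-((y - 1) * d))
      have h6 := Real.exp_pos (-((y - 1) * m))
      rw [h2]
      rcases le_total m d with hmd | hmd
      · have e1 : m ^ 2 * (Real.exp (-((y - 1) * m)) * Real.exp (-(1 * m)))
            - d * (m ^ 1 * (Real.exp (-((y - 1) * m)) * Real.exp (-(1 * m)))) ≤ 0 := by
          have : 0 < m * Real.exp (-(1 * m)) * Real.exp (-((y - 1) * m)) := by positivity
          nlinarith
        exact e1.trans (by positivity)
      · have h3 : Real.exp (-((y - 1) * m)) ≤ Real.exp (-((y - 1) * d)) := by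
          refine Real.exp_le_exp.2 (neg_le_neg (mul_le_mul_of_nonneg_left hmd ?_))
          linarith
        have h7 : 0 ≤ d * (m ^ 1 * (Real.exp (-((y - 1) * m)) * Real.exp (-(1 * m)))) := by
          positivity
        have h8 : m ^ 2 * (Real.exp (-((y - 1) * m)) * Real.exp (-(1 * m)))
            ≤ Real.exp (-((y - 1) * d)) * (m ^ 2 * Real.exp (-(1 * m))) := by
          have : 0 < m ^ 2 * Real.exp (-(1 * m)) := by positivity
          nlinarith
        linarith
    have hlim : Tendsto (fun y => d + Real.exp (-((y - 1) * (d - b))) * (lap 2 μ₀ 1 / κ)) atTop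
        (𝓝 (d + 0 * (lap 2 μ₀ 1 / κ))) := by
      refine tendsto_const_nhds.add (Tendsto.mul_const _
        (Real.tendsto_exp_neg_atTop_nhds_zero.comp ?_))
      exact (tendsto_atTop_add_const_right _ (-1) tendsto_id).atTop_mul_const (sub_pos.2 hb2)
    rw [zero_mul, add_zero] at hlim
    filter_upwards [hlim.eventually (gt_mem_nhds hd2), eventually_ge_atTop 1] with y hy1 hy
    refine lt_of_le_of_lt ?_ hy1
    have hpos := h₀.lap_pos hne (n := 1) le_rfl (by linarith : 0 < y)
    rw [div_le_iff₀ hpos, add_mul]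
    have h1 := hup y hy
    have h2 := mul_le_mul_of_nonneg_left (hlow y hy) (show 0 ≤ Real.exp (-((y - 1) * (d - b))) *
      (lap 2 μ₀ 1 / κ) from mul_nonneg (Real.exp_pos _).le
        (div_nonneg (lap_nonneg h₀.toIsRadonOnPos _ _) hκ.le))
    have h3 : Real.exp (-((y - 1) * (d - b))) * (lap 2 μ₀ 1 / κ) *
        (Real.exp (-((y - 1) * b)) * κ) = Real.exp (-((y - 1) * d)) * lap 2 μ₀ 1 := by
      have : Real.exp (-((y - 1) * d)) = Real.exp (-((y - 1) * (d - b))) *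
          Real.exp (-((y - 1) * b)) := by
        rw [← Real.exp_add]; ring_nf
      rw [this]
      field_simp
    linarith

end IsAdmissible

/-! ### The mass of the solution -/

namespace IsTransported

lemma continuousOn_mass (hμ : IsTransported μ₀ μ) (h₀ : IsAdmissible μ₀) (hne : μ₀ ≠ 0) :
    ContinuousOn (fun t => mass (μ t)) (Ici 0) :=
  (h₀.continuousOn_lapE_foot hne).congr fun _ ht => hμ.mass_eq ht

lemma mass_eq_initial (hμ : IsTransported μ₀ μ) (h₀ : IsAdmissible μ₀) (hne : μ₀ ≠ 0)
    (ht : t ∈ Icc 0 (gelTime μ₀)) : mass (μ t) = mass μ₀ := by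
  rw [hμ.mass_eq ht.1, h₀.foot_eq_zero hne ht.1 ht.2, mass_eq_lapE]

lemma strictAntiOn_mass (hμ : IsTransported μ₀ μ) (h₀ : IsAdmissible μ₀) (hne : μ₀ ≠ 0) :
    StrictAntiOn (fun t => mass (μ t)) (Ici (gelTime μ₀)) := by
  intro s hs t ht hst
  simp only
  rw [hμ.mass_eq ((gelTime_nonneg μ₀).trans hs), hμ.mass_eq ((gelTime_nonneg μ₀).trans ht)]
  exact h₀.lapE_one_lt hne (foot_nonneg _ _) (h₀.foot_strictMonoOn hne hs ht hst)

lemma analyticOn_mass (hμ : IsTransported μ₀ μ) (h₀ : IsAdmissible μ₀) (hne : μ₀ ≠ 0) :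
    AnalyticOn ℝ (fun t => (mass (μ t)).toReal) (Ici 0 \ {gelTime μ₀}) := by
  intro t ht
  rcases lt_or_gt_of_ne (show t ≠ gelTime μ₀ from ht.2) with h | h
  · refine (analyticWithinAt_const (v := (mass μ₀).toReal)).congr_of_eventuallyEq ?_ ?_
    · filter_upwards [self_mem_nhdsWithin, mem_nhdsWithin_of_mem_nhds (gt_mem_nhds h)] with r hr hr2
      rw [hμ.mass_eq_initial h₀ hne ⟨hr.1, hr2.le⟩]
    · rw [hμ.mass_eq_initial h₀ hne ⟨ht.1, h.le⟩]
  · have h1 : AnalyticAt ℝ (fun t => lap 1 μ₀ (foot μ₀ t)) t :=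
      (h₀.analyticAt_lap le_rfl (h₀.foot_pos hne h)).comp (h₀.analyticAt_foot hne h)
    refine (h1.congr ?_).analyticWithinAt
    filter_upwards [lt_mem_nhds ((gelTime_nonneg μ₀).trans_lt h)] with r hr
    exact (hμ.mass_toReal h₀ hr.le).symm

lemma coe_mass (hμ : IsTransported μ₀ μ) (h₀ : IsAdmissible μ₀) (ht : 0 ≤ t)
    (hM : mass (μ t) ≠ ∞) : (mass (μ t) : EReal) = (lap 1 μ₀ (foot μ₀ t) : ℝ) := by
  rw [← hμ.mass_toReal h₀ ht]
  lift mass (μ t) to NNReal using hM with r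
  rfl

/-- The right derivative of the mass at the gelation time, by L'Hôpital's rule. If the initial mass
is infinite, then both sides are `-∞`. -/
lemma tendsto_right_slope (hμ : IsTransported μ₀ μ) (h₀ : IsAdmissible μ₀) (hne : μ₀ ≠ 0)
    {ν : EReal}
    (hν : Tendsto (fun t => ((-(lap 2 μ₀ (foot μ₀ t) ^ 3 / lap 3 μ₀ (foot μ₀ t)) : ℝ) : EReal))
      (𝓝[>] (gelTime μ₀)) (𝓝 ν)) :
    Tendsto (fun t : ℝ => ((mass (μ t) : EReal) - (mass (μ (gelTime μ₀)) : EReal)) /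
      ((t - gelTime μ₀ : ℝ) : EReal)) (𝓝[>] (gelTime μ₀)) (𝓝 ν) := by
  have hT := gelTime_nonneg μ₀
  set T := gelTime μ₀ with hTdef
  let M : ℝ → ℝ := fun t => lap 1 μ₀ (foot μ₀ t)
  have hcoe : ∀ t, T < t → (mass (μ t) : EReal) = (M t : ℝ) := fun t ht =>
    hμ.coe_mass h₀ (hT.trans ht.le) (hμ.mass_lt_top h₀ hne (hT.trans_lt ht)).ne
  have hder : ∀ t, T < t →
      HasDerivAt M (-(lap 2 μ₀ (foot μ₀ t) ^ 3 / lap 3 μ₀ (foot μ₀ t))) t := fun t ht =>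
    h₀.hasDerivAt_lap_foot hne ht
  have hmass : Tendsto (fun t => mass (μ t)) (𝓝[>] T) (𝓝 (mass (μ T))) :=
    ((hμ.continuousOn_mass h₀ hne) T hT).mono (Ioi_subset_Ici hT)
  by_cases hM : mass (μ T) = ∞
  · -- a real lower bound `c` of the derivative would keep the mass bounded near the gelation time
    have hbot : ν = ⊥ := by
      by_contra hcon
      obtain ⟨c, hc1, hc2⟩ := EReal.lt_iff_exists_real_btwn.1 (bot_lt_iff_ne_bot.2 hcon)
      obtain ⟨δ, hδ, hsub⟩ := mem_nhdsGT_iff_exists_Ioo_subset.1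
        (hν.eventually (lt_mem_nhds hc2))
      rw [mem_Ioi] at hδ
      have hmono : MonotoneOn (fun t => M t - c * t) (Ioo T δ) := by
        have hd : ∀ t ∈ Ioo T δ, HasDerivAt (fun t => M t - c * t)
            (-(lap 2 μ₀ (foot μ₀ t) ^ 3 / lap 3 μ₀ (foot μ₀ t)) - c * 1) t := fun t ht =>
          (hder t ht.1).sub ((hasDerivAt_id t).const_mul c)
        refine monotoneOn_of_deriv_nonneg (convex_Ioo T δ)
          (fun t ht => (hd t ht).continuousAt.continuousWithinAt)
          (fun t ht => ?_) fun t ht => ?_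
        · rw [interior_Ioo] at ht
          exact (hd t ht).differentiableAt.differentiableWithinAt
        · rw [interior_Ioo] at ht
          rw [(hd t ht).deriv]
          have h1 : (c : EReal) < _ := hsub ht
          have h2 := EReal.coe_lt_coe_iff.1 h1
          linarith
      obtain ⟨s, hs⟩ := exists_between hδ
      have hev : ∀ᶠ t in 𝓝[>] T, mass (μ t) ≤ ENNReal.ofReal (M s - c * s + |c| * δ) := by
        filter_upwards [Ioo_mem_nhdsGT hs.1] with t ht
        have h1 := hmono ⟨ht.1, ht.2.trans hs.2⟩ hs ht.2.le
        simp only at h1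
        have h0 : 0 ≤ t := hT.trans ht.1.le
        rw [← ENNReal.ofReal_toReal (hμ.mass_lt_top h₀ hne (hT.trans_lt ht.1)).ne,
          hμ.mass_toReal h₀ h0]
        refine ENNReal.ofReal_le_ofReal ?_
        have h2 : c * t ≤ |c| * δ := (mul_le_mul_of_nonneg_right (le_abs_self c) h0).trans
          (mul_le_mul_of_nonneg_left (ht.2.trans hs.2).le (abs_nonneg c))
        change M t ≤ _
        linarith
      have := le_of_tendsto hmass hev
      rw [hM] at this
      exact ENNReal.ofReal_ne_top (top_le_iff.1 this)
    rw [hbot]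
    refine tendsto_const_nhds.congr' ?_
    filter_upwards [self_mem_nhdsWithin] with t ht
    rw [hcoe t ht, hM, EReal.coe_ennreal_top, EReal.sub_top,
      EReal.bot_div_of_pos_ne_top (by exact_mod_cast sub_pos.2 ht) (EReal.coe_ne_top _)]
  · have hcT : (mass (μ T) : EReal) = (M T : ℝ) := hμ.coe_mass h₀ hT hM
    have hMc : Tendsto M (𝓝[>] T) (𝓝 (M T)) := by
      have h1 := (ENNReal.tendsto_toReal hM).comp hmass
      rw [hμ.mass_toReal h₀ hT] at h1
      refine h1.congr' ?_
      filter_upwards [self_mem_nhdsWithin] with t ht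
      exact hμ.mass_toReal h₀ (hT.trans (le_of_lt ht))
    -- the target filter `comap` of `𝓝 ν` covers finite and infinite limits at once
    have hlop := HasDerivAt.lhopital_zero_nhdsGT (a := T) (f := fun t => M t - M T)
      (g := fun t => t - T) (g' := fun _ => 1)
      (f' := fun t => -(lap 2 μ₀ (foot μ₀ t) ^ 3 / lap 3 μ₀ (foot μ₀ t)))
      (l := comap Real.toEReal (𝓝 ν))
      (by filter_upwards [self_mem_nhdsWithin] with t ht using (hder t ht).sub_const _)
      (Eventually.of_forall fun t => (hasDerivAt_id t).sub_const _)
      (Eventually.of_forall fun t => one_ne_zero)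
      (by simpa using hMc.sub_const (M T))
      (by
        have : Tendsto (fun t => t - T) (𝓝 T) (𝓝 (T - T)) := (continuous_sub_right T).tendsto T
        rw [sub_self] at this
        exact this.mono_left nhdsWithin_le_nhds)
      (by simpa [tendsto_comap_iff, Function.comp_def] using hν)
    rw [tendsto_comap_iff] at hlop
    refine hlop.congr' ?_
    filter_upwards [self_mem_nhdsWithin] with t ht
    rw [hcoe t ht, hcT, ← EReal.coe_sub, ← EReal.coe_div]
    rfl

lemma tendsto_atTop (hμ : IsTransported μ₀ μ) (h₀ : IsAdmissible μ₀) (hne : μ₀ ≠ 0) :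
    Tendsto (fun t : ℝ => 1 / (t * (mass (μ t)).toReal)) atTop (𝓝 (sInf μ₀.support)) := by
  refine ((h₀.tendsto_lap_two_div_lap_one hne).comp (h₀.tendsto_foot_atTop hne)).congr' ?_
  filter_upwards [eventually_gt_atTop (gelTime μ₀)] with t ht
  have ht0 := (gelTime_nonneg μ₀).trans_lt ht
  have hl := h₀.foot_pos hne ht
  have h1 := h₀.mul_lap_foot hne ht0.le hl
  have h2 := h₀.lap_pos hne (n := 1) le_rfl hl
  simp only [Function.comp]
  rw [hμ.mass_toReal h₀ ht0.le]
  field_simp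
  linarith

lemma congr {μ' : ℝ → Measure ℝ} (hμ : IsTransported μ₀ μ) (h : ∀ t, 0 ≤ t → μ' t = μ t) :
    IsTransported μ₀ μ' where
  initial := by rw [h 0 le_rfl, hμ.initial]
  admissible t ht := by rw [h t ht]; exact hμ.admissible t ht
  lapE_eq t ht := by rw [h t ht.le]; exact hμ.lapE_eq t ht

end IsTransported

end

end Smoluchowski

end

/-! ### Well-posedness and properties of the solution -/

theorem mainTheorem2 (μ₀ : Measure ℝ) (hμ₀ : Smoluchowski.IsRadonOnPos μ₀) (hne : μ₀ ≠ 0)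
    (hmin : ∫⁻ m, ENNReal.ofReal (min m 1) ∂μ₀ < ∞) :
    -- the objects attached to the initial measure are well defined
    (0 < Smoluchowski.mass μ₀ ∧ 0 < Smoluchowski.secondMoment μ₀ ∧
      (∀ x ∈ Ico (0 : ℝ) 1, Integrable (fun m : ℝ => m * x ^ m) μ₀) ∧
      AnalyticOn ℝ (Smoluchowski.genFun μ₀) (Ioo 0 1)) ∧
    -- existence and uniqueness of the global solution
    (∃ μ : ℝ → Measure ℝ, Smoluchowski.IsSolution μ₀ μ ∧
      ∀ μ' : ℝ → Measure ℝ, Smoluchowski.IsSolution μ₀ μ' → ∀ t : ℝ, 0 ≤ t → μ' t = μ t) ∧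
    -- properties of the solution
    ∀ μ : ℝ → Measure ℝ, Smoluchowski.IsSolution μ₀ μ →
      -- the total mass
      (ContinuousOn (fun t => Smoluchowski.mass (μ t)) (Ici 0) ∧
        (∀ t : ℝ, 0 < t → Smoluchowski.mass (μ t) < ∞) ∧
        (∀ t ∈ Icc 0 (Smoluchowski.gelTime μ₀),
          Smoluchowski.mass (μ t) = Smoluchowski.mass μ₀) ∧
        StrictAntiOn (fun t => Smoluchowski.mass (μ t)) (Ici (Smoluchowski.gelTime μ₀)) ∧
        AnalyticOn ℝ (fun t => (Smoluchowski.mass (μ t)).toReal)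
          (Ici 0 \ {Smoluchowski.gelTime μ₀})) ∧
      -- the right derivative of the mass at the gelation time
      (∀ ν : EReal,
        Tendsto
          (fun x : ℝ => ((-(deriv (Smoluchowski.genFun μ₀) x ^ 3 /
            (deriv (Smoluchowski.genFun μ₀) x +
              x * deriv (deriv (Smoluchowski.genFun μ₀)) x)) : ℝ) : EReal))
          (𝓝[<] 1) (𝓝 ν) →
        ν ≤ 0 ∧
        Tendsto
          (fun t : ℝ => ((Smoluchowski.mass (μ t) : EReal) -
              (Smoluchowski.mass (μ (Smoluchowski.gelTime μ₀)) : EReal)) /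
            ((t - Smoluchowski.gelTime μ₀ : ℝ) : EReal))
          (𝓝[>] (Smoluchowski.gelTime μ₀)) (𝓝 ν)) ∧
      -- the long-time behaviour of the mass
      Tendsto (fun t : ℝ => 1 / (t * (Smoluchowski.mass (μ t)).toReal)) atTop
        (𝓝 (sInf μ₀.support)) ∧
      -- the second moment
      (∀ t ∈ Ico 0 (Smoluchowski.gelTime μ₀), Smoluchowski.secondMoment (μ t) < ∞) ∧
      (∀ t ∈ Ici (Smoluchowski.gelTime μ₀), Smoluchowski.secondMoment (μ t) = ∞) := by
  have h₀ : Smoluchowski.IsAdmissible μ₀ := ⟨hμ₀, hmin⟩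
  obtain ⟨μ, hμ⟩ := h₀.exists_transported hne
  have hs := hμ.isSolution h₀ hne
  have huniq : ∀ μ' : ℝ → Measure ℝ, Smoluchowski.IsSolution μ₀ μ' → ∀ t : ℝ, 0 ≤ t →
      μ' t = μ t := fun μ' hs' t ht => hs'.unique hs h₀ ht
  refine ⟨⟨?_, ?_, fun x hx => h₀.integrable_mul_rpow hx, h₀.analyticOn_genFun⟩, ⟨μ, hs, huniq⟩,
    fun μ' hs' => ?_⟩
  · rw [Smoluchowski.mass_eq_lapE]
    exact hμ₀.lapE_pos hne 1 0
  · rw [Smoluchowski.secondMoment_eq_lapE]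
    exact hμ₀.lapE_pos hne 2 0
  · have hμ' := hμ.congr (huniq μ' hs')
    refine ⟨⟨hμ'.continuousOn_mass h₀ hne, fun t ht => hμ'.mass_lt_top h₀ hne ht,
      fun t ht => hμ'.mass_eq_initial h₀ hne ht, hμ'.strictAntiOn_mass h₀ hne,
      hμ'.analyticOn_mass h₀ hne⟩, fun ν hν => ?_, hμ'.tendsto_atTop h₀ hne, fun t ht => ?_,
      fun t ht => hμ'.secondMoment_eq_top h₀ hne ht⟩
    · have hν' := h₀.tendsto_deriv_mass hne hν
      exact ⟨h₀.limit_nonpos hν', hμ'.tendsto_right_slope h₀ hne hν'⟩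
    · exact (hμ'.secondMoment_le h₀ hne ht.1 ht.2).trans_lt ENNReal.ofReal_lt_top
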